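/- Let $\alpha,\beta$ be real numbers with $\alpha\beta=2$ and $\beta\ge 1$ (so $0<\alpha\le 2$). Let $(\varepsilon_n)_{n\in\mathbb Z}$ be i.i.d. real random variables whose common law belongs to the domain of attraction of a (non-degenerate) $\alpha$-stable law; assume that $\varepsilon_0$ is symmetric if $\alpha=1$ and that $\mathbb E\,\varepsilon_0=0$ if $\alpha>1$. Let $\phi_\varepsilon(u)=\mathbb E\,e^{iu\varepsilon_0}$. A function $f:(0,\infty)\to(0,\infty)$ is called slowly varying if it is measurable and $\lim_{t\to\infty} f(ct)/f(t)=1$ for every $c>0$. Define $H$ as follows. If $\alpha<2$, let $H=h$, where $h$ is any slowly varying function for which there are $\sigma_1,\sigma_2\ge 0$ with $\sigma_1+\sigma_2>0$ such that, as $x\to\infty$, $$\mathbb P(\varepsilon_0\le -x)=(\sigma_1+o(1))\,x^{-\alpha}h(x),\qquad \mathbb P(\varepsilon_0> x)=(\sigma_2+o(1))\,x^{-\alpha}h(x).$$ If $\alpha=2$, let $$H(t)=-\int_{(0,t]} s^2\,d\,\mathbb P(|\varepsilon_0|>s)=\mathbb E\big[\varepsilon_0^2\,\mathbf 1_{\{|\varepsilon_0|\le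 t\}}\big].$$ Let $a_j=j^{-\beta}\ell(j)$ for $j\ge 1$, where $\ell$ is slowly varying, and let $X_n=\sum_{j=1}^\infty a_j\varepsilon_{n-j}$. Let $K:\mathbb R\to\mathbb R$ and assume * (A1) $K$ is integrable and square integrable with respect to Lebesgue measure on $\mathbb R$; * (A2) there are constants $c,\delta>0$ such that $|\phi_\varepsilon(u)|\le \dfrac{c}{1+|u|^\delta}$ for all $u\in\mathbb R$; * (short memory) $\displaystyle\sum_{j=1}^\infty a_j^{\alpha/2}\,H(a_j^{-1})^{1/2}<\infty$. Then the series defining $X_n$ converges absolutely almost surely and $\mathbb E\,K(X_n)^2<\infty$ for every $n$, and, writing $S_M=\sum_{n=1}^{M}\big(K(X_n)-\mathbb E\,K(X_n)\big)$, the limit $$\theta^2=\lim_{N\to\infty}N^{-1}\operatorname{Var}(S_N)$$ exists and is finite, and, as $N\to\infty$, $$\big\{N^{-1/2}S_{\lfloor Nt\rfloor}:t\ge 0\big\}\longrightarrow\big\{|\theta|\,W_t:t\ge 0\big\}$$ in the sense of finite-dimensional distributions, where $W$ is a standard Brownian motion. -/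

import Mathlib

open MeasureTheory ProbabilityTheory Filter Topology
open scoped NNReal

noncomputable section

/-- `f : (0,∞) → (0,∞)` is slowly varying at infinity (values of `f` outside `(0,∞)` are
irrelevant). As usual in the theory of regular variation, measurability is included. -/
structure IsSlowlyVarying (f : ℝ → ℝ) : Prop where
  pos : ∀ t, 0 < t → 0 < f t
  measurable : Measurable (fun t : Set.Ioi (0 : ℝ) => f t)
  tendsto : ∀ c : ℝ, 0 < c → Tendsto (fun t => f (c * t) / f t) atTop (𝓝 1)

/-- `μ` is a (non-degenerate) `α`-stable law on `ℝ`, `0 < α ≤ 2`: for a scale `s > 0`, a skewness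
`b ∈ [-1,1]` and a shift `m`, its characteristic function is
`exp (i m u - s |u|^α (1 - i b sgn(u) tan(πα/2)))` if `α ≠ 1`, and
`exp (i m u - s |u| (1 + i b (2/π) sgn(u) log|u|))` if `α = 1`. -/
def IsStableLaw (α : ℝ) (μ : Measure ℝ) : Prop :=
  ∃ s b m : ℝ, 0 < s ∧ |b| ≤ 1 ∧ ∀ u : ℝ,
    charFun μ u = Complex.exp
      (Complex.I * ((m * u : ℝ) : ℂ) - ((s * |u| ^ α : ℝ) : ℂ) *
        (1 - Complex.I * ((b * SignType.sign u *
          (if α = 1 then -(2 / Real.pi) * Real.log |u|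
            else Real.tan (Real.pi * α / 2)) : ℝ) : ℂ)))

/-- `ν` belongs to the domain of attraction of an `α`-stable law: if `x 0, x 1, …` are
independent with law `ν`, then for suitable `A n > 0` and `B n`,
`(x 0 + ⋯ + x (n - 1) - B n) / A n` converges in distribution to an `α`-stable law. -/
def InDomainOfAttraction (α : ℝ) (ν : Measure ℝ) [IsProbabilityMeasure ν] : Prop :=
  ∃ (μ : Measure ℝ) (_ : IsProbabilityMeasure μ) (A B : ℕ → ℝ),
    IsStableLaw α μ ∧ (∀ n, 0 < A n) ∧
      TendstoInDistribution (Ω := fun n : ℕ => Fin n → ℝ)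
        (fun n x => ((∑ i, x i) - B n) / A n) atTop (fun y : ℝ => y)
        (fun n => Measure.pi (fun _ : Fin n => ν)) μ

/-- The tails of `ν` are `ν (-∞,-x] = (σ₁ + o(1)) x^(-α) h(x)` and
`ν (x,∞) = (σ₂ + o(1)) x^(-α) h(x)` as `x → ∞`, with `σ₁, σ₂ ≥ 0`, `σ₁ + σ₂ > 0` and `h` positive
and slowly varying. -/
structure HasStableTails (α : ℝ) (ν : Measure ℝ) (σ₁ σ₂ : ℝ) (h : ℝ → ℝ) : Prop where
  nonneg₁ : 0 ≤ σ₁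
  nonneg₂ : 0 ≤ σ₂
  pos : 0 < σ₁ + σ₂
  slowlyVarying : IsSlowlyVarying h
  left : Tendsto (fun x : ℝ => ν.real (Set.Iic (-x)) / (x ^ (-α) * h x)) atTop (𝓝 σ₁)
  right : Tendsto (fun x : ℝ => ν.real (Set.Ioi x) / (x ^ (-α) * h x)) atTop (𝓝 σ₂)

/-- The slowly varying function `H` of the innovation law `ν`. For `α < 2` it is `h`. For `α = 2`
it is `-∫_{(0,t]} s² dT(s)`, where `T(s) = ν {y | s < |y|} = h(s) / s²` is the tail function; as
`-dT` is the law of `|y|` under `ν`, this is the truncated second moment of `ν`. -/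
def innovH (α : ℝ) (ν : Measure ℝ) (h : ℝ → ℝ) (t : ℝ) : ℝ :=
  if α < 2 then h t else ∫ s in Set.Ioc 0 t, s ^ 2 ∂(ν.map (fun y : ℝ => |y|))

/-- The coefficients `a_j = j^(-β) ℓ(j)`, for `j ≥ 1`. -/
def coeff (β : ℝ) (ℓ : ℝ → ℝ) (j : ℕ) : ℝ := (j : ℝ) ^ (-β) * ℓ j

/-- The linear process `X_n = ∑_{j ≥ 1} a_j ε_{n-j}` (the summation index is `j - 1`). -/
def linearProcess {Ω : Type*} (a : ℕ → ℝ) (ε : ℤ → Ω → ℝ) (n : ℕ) (ω : Ω) : ℝ :=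
  ∑' i : ℕ, a (i + 1) * ε ((n : ℤ) - ((i : ℤ) + 1)) ω

/-- The partial sum `S_M = ∑_{n=1}^M (K(X_n) - E K(X_n))`. -/
def partialSum {Ω : Type*} [MeasurableSpace Ω] (P : Measure Ω) (K : ℝ → ℝ) (X : ℕ → Ω → ℝ)
    (M : ℕ) (ω : Ω) : ℝ :=
  ∑ n ∈ Finset.Icc 1 M, (K (X n ω) - ∫ ω', K (X n ω') ∂P)

/-- Convergence of the processes `Y N`, as `N → ∞`, to the process `Z` in the sense of finite
dimensional distributions. -/
def TendstoFDD {Ω Ω' : Type*} [MeasurableSpace Ω] [MeasurableSpace Ω']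
    (Y : ℕ → ℝ≥0 → Ω → ℝ) (Z : ℝ≥0 → Ω' → ℝ)
    (P : Measure Ω) [IsProbabilityMeasure P] (P' : Measure Ω') [IsProbabilityMeasure P'] : Prop :=
  ∀ I : Finset ℝ≥0, TendstoInDistribution
    (fun N ω (t : I) => Y N t ω) atTop (fun ω (t : I) => Z t ω) (fun _ => P) P'

end

/-- `μ` has a density bounded by `C`, and convolution with `μ` maps integrable functions to
Lipschitz ones, with constant `C` times the `L¹` norm. -/
structure IsSmoothing (C : ℝ≥0) (μ : Measure ℝ) : Prop where
  le_volume : μ ≤ C • (volume : Measure ℝ)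
  lipschitz : ∀ K : ℝ → ℝ, Integrable K → ∀ x x' : ℝ,
    |∫ y, K (x + y) ∂μ - ∫ y, K (x' + y) ∂μ| ≤ C * (∫ y, |K y|) * |x - x'|

section Smoothing

open scoped SchwartzMap FourierTransform

lemma integral_schwartz_eq_integral_charFun (g : 𝓢(ℝ, ℂ)) (μ : Measure ℝ) [IsProbabilityMeasure μ]
    (x : ℝ) : ∫ y, g (x + y) ∂μ =
      ∫ w, 𝓕 (g : ℝ → ℂ) w * Complex.exp (2 * Real.pi * w * x * Complex.I) *
        charFun μ (2 * Real.pi * w) := by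
  have hinv : ∀ z, g z =
      ∫ w, 𝓕 (g : ℝ → ℂ) w * Complex.exp (2 * Real.pi * w * z * Complex.I) := by
    intro z
    have h : 𝓕⁻ (𝓕 (g : ℝ → ℂ)) = g := g.continuous.fourierInv_fourier_eq g.integrable
      (by rw [← SchwartzMap.fourier_coe]; exact (𝓕 g).integrable)
    conv_lhs => rw [← h]
    rw [Real.fourierInv_eq']
    congr 1 with w
    rw [smul_eq_mul, mul_comm]
    congr 2
    simp
    ring
  have hint : Integrable (𝓕 (g : ℝ → ℂ)) := by
    rw [← SchwartzMap.fourier_coe]; exact (𝓕 g).integrable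
  simp_rw [hinv]
  rw [integral_integral_swap]
  · congr 1 with w
    rw [charFun_apply_real, ← integral_const_mul]
    congr 1 with y
    rw [mul_assoc (𝓕 (g : ℝ → ℂ) w), ← Complex.exp_add]
    congr 2
    push_cast
    ring
  · refine (hint.comp_snd μ).mul_bdd (c := 1) ?_ ?_
    · exact Continuous.aestronglyMeasurable (by fun_prop)
    · filter_upwards with p
      rw [show (2 * Real.pi * (p.2 : ℂ) * ((x + p.1 : ℝ) : ℂ) * Complex.I) =
        ((2 * Real.pi * p.2 * (x + p.1) : ℝ) : ℂ) * Complex.I by push_cast; ring,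
        Complex.norm_exp_ofReal_mul_I]

lemma norm_fourier_le (g : ℝ → ℂ) (w : ℝ) : ‖𝓕 g w‖ ≤ ∫ y, ‖g y‖ :=
  VectorFourier.norm_fourierIntegral_le_integral_norm _ _ _ _ _

variable {Φ : ℝ → ℝ} {μ : Measure ℝ} [IsProbabilityMeasure μ]

lemma norm_integral_schwartz_le (g : 𝓢(ℝ, ℂ)) (hΦ : Integrable Φ)
    (hμ : ∀ u, ‖charFun μ u‖ ≤ Φ u) :
    ‖∫ y, g y ∂μ‖ ≤ (∫ w, Φ (2 * Real.pi * w)) * ∫ y, ‖g y‖ := by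
  have h := integral_schwartz_eq_integral_charFun g μ 0
  simp only [zero_add] at h
  rw [h, ← integral_mul_const]
  refine norm_integral_le_of_norm_le ((hΦ.comp_mul_left' (by positivity)).mul_const _) ?_
  filter_upwards with w
  rw [norm_mul, norm_mul]
  simp only [Complex.ofReal_zero, mul_zero, zero_mul, Complex.exp_zero, norm_one, mul_one]
  rw [mul_comm]
  exact mul_le_mul (hμ _) (norm_fourier_le _ _) (norm_nonneg _) ((norm_nonneg _).trans (hμ _))

lemma norm_integral_schwartz_sub_le (g : 𝓢(ℝ, ℂ)) (hΦ : Integrable (fun u => |u| * Φ u))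
    (hμ : ∀ u, ‖charFun μ u‖ ≤ Φ u) (x x' : ℝ) :
    ‖∫ y, g (x + y) ∂μ - ∫ y, g (x' + y) ∂μ‖ ≤
      (∫ w, |2 * Real.pi * w| * Φ (2 * Real.pi * w)) * (∫ y, ‖g y‖) * |x - x'| := by
  have hint : ∀ x : ℝ, Integrable (fun w =>
      𝓕 (g : ℝ → ℂ) w * Complex.exp (2 * Real.pi * w * x * Complex.I) *
        charFun μ (2 * Real.pi * w)) := by
    intro x
    have h : Integrable (𝓕 (g : ℝ → ℂ)) := by
      rw [← SchwartzMap.fourier_coe]; exact (𝓕 g).integrable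
    refine (h.mul_bdd (c := 1) ?_ ?_).mul_bdd (c := 1) ?_ ?_
    · exact Continuous.aestronglyMeasurable (by fun_prop)
    · filter_upwards with w
      rw [show (2 * Real.pi * (w : ℂ) * (x : ℂ) * Complex.I) =
        ((2 * Real.pi * w * x : ℝ) : ℂ) * Complex.I by push_cast; ring,
        Complex.norm_exp_ofReal_mul_I]
    · exact (measurable_charFun.comp (measurable_const_mul _)).aestronglyMeasurable
    · filter_upwards with w using norm_charFun_le_one _
  rw [integral_schwartz_eq_integral_charFun, integral_schwartz_eq_integral_charFun,
    ← integral_sub (hint x) (hint x'), mul_assoc, ← integral_mul_const]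
  refine norm_integral_le_of_norm_le
    ((hΦ.comp_mul_left' (R := 2 * Real.pi) (by positivity)).mul_const _) ?_
  filter_upwards with w
  rw [← sub_mul, ← mul_sub, norm_mul, norm_mul]
  have hexp : ‖Complex.exp (2 * Real.pi * w * x * Complex.I) -
      Complex.exp (2 * Real.pi * w * x' * Complex.I)‖ ≤ |2 * Real.pi * w| * |x - x'| := by
    have h := Real.norm_exp_I_mul_ofReal_sub_one_le (x := 2 * Real.pi * w * (x - x'))
    rw [Real.norm_eq_abs, abs_mul] at h
    have heq : Complex.exp (2 * Real.pi * w * x * Complex.I) -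
        Complex.exp (2 * Real.pi * w * x' * Complex.I) =
        Complex.exp ((2 * Real.pi * w * x' : ℝ) * Complex.I) *
        (Complex.exp (Complex.I * (2 * Real.pi * w * (x - x') : ℝ)) - 1) := by
      rw [mul_sub, ← Complex.exp_add, mul_one]
      congr 2 <;> push_cast <;> ring
    rw [heq, norm_mul, Complex.norm_exp_ofReal_mul_I, one_mul]
    exact h
  calc _ ≤ ((∫ y, ‖g y‖) * (|2 * Real.pi * w| * |x - x'|)) * Φ (2 * Real.pi * w) := by
        gcongr
        · exact norm_fourier_le _ _
        · exact hμ _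
    _ = _ := by ring

lemma le_smul_volume_of_norm_charFun_le (hΦ : Integrable Φ) (hμ : ∀ u, ‖charFun μ u‖ ≤ Φ u)
    {C : ℝ≥0} (hC : ∫ w, Φ (2 * Real.pi * w) ≤ C) : μ ≤ C • (volume : Measure ℝ) := by
  have hcpt : ∀ K U : Set ℝ, IsCompact K → IsOpen U → K ⊆ U → Bornology.IsBounded U →
      μ K ≤ C * volume U := by
    intro K U hK hU hKU hUb
    obtain ⟨f, hf0, hf1, hf⟩ := exists_contMDiffMap_zero_one_of_isClosed (n := ⊤)
      (modelWithCornersSelf ℝ ℝ) hU.isClosed_compl hK.isClosed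
      (Set.disjoint_left.2 fun x hx hxK => hx (hKU hxK))
    have hfc : HasCompactSupport (fun x => ((f x : ℝ) : ℂ)) := by
      refine HasCompactSupport.of_support_subset_isCompact hUb.isCompact_closure ?_
      intro x hx
      refine subset_closure ?_
      by_contra hxU
      exact hx (by simp [hf0 (show x ∈ Uᶜ from hxU)])
    have hfs : ContDiff ℝ ((⊤ : ℕ∞) : WithTop ℕ∞) (fun x => ((f x : ℝ) : ℂ)) :=
      Complex.ofRealCLM.contDiff.comp f.contMDiff.contDiff
    have key := norm_integral_schwartz_le (hfc.toSchwartzMap hfs) hΦ hμ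
    simp only [HasCompactSupport.toSchwartzMap_toFun, Complex.norm_real] at key
    have hfnn : ∀ x, 0 ≤ f x := fun x => (hf x).1
    simp only [Real.norm_eq_abs, abs_of_nonneg (hfnn _)] at key
    rw [integral_complex_ofReal, Complex.norm_real, Real.norm_eq_abs,
      abs_of_nonneg (integral_nonneg hfnn)] at key
    have hfcont : Continuous (fun x => f x) := f.contMDiff.continuous
    have h1 : μ.real K ≤ ∫ x, f x ∂μ := by
      rw [← integral_indicator_one hK.measurableSet]
      refine integral_mono ?_ ?_ ?_
      · exact (integrable_indicator_iff hK.measurableSet).2 (integrable_const 1).integrableOn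
      · refine Integrable.of_bound hfcont.aestronglyMeasurable 1 ?_
        filter_upwards with x
        rw [Real.norm_eq_abs, abs_of_nonneg (hfnn x)]
        exact (hf x).2
      · intro x
        by_cases hx : x ∈ K
        · simp [hx, hf1 hx]
        · simp [hx, hfnn x]
    have hUfin : volume U < ⊤ := hUb.measure_lt_top
    have h2 : ∫ x, f x ≤ volume.real U := by
      rw [← integral_indicator_one hU.measurableSet]
      refine integral_mono_of_nonneg (Eventually.of_forall hfnn) ?_ (Eventually.of_forall ?_)
      · exact (integrable_indicator_iff hU.measurableSet).2 (integrableOn_const hUfin.ne)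
      · intro x
        by_cases hx : x ∈ U
        · simpa [hx] using (hf x).2
        · simp [hx, hf0 (show x ∈ Uᶜ from hx)]
    have h3 : μ.real K ≤ C * volume.real U :=
      (h1.trans key).trans (mul_le_mul hC h2 (integral_nonneg hfnn) C.2)
    rw [← ENNReal.ofReal_toReal (measure_ne_top μ K),
      ← ENNReal.ofReal_toReal hUfin.ne, ← ENNReal.ofReal_coe_nnreal,
      ← ENNReal.ofReal_mul C.coe_nonneg]
    exact ENNReal.ofReal_le_ofReal h3
  have hcpt' : ∀ K : Set ℝ, IsCompact K → μ K ≤ C * volume K := by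
    intro K hK
    refine le_of_forall_gt fun r hr => ?_
    obtain ⟨V, hKV, hV, hVr⟩ := Set.exists_isOpen_lt_of_lt (μ := C • (volume : Measure ℝ)) K r
      hr
    obtain ⟨R, hR⟩ := hK.isBounded.subset_ball 0
    refine (hcpt K (V ∩ Metric.ball 0 R) hK (hV.inter Metric.isOpen_ball)
      (Set.subset_inter hKV hR) (Metric.isBounded_ball.subset Set.inter_subset_right)).trans_lt
      (lt_of_le_of_lt ?_ hVr)
    simp only [Measure.smul_apply, ENNReal.smul_def, smul_eq_mul]
    gcongr
    exact Set.inter_subset_left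
  refine Measure.le_iff.2 fun s hs => ?_
  rw [hs.measure_eq_iSup_isCompact μ]
  refine iSup₂_le fun K hK => iSup_le fun hKc => (hcpt' K hKc).trans ?_
  simp only [Measure.smul_apply, ENNReal.smul_def, smul_eq_mul]
  gcongr

lemma integral_comp_add_le_of_le_volume {μ : Measure ℝ} {C : ℝ≥0}
    (hμ : μ ≤ C • (volume : Measure ℝ)) {f : ℝ → ℝ} (hf : Integrable f) (hf0 : ∀ y, 0 ≤ f y)
    (x : ℝ) : ∫ y, f (x + y) ∂μ ≤ C * ∫ y, f y := by
  have hfx : Integrable (fun y => f (x + y)) := hf.comp_add_left x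
  refine (integral_mono_measure hμ (Eventually.of_forall fun y => hf0 _)
    (hfx.smul_measure_nnreal)).trans_eq ?_
  rw [integral_smul_nnreal_measure, integral_add_left_eq_self f x]
  rfl

lemma integrable_comp_add_of_le_volume {E : Type*} [NormedAddCommGroup E] {μ : Measure ℝ}
    {C : ℝ≥0} (hμ : μ ≤ C • (volume : Measure ℝ)) {f : ℝ → E} (hf : Integrable f)
    (x : ℝ) : Integrable (fun y => f (x + y)) μ :=
  (hf.comp_add_left x).smul_measure_nnreal.mono_measure hμ

theorem exists_isSmoothing (hΦ : Integrable Φ) (hΦ' : Integrable (fun u => |u| * Φ u)) :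
    ∃ C : ℝ≥0, ∀ (μ : Measure ℝ) [IsProbabilityMeasure μ], (∀ u, ‖charFun μ u‖ ≤ Φ u) →
      IsSmoothing C μ := by
  set C₁ : ℝ := ∫ w, Φ (2 * Real.pi * w)
  set C₂ : ℝ := ∫ w, |2 * Real.pi * w| * Φ (2 * Real.pi * w)
  refine ⟨(max C₁ C₂).toNNReal, fun μ _ hμ => ?_⟩
  have hC₁ : C₁ ≤ (max C₁ C₂).toNNReal := (le_max_left _ _).trans (Real.le_coe_toNNReal _)
  have hC₂ : C₂ ≤ (max C₁ C₂).toNNReal := (le_max_right _ _).trans (Real.le_coe_toNNReal _)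
  set C : ℝ≥0 := (max C₁ C₂).toNNReal
  have hle := le_smul_volume_of_norm_charFun_le hΦ hμ hC₁
  refine ⟨hle, fun K hK x x' => ?_⟩
  have hKc : Integrable (fun y => (K y : ℂ)) := hK.ofReal
  have happrox : ∀ δ > 0, ∃ g : 𝓢(ℝ, ℂ), ∫ y, ‖(K y : ℂ) - g y‖ ≤ δ := by
    intro δ hδ
    obtain ⟨g, hg⟩ := (SchwartzMap.denseRange_toLpCLM (F := ℂ) (μ := (volume : Measure ℝ))
      ENNReal.one_ne_top).exists_dist_lt ((memLp_one_iff_integrable.2 hKc).toLp _) hδ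
    refine ⟨g, ?_⟩
    rw [SchwartzMap.toLpCLM_apply, dist_eq_norm, L1.norm_eq_integral_norm] at hg
    refine le_of_eq_of_le (integral_congr_ae ?_) hg.le
    filter_upwards [Lp.coeFn_sub ((memLp_one_iff_integrable.2 hKc).toLp _) (g.toLp 1),
      (memLp_one_iff_integrable.2 hKc).coeFn_toLp, g.coeFn_toLp 1] with y h1 h2 h3
    rw [h1, Pi.sub_apply, h2, h3]
  have hδ : ∀ δ > 0, |∫ y, K (x + y) ∂μ - ∫ y, K (x' + y) ∂μ| ≤
      C * (∫ y, |K y|) * |x - x'| + δ * (C + C + C * |x - x'|) := by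
    intro δ hδ
    obtain ⟨g, hg⟩ := happrox δ hδ
    have hsub : ∀ z, ‖(∫ y, K (z + y) ∂μ : ℝ) - ∫ y, g (z + y) ∂μ‖ ≤ C * δ := by
      intro z
      rw [← integral_complex_ofReal, ← integral_sub
        (integrable_comp_add_of_le_volume hle hKc z)
        (integrable_comp_add_of_le_volume hle g.integrable z)]
      refine (norm_integral_le_integral_norm _).trans ?_
      refine (integral_comp_add_le_of_le_volume hle (f := fun y => ‖(K y : ℂ) - g y‖)
        (hKc.sub g.integrable).norm (fun y => norm_nonneg _) z).trans ?_
      gcongr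
    have hgn : ∫ y, ‖g y‖ ≤ (∫ y, |K y|) + δ := by
      have : ∫ y, ‖g y‖ ≤ ∫ y, (|K y| + ‖(K y : ℂ) - g y‖) := by
        refine integral_mono g.integrable.norm (hK.abs.add (hKc.sub g.integrable).norm) ?_
        intro y
        have := norm_sub_norm_le (g y) (K y : ℂ)
        rw [norm_sub_rev, Complex.norm_real, Real.norm_eq_abs] at this
        dsimp only
        linarith
      have hKg : Integrable (fun y => ‖(K y : ℂ) - g y‖) := (hKc.sub g.integrable).norm
      rw [integral_add hK.abs hKg] at this
      linarith
    have hlip := norm_integral_schwartz_sub_le g hΦ' hμ x x'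
    have hlip' : ‖∫ y, g (x + y) ∂μ - ∫ y, g (x' + y) ∂μ‖ ≤
        C * ((∫ y, |K y|) + δ) * |x - x'| := by
      refine hlip.trans ?_
      gcongr
    rw [← Real.norm_eq_abs, ← Complex.norm_real, Complex.ofReal_sub]
    calc _ = ‖((∫ y, K (x + y) ∂μ : ℝ) - ∫ y, g (x + y) ∂μ) -
          ((∫ y, K (x' + y) ∂μ : ℝ) - ∫ y, g (x' + y) ∂μ) +
          (∫ y, g (x + y) ∂μ - ∫ y, g (x' + y) ∂μ)‖ := by congr 1; ring
      _ ≤ C * δ + C * δ + C * ((∫ y, |K y|) + δ) * |x - x'| :=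
          (norm_add_le _ _).trans (add_le_add ((norm_sub_le _ _).trans
            (add_le_add (hsub x) (hsub x'))) hlip')
      _ = _ := by ring
  refine le_of_forall_pos_le_add fun η hη => ?_
  have hpos : 0 < (C : ℝ) + C + C * |x - x'| + 1 := by positivity
  refine (hδ (η / ((C : ℝ) + C + C * |x - x'| + 1)) (by positivity)).trans ?_
  gcongr
  rw [div_mul_eq_mul_div, div_le_iff₀ hpos]
  nlinarith

end Smoothing

section Projections

variable {H : Type*} [NormedAddCommGroup H] [InnerProductSpace ℝ H]

lemma norm_sum_sq_of_mem_of_inner_eq_zero (V : ℤ → Submodule ℝ H) (hV : Monotone V) (j : ℤ)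
    (x : ℕ → H) (hx : ∀ n : ℕ, x n ∈ V (n - j))
    (hx' : ∀ n : ℕ, ∀ y ∈ V (n - j - 1), inner ℝ y (x n) = 0) (N : ℕ) :
    ‖∑ n ∈ Finset.range N, x n‖ ^ 2 = ∑ n ∈ Finset.range N, ‖x n‖ ^ 2 := by
  induction N with
  | zero => simp
  | succ N ih =>
    rw [Finset.sum_range_succ, Finset.sum_range_succ, norm_add_sq_real, ih, hx' N, mul_zero,
      add_zero]
    refine Submodule.sum_mem _ fun n hn => hV ?_ (hx n)
    have := Finset.mem_range.1 hn
    omega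

/-- A sum of vectors adapted to an increasing family of subspaces is bounded by the sum over the
lags of the norms of the orthogonal increments at this lag. -/
theorem norm_sum_le_tsum_of_projections (V : ℤ → Submodule ℝ H)
    [∀ k, (V k).HasOrthogonalProjection] (hV : Monotone V) (N : ℕ) (D : ℕ → H)
    (hD : ∀ n : ℕ, D n ∈ V n)
    (htail : ∀ n : ℕ, Tendsto (fun j : ℕ => (V (n - j)).starProjection (D n)) atTop (𝓝 0))
    (Q : ℕ → ℝ) (hQ0 : ∀ j, 0 ≤ Q j) (hQ : Summable Q)
    (hDQ : ∀ j : ℕ, ∑ n ∈ Finset.range N, ‖(V (n - j)).starProjection (D n) -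
      (V (n - j - 1)).starProjection (D n)‖ ^ 2 ≤ Q j ^ 2) :
    ‖∑ n ∈ Finset.range N, D n‖ ≤ ∑' j, Q j := by
  set Δ : ℕ → ℕ → H := fun j n => (V (n - j)).starProjection (D n) -
      (V (n - j - 1)).starProjection (D n) with hΔ
  have hdecomp : ∀ (J n : ℕ), D n = ∑ j ∈ Finset.range J, Δ j n +
      (V (n - J)).starProjection (D n) := by
    intro J n
    induction J with
    | zero =>
      simp only [Finset.range_zero, Finset.sum_empty, zero_add, Nat.cast_zero, sub_zero]
      exact (Submodule.starProjection_eq_self_iff.2 (hD n)).symm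
    | succ J ih =>
      rw [Finset.sum_range_succ, add_assoc]
      have : Δ J n + (V (n - (J + 1 : ℕ))).starProjection (D n) =
          (V (n - J)).starProjection (D n) := by
        simp only [hΔ]
        rw [show ((n : ℤ) - (J + 1 : ℕ)) = n - J - 1 by push_cast; ring]
        abel
      rw [this]
      exact ih
  have hlag : ∀ j, ‖∑ n ∈ Finset.range N, Δ j n‖ ≤ Q j := by
    intro j
    refine le_of_sq_le_sq ?_ (hQ0 j)
    rw [norm_sum_sq_of_mem_of_inner_eq_zero V hV j (Δ j)]
    · exact hDQ j
    · intro n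
      refine Submodule.sub_mem _ (Submodule.starProjection_apply_mem _ _)
        (hV (by omega) (Submodule.starProjection_apply_mem _ _))
    · intro n y hy
      have h1 : inner ℝ y (D n - (V (n - j)).starProjection (D n)) = 0 :=
        Submodule.sub_starProjection_mem_orthogonal (K := V (n - j)) (D n) y (hV (by omega) hy)
      have h2 : inner ℝ y (D n - (V (n - j - 1)).starProjection (D n)) = 0 :=
        Submodule.sub_starProjection_mem_orthogonal (K := V (n - j - 1)) (D n) y hy
      simp only [hΔ]
      rw [inner_sub_right] at h1 h2 ⊢
      linarith
  have hbound : ∀ J : ℕ, ‖∑ n ∈ Finset.range N, D n‖ ≤ ∑' j, Q j +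
      ∑ n ∈ Finset.range N, ‖(V (n - J)).starProjection (D n)‖ := by
    intro J
    have : ∑ n ∈ Finset.range N, D n = ∑ j ∈ Finset.range J, ∑ n ∈ Finset.range N, Δ j n +
        ∑ n ∈ Finset.range N, (V (n - J)).starProjection (D n) := by
      rw [Finset.sum_comm, ← Finset.sum_add_distrib]
      exact Finset.sum_congr rfl fun n _ => hdecomp J n
    rw [this]
    refine (norm_add_le _ _).trans (add_le_add ?_ (norm_sum_le _ _))
    exact ((norm_sum_le _ _).trans (Finset.sum_le_sum fun j _ => hlag j)).trans
      (hQ.sum_le_tsum _ fun j _ => hQ0 j)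
  have hlim : Tendsto (fun J : ℕ => ∑' j, Q j +
      ∑ n ∈ Finset.range N, ‖(V (n - J)).starProjection (D n)‖) atTop (𝓝 (∑' j, Q j + 0)) := by
    refine tendsto_const_nhds.add ?_
    have := tendsto_finsetSum (Finset.range N) fun n _ => (htail n).norm
    simpa using this
  rw [add_zero] at hlim
  exact ge_of_tendsto' hlim hbound

end Projections

section CondExp

variable {Ω : Type*} {m mΩ : MeasurableSpace Ω} {P : Measure Ω} [IsProbabilityMeasure P]

/-- The conditional expectation of `f (V + U)` given `m`, where `V` is `m`-measurable and `U` is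
independent of `m`. -/
lemma condExp_comp_add_of_indep (hm : m ≤ mΩ) {U V : Ω → ℝ} (hU : Measurable U)
    (hV : Measurable[m] V) (hind : Indep m (MeasurableSpace.comap U inferInstance) P)
    {f : ℝ → ℝ} (hf : Measurable f) (hint : Integrable (fun ω => f (V ω + U ω)) P) :
    P[fun ω => f (V ω + U ω) | m] =ᵐ[P] fun ω => ∫ u, f (V ω + u) ∂(P.map U) := by
  have : IsProbabilityMeasure (P.map U) := Measure.isProbabilityMeasure_map hU.aemeasurable
  set F : ℝ → ℝ := fun v => ∫ u, f (v + u) ∂(P.map U) with hF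
  have hFm : Measurable F :=
    (StronglyMeasurable.integral_prod_right (f := fun v u => f (v + u))
      (hf.comp measurable_add).stronglyMeasurable).measurable
  have key : ∀ s, MeasurableSet[m] s →
      Integrable (s.indicator fun ω => F (V ω)) P ∧
        ∫ ω in s, F (V ω) ∂P = ∫ ω in s, f (V ω + U ω) ∂P := by
    intro s hs
    have hs' := hm s hs
    set W : Ω → ℝ × ℝ := fun ω => (V ω, s.indicator 1 ω)
    have hWm : Measurable[m] W := hV.prodMk ((measurable_const (a := (1 : ℝ))).indicator hs)
    have hW : Measurable W := hWm.mono hm le_rfl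
    have hWU : IndepFun W U P := by
      rw [IndepFun_iff_Indep]
      exact indep_of_indep_of_le_left hind hWm.comap_le
    have hlaw := hWU.map_prod_eq_prod_map_map hW.aemeasurable hU.aemeasurable
    set Ψ : (ℝ × ℝ) × ℝ → ℝ := fun q => q.1.2 * f (q.1.1 + q.2) with hΨ
    have hΨm : Measurable Ψ := by fun_prop
    have hΨW : (fun ω => Ψ (W ω, U ω)) = s.indicator fun ω => f (V ω + U ω) := by
      ext ω
      by_cases hω : ω ∈ s <;> simp [hΨ, W, hω]
    have hΨint : Integrable Ψ ((P.map W).prod (P.map U)) := by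
      rw [← hlaw, integrable_map_measure hΨm.aestronglyMeasurable (hW.prodMk hU).aemeasurable]
      exact (show Integrable (fun ω => Ψ (W ω, U ω)) P from hΨW ▸ hint.indicator hs')
    have hinner : ∀ ω, ∫ u, Ψ (W ω, u) ∂(P.map U) = s.indicator (fun ω => F (V ω)) ω := by
      intro ω
      simp only [hΨ, W, integral_const_mul]
      by_cases hω : ω ∈ s <;> simp [hω, hF]
    constructor
    · have h := hΨint.integral_prod_left
      rw [integrable_map_measure h.aestronglyMeasurable hW.aemeasurable] at h
      refine h.congr (Eventually.of_forall fun ω => ?_)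
      exact hinner ω
    · rw [← integral_indicator hs', ← integral_indicator hs', ← hΨW]
      calc _ = ∫ ω, (∫ u, Ψ (W ω, u) ∂(P.map U)) ∂P := by
            refine integral_congr_ae (Eventually.of_forall fun ω => ?_)
            exact (hinner ω).symm
        _ = ∫ w, (∫ u, Ψ (w, u) ∂(P.map U)) ∂(P.map W) := by
            rw [integral_map hW.aemeasurable hΨint.integral_prod_left.aestronglyMeasurable]
        _ = ∫ q, Ψ q ∂((P.map W).prod (P.map U)) := (integral_prod _ hΨint).symm
        _ = _ := by
            rw [← hlaw, integral_map (hW.prodMk hU).aemeasurable hΨm.aestronglyMeasurable]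
  refine (ae_eq_condExp_of_forall_setIntegral_eq hm hint ?_ ?_ ?_).symm
  · intro s hs _
    exact (integrable_indicator_iff (hm s hs)).1 (key s hs).1
  · intro s hs _
    exact (key s hs).2
  · exact (hFm.comp hV).aestronglyMeasurable

end CondExp

/-- `ε` is an i.i.d. sequence of random variables with law `ν`. -/
structure IsIIDSequence {Ω : Type*} [MeasurableSpace Ω] (ε : ℤ → Ω → ℝ) (ν : Measure ℝ)
    (P : Measure Ω) : Prop where
  measurable : ∀ n, Measurable (ε n)
  hasLaw : ∀ n, HasLaw (ε n) ν P
  indep : iIndepFun ε P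

/-- The `σ`-algebra generated by the `ε i`, `i ∈ A`. -/
abbrev sigmaOf {Ω : Type*} (ε : ℤ → Ω → ℝ) (A : Set ℤ) : MeasurableSpace Ω :=
  ⨆ i ∈ A, MeasurableSpace.comap (ε i) inferInstance

/-- The first `j` terms of the linear process at time `n + 1`. -/
noncomputable def headSum {Ω : Type*} (a : ℕ → ℝ) (ε : ℤ → Ω → ℝ) (n : ℤ) (j : ℕ) (ω : Ω) : ℝ :=
  ∑ i ∈ Finset.range j, a i * ε (n - i) ω

/-- The linear process at time `n + 1`, without its first `j` terms. -/
noncomputable def tailSum {Ω : Type*} (a : ℕ → ℝ) (ε : ℤ → Ω → ℝ) (n : ℤ) (j : ℕ) (ω : Ω) : ℝ :=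
  ∑' i : ℕ, a (i + j) * ε (n - j - i) ω

section Sequence

variable {Ω : Type*} {mΩ : MeasurableSpace Ω} {P : Measure Ω} {ε : ℤ → Ω → ℝ} {a : ℕ → ℝ}
  {ν : Measure ℝ}

lemma sigmaOf_le (hε : ∀ n, Measurable (ε n)) (A : Set ℤ) : sigmaOf ε A ≤ mΩ :=
  iSup₂_le fun i _ => (hε i).comap_le

lemma sigmaOf_mono {A B : Set ℤ} (h : A ⊆ B) : sigmaOf ε A ≤ sigmaOf ε B :=
  biSup_mono h

lemma measurable_sigmaOf {A : Set ℤ} {i : ℤ} (hi : i ∈ A) : Measurable[sigmaOf ε A] (ε i) :=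
  (comap_measurable (ε i)).mono (le_iSup₂ (f := fun i (_ : i ∈ A) =>
    MeasurableSpace.comap (ε i) inferInstance) i hi) le_rfl

lemma measurable_headSum_sigmaOf {A : Set ℤ} {n : ℤ} {j : ℕ} (h : ∀ i < j, n - (i : ℤ) ∈ A) :
    Measurable[sigmaOf ε A] (headSum a ε n j) :=
  Finset.measurable_fun_sum _ fun i hi =>
    (measurable_sigmaOf (h i (Finset.mem_range.1 hi))).const_mul (a i)

lemma measurable_tailSum_sigmaOf {A : Set ℤ} {n : ℤ} {j : ℕ}
    (h : ∀ i : ℕ, n - j - (i : ℤ) ∈ A) : Measurable[sigmaOf ε A] (tailSum a ε n j) :=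
  @Measurable.tsum Ω ℝ ℕ (sigmaOf ε A) _ _ _ _ _ _ _ _ _ _ _ _
    fun i => (measurable_sigmaOf (h i)).const_mul (a (i + j))

lemma measurable_headSum (hε : ∀ n, Measurable (ε n)) (n : ℤ) (j : ℕ) :
    Measurable (headSum a ε n j) :=
  Finset.measurable_fun_sum _ fun i _ => (hε _).const_mul (a i)

lemma measurable_tailSum (hε : ∀ n, Measurable (ε n)) (n : ℤ) (j : ℕ) :
    Measurable (tailSum a ε n j) :=
  Measurable.tsum fun i => (hε _).const_mul (a (i + j))

lemma IsIIDSequence.indep_sigmaOf (h : IsIIDSequence ε ν P) {A B : Set ℤ} (hAB : Disjoint A B) :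
    Indep (sigmaOf ε A) (sigmaOf ε B) P :=
  indep_iSup_of_disjoint (fun i => (h.measurable i).comap_le) h.indep.iIndep hAB

lemma IsIIDSequence.indep_comap (h : IsIIDSequence ε ν P) {A B : Set ℤ} (hAB : Disjoint A B)
    {U : Ω → ℝ} (hU : Measurable[sigmaOf ε B] U) :
    Indep (sigmaOf ε A) (MeasurableSpace.comap U inferInstance) P :=
  indep_of_indep_of_le_right (h.indep_sigmaOf hAB) hU.comap_le

lemma IsIIDSequence.indepFun (h : IsIIDSequence ε ν P) {A B : Set ℤ} (hAB : Disjoint A B)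
    {V U : Ω → ℝ} (hV : Measurable[sigmaOf ε A] V) (hU : Measurable[sigmaOf ε B] U) :
    IndepFun V U P := by
  rw [IndepFun_iff_Indep]
  exact indep_of_indep_of_le_left (h.indep_comap hAB hU) hV.comap_le

/-- The sequence `ε` is stationary. -/
lemma IsIIDSequence.identDistrib_shift (h : IsIIDSequence ε ν P) (n : ℤ) :
    IdentDistrib (fun ω (i : ℤ) => ε (n + i) ω) (fun ω (i : ℤ) => ε i ω) P P := by
  have h1 : HasLaw (fun ω (i : ℤ) => ε (n + i) ω) (Measure.infinitePi fun _ => ν) P :=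
    (h.indep.precomp (add_right_injective n)).hasLaw_infinitePi (fun i => h.hasLaw (n + i))
      (measurable_pi_iff.2 fun i => h.measurable _).aemeasurable
  have h2 : HasLaw (fun ω (i : ℤ) => ε i ω) (Measure.infinitePi fun _ => ν) P :=
    h.indep.hasLaw_infinitePi h.hasLaw (measurable_pi_iff.2 fun i => h.measurable _).aemeasurable
  exact ⟨h1.aemeasurable, h2.aemeasurable, h1.map_eq.trans h2.map_eq.symm⟩

lemma headSum_shift (n m : ℤ) (j : ℕ) (ω : Ω) :
    headSum a ε (n + m) j ω = headSum a (fun i (e : ℤ → ℝ) => e i) m j fun i => ε (n + i) ω := by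
  simp only [headSum, add_sub_assoc]

lemma tailSum_shift (n m : ℤ) (j : ℕ) (ω : Ω) :
    tailSum a ε (n + m) j ω = tailSum a (fun i (e : ℤ → ℝ) => e i) m j fun i => ε (n + i) ω := by
  simp only [tailSum, add_sub_assoc]

/-- The pair formed by the first terms and the remaining ones is stationary. -/
lemma IsIIDSequence.identDistrib_headSum_tailSum (h : IsIIDSequence ε ν P) (n : ℤ) (j : ℕ) :
    IdentDistrib (fun ω => (headSum a ε n j ω, tailSum a ε n j ω))
      (fun ω => (headSum a ε 0 j ω, tailSum a ε 0 j ω)) P P := by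
  have hm : Measurable fun e : ℤ → ℝ => (headSum a (fun i (e : ℤ → ℝ) => e i) 0 j e,
      tailSum a (fun i (e : ℤ → ℝ) => e i) 0 j e) :=
    (measurable_headSum (fun i => measurable_pi_apply i) 0 j).prodMk
      (measurable_tailSum (fun i => measurable_pi_apply i) 0 j)
  have := (h.identDistrib_shift n).comp hm
  simp only [Function.comp_def, ← headSum_shift, ← tailSum_shift, add_zero] at this
  exact this

lemma headSum_add (n : ℤ) (j k : ℕ) (ω : Ω) :
    headSum a ε n (j + k) ω = headSum a ε n j ω +
      headSum (fun i => a (i + j)) ε (n - j) k ω := by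
  simp only [headSum, Finset.sum_range_add]
  congr 1
  refine Finset.sum_congr rfl fun i _ => ?_
  rw [add_comm j i]
  congr 2
  push_cast
  ring

lemma headSum_add_tailSum {n : ℤ} {ω : Ω} (h : Summable fun i : ℕ => a i * ε (n - i) ω) (j : ℕ) :
    headSum a ε n j ω + tailSum a ε n j ω = tailSum a ε n 0 ω := by
  have := h.sum_add_tsum_nat_add j
  simp only [headSum, tailSum, add_zero, Nat.cast_zero, sub_zero]
  rw [← this]
  congr 1
  refine tsum_congr fun i => ?_
  congr 2
  push_cast
  ring

lemma tailSum_eq_add {n : ℤ} {ω : Ω} (h : Summable fun i : ℕ => a i * ε (n - i) ω) (j : ℕ) :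
    tailSum a ε n j ω = a j * ε (n - j) ω + tailSum a ε n (j + 1) ω := by
  have h1 := headSum_add_tailSum h j
  have h2 := headSum_add_tailSum h (j + 1)
  rw [headSum, Finset.sum_range_succ] at h2
  rw [headSum] at h1
  linarith

lemma tendsto_headSum {n : ℤ} {ω : Ω} (h : Summable fun i : ℕ => a i * ε (n - i) ω) :
    Tendsto (fun j => headSum a ε n j ω) atTop (𝓝 (tailSum a ε n 0 ω)) := by
  have := h.hasSum.tendsto_sum_nat
  simpa [headSum, tailSum] using this

end Sequence

section SmoothingOfHead

lemma one_add_abs_rpow_le {δ : ℝ} (hδ : 0 < δ) {a : ℝ} (ha : a ≠ 0) (u : ℝ) :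
    (1 + |u|) ^ δ ≤ 2 ^ δ * (1 + |a| ^ (-δ)) * (1 + |a * u| ^ δ) := by
  have ha' : 0 < |a| := abs_pos.2 ha
  have h1 : (1 + |u|) ^ δ ≤ 2 ^ δ * (1 + |u| ^ δ) := by
    have hu : 0 ≤ |u| ^ δ := by positivity
    rcases le_total |u| 1 with h | h
    · calc (1 + |u|) ^ δ ≤ 2 ^ δ := Real.rpow_le_rpow (by positivity) (by linarith) hδ.le
        _ ≤ _ := le_mul_of_one_le_right (by positivity) (by linarith)
    · calc (1 + |u|) ^ δ ≤ (2 * |u|) ^ δ :=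
            Real.rpow_le_rpow (by positivity) (by linarith) hδ.le
        _ = 2 ^ δ * |u| ^ δ := Real.mul_rpow (by norm_num) (abs_nonneg u)
        _ ≤ _ := by gcongr; linarith
  have h2 : 1 + |u| ^ δ ≤ (1 + |a| ^ (-δ)) * (1 + |a * u| ^ δ) := by
    rw [abs_mul, Real.mul_rpow (abs_nonneg a) (abs_nonneg u)]
    have h3 : |a| ^ (-δ) * |a| ^ δ = 1 := by
      rw [← Real.rpow_add ha', neg_add_cancel, Real.rpow_zero]
    have h4 : 0 ≤ |a| ^ (-δ) := by positivity
    have h5 : 0 ≤ |a| ^ δ * |u| ^ δ := by positivity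
    calc 1 + |u| ^ δ = 1 + (|a| ^ (-δ) * |a| ^ δ) * |u| ^ δ := by rw [h3, one_mul]
      _ ≤ 1 + (|a| ^ (-δ) * |a| ^ δ) * |u| ^ δ + (|a| ^ (-δ) + |a| ^ δ * |u| ^ δ) := by linarith
      _ = _ := by ring
  calc (1 + |u|) ^ δ ≤ 2 ^ δ * (1 + |u| ^ δ) := h1
    _ ≤ 2 ^ δ * ((1 + |a| ^ (-δ)) * (1 + |a * u| ^ δ)) := by gcongr
    _ = _ := by ring

variable {Ω : Type*} {mΩ : MeasurableSpace Ω} {P : Measure Ω} [IsProbabilityMeasure P]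
  {ε : ℤ → Ω → ℝ} {a : ℕ → ℝ} {ν : Measure ℝ}

omit [IsProbabilityMeasure P] in
lemma IsIIDSequence.charFun_headSum (h : IsIIDSequence ε ν P) (n : ℤ) (j : ℕ) (u : ℝ) :
    charFun (P.map (headSum a ε n j)) u = ∏ i ∈ Finset.range j, charFun ν (a i * u) := by
  have hinj : Function.Injective fun i : ℕ => n - (i : ℤ) := fun i i' hi => by simpa using hi
  have hind : iIndepFun (fun (i : ℕ) ω => a i * ε (n - i) ω) P :=
    (h.indep.precomp hinj).comp (fun i x => a i * x) fun i => measurable_const_mul _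
  have hm : ∀ i : ℕ, Measurable fun ω => a i * ε (n - i) ω := fun i => (h.measurable _).const_mul _
  change charFun (P.map fun ω => ∑ i ∈ Finset.range j, a i * ε (n - i) ω) u = _
  rw [(hind.restrict (Finset.range j)).charFun_map_fun_finsetSum_eq_prod
    fun i _ => (hm i).aemeasurable, Finset.prod_apply]
  refine Finset.prod_congr rfl fun i _ => ?_
  rw [charFun_map_mul_comp (h.measurable _).aemeasurable, (h.hasLaw _).map_eq]

/-- Long sums, with an arbitrary independent term added, have uniformly smoothing laws. -/
theorem IsIIDSequence.exists_isSmoothing_headSum_add (h : IsIIDSequence ε ν P)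
    (ha : ∀ i, a i ≠ 0)
    (hφ : ∃ c δ : ℝ, 0 < c ∧ 0 < δ ∧ ∀ u : ℝ, ‖charFun ν u‖ ≤ c / (1 + |u| ^ δ)) :
    ∃ (C : ℝ≥0) (J : ℕ), ∀ (n : ℤ) (j : ℕ), J ≤ j → ∀ U : Ω → ℝ, Measurable U →
      IndepFun (headSum a ε n j) U P →
        IsSmoothing C (P.map fun ω => headSum a ε n j ω + U ω) := by
  obtain ⟨c, δ, hc, hδ, hφ⟩ := hφ
  have : IsProbabilityMeasure ν := (h.hasLaw 0).isProbabilityMeasure_iff.1 inferInstance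
  obtain ⟨J, hJ⟩ := exists_nat_ge (3 / δ)
  have hJ' : 3 ≤ δ * J := by rwa [div_le_iff₀' hδ] at hJ
  set D : ℝ := ∏ i ∈ Finset.range J, (c * (2 ^ δ * (1 + |a i| ^ (-δ))))
  have hD : 0 ≤ D := Finset.prod_nonneg fun i _ => by positivity
  set Φ : ℝ → ℝ := fun u => D * (1 + ‖u‖) ^ (-3 : ℝ) with hΦdef
  have hfac : ∀ i u, ‖charFun ν (a i * u)‖ ≤
      (c * (2 ^ δ * (1 + |a i| ^ (-δ)))) * (1 + |u|) ^ (-δ) := by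
    intro i u
    refine (hφ _).trans ?_
    rw [Real.rpow_neg (x := 1 + |u|) (by positivity), ← div_eq_mul_inv, div_le_div_iff₀ (by positivity)
      (by positivity)]
    calc c * (1 + |u|) ^ δ ≤ c * (2 ^ δ * (1 + |a i| ^ (-δ)) * (1 + |a i * u| ^ δ)) := by
          gcongr
          exact one_add_abs_rpow_le hδ (ha i) u
      _ = _ := by ring
  have hΦ : Integrable Φ := (integrable_one_add_norm (by norm_num)).const_mul D
  have hΦ' : Integrable fun u => |u| * Φ u := by
    refine ((integrable_one_add_norm (E := ℝ) (r := 2) (by norm_num)).const_mul D).mono' ?_ ?_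
    · exact (continuous_abs.measurable.mul (by fun_prop)).aestronglyMeasurable
    · filter_upwards with u
      have h1 : 0 < 1 + ‖u‖ := by positivity
      rw [Real.norm_eq_abs, abs_of_nonneg (by positivity)]
      simp only [hΦdef]
      have : (1 + ‖u‖) ^ (-2 : ℝ) = (1 + ‖u‖) * (1 + ‖u‖) ^ (-3 : ℝ) := by
        rw [← Real.rpow_one_add' h1.le (by norm_num)]
        norm_num
      rw [this]
      have h2 : |u| ≤ 1 + ‖u‖ := by rw [Real.norm_eq_abs]; linarith
      calc |u| * (D * (1 + ‖u‖) ^ (-3 : ℝ)) ≤ (1 + ‖u‖) * (D * (1 + ‖u‖) ^ (-3 : ℝ)) := by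
            gcongr
        _ = _ := by ring
  obtain ⟨C, hC⟩ := exists_isSmoothing hΦ hΦ'
  refine ⟨C, J, fun n j hj U hU hind => ?_⟩
  have hhead := measurable_headSum (a := a) h.measurable n j
  have : IsProbabilityMeasure (P.map fun ω => headSum a ε n j ω + U ω) :=
    Measure.isProbabilityMeasure_map (hhead.add hU).aemeasurable
  have : IsProbabilityMeasure (P.map U) := Measure.isProbabilityMeasure_map hU.aemeasurable
  refine hC _ fun u => ?_
  rw [hind.charFun_map_fun_add_eq_mul hhead.aemeasurable hU.aemeasurable, Pi.mul_apply,
    h.charFun_headSum, norm_mul, norm_prod]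
  calc _ ≤ (∏ i ∈ Finset.range j, ‖charFun ν (a i * u)‖) * 1 := by
        gcongr
        exact norm_charFun_le_one u
    _ ≤ ∏ i ∈ Finset.range J, ‖charFun ν (a i * u)‖ := by
        rw [mul_one]
        exact Finset.prod_le_prod_of_subset_of_le_one (Finset.range_mono hj)
          (fun i _ => norm_nonneg _) fun i _ _ => norm_charFun_le_one _
    _ ≤ ∏ i ∈ Finset.range J, (c * (2 ^ δ * (1 + |a i| ^ (-δ)))) * (1 + |u|) ^ (-δ) :=
        Finset.prod_le_prod (fun i _ => norm_nonneg _) fun i _ => hfac i u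
    _ = D * (1 + |u|) ^ (-(δ * J)) := by
        rw [Finset.prod_mul_distrib, Finset.prod_const, Finset.card_range,
          ← Real.rpow_mul_natCast (by positivity), neg_mul]
    _ ≤ Φ u := by
        simp only [hΦdef, Real.norm_eq_abs]
        gcongr
        · linarith [abs_nonneg u]

end SmoothingOfHead

section LpNormTwo

variable {Ω : Type*} {mΩ : MeasurableSpace Ω} {P : Measure Ω} {f g : Ω → ℝ}

lemma lpNorm_congr_ae (hf : AEStronglyMeasurable f P) (h : f =ᵐ[P] g) :
    lpNorm f 2 P = lpNorm g 2 P := by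
  rw [← toReal_eLpNorm hf, ← toReal_eLpNorm (hf.congr h), eLpNorm_congr_ae h]

lemma lpNorm_two_sq (hf : AEStronglyMeasurable f P) : lpNorm f 2 P ^ 2 = ∫ ω, f ω ^ 2 ∂P := by
  rw [lpNorm_eq_integral_norm_rpow_toReal two_ne_zero ENNReal.ofNat_ne_top hf,
    ← Real.rpow_natCast, ← Real.rpow_mul (by positivity)]
  simp

lemma lpNorm_two_eq_sqrt (hf : AEStronglyMeasurable f P) :
    lpNorm f 2 P = √(∫ ω, f ω ^ 2 ∂P) := by
  rw [← lpNorm_two_sq hf, Real.sqrt_sq lpNorm_nonneg]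

lemma lpNorm_mono_ae (hf : AEStronglyMeasurable f P) (hg : MemLp g 2 P)
    (h : ∀ᵐ ω ∂P, |f ω| ≤ |g ω|) : lpNorm f 2 P ≤ lpNorm g 2 P := by
  rw [← toReal_eLpNorm hf, ← toReal_eLpNorm hg.aestronglyMeasurable]
  exact ENNReal.toReal_mono hg.eLpNorm_ne_top (eLpNorm_mono_ae h)

lemma integral_abs_le_lpNorm_two [IsProbabilityMeasure P] (hf : MemLp f 2 P) :
    ∫ ω, |f ω| ∂P ≤ lpNorm f 2 P := by
  have h := eLpNorm_le_eLpNorm_of_exponent_le (p := 1) (q := 2) one_le_two hf.aestronglyMeasurable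
  have h' := ENNReal.toReal_mono hf.eLpNorm_ne_top h
  rwa [toReal_eLpNorm hf.aestronglyMeasurable, toReal_eLpNorm hf.aestronglyMeasurable,
    lpNorm_one_eq_integral_norm hf.aestronglyMeasurable] at h'

end LpNormTwo

section Increments

variable {Ω : Type*} {mΩ : MeasurableSpace Ω} {P : Measure Ω} [IsProbabilityMeasure P]

lemma lpNorm_condExp_sub_le {m₁ m₂ : MeasurableSpace Ω} (h₁₂ : m₁ ≤ m₂) (h₂ : m₂ ≤ mΩ)
    {Z W : Ω → ℝ} (hZ : MemLp Z 2 P) (hW : MemLp W 2 P) (hWm : StronglyMeasurable[m₁] W) :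
    lpNorm (P[Z | m₂] - P[Z | m₁]) 2 P ≤ 2 * lpNorm (P[Z | m₂] - W) 2 P := by
  set Φ := P[Z | m₂] with hΦ
  have hΦL : MemLp Φ 2 P := hZ.condExp one_le_two
  have htower : P[Φ | m₁] =ᵐ[P] P[Z | m₁] := condExp_condExp_of_le h₁₂ h₂
  have hWW : P[W | m₁] = W :=
    condExp_of_stronglyMeasurable (h₁₂.trans h₂) hWm (hW.integrable one_le_two)
  have hsub : P[Φ - W | m₁] =ᵐ[P] P[Φ | m₁] - P[W | m₁] :=
    condExp_sub (hΦL.integrable one_le_two) (hW.integrable one_le_two) m₁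
  have heq : Φ - P[Z | m₁] =ᵐ[P] (Φ - W) - P[Φ - W | m₁] := by
    filter_upwards [htower, hsub] with ω h1 h2
    rw [hWW] at h2
    simp only [Pi.sub_apply] at h2 ⊢
    rw [h2, ← h1]
    ring
  rw [lpNorm_congr_ae (hΦL.sub (hZ.condExp one_le_two)).aestronglyMeasurable heq]
  have h2 := (hΦL.sub hW).lpNorm_condExp_le_lpNorm (m := m₁) one_le_two
  linarith [lpNorm_sub_le (hΦL.sub hW) (g := P[Φ - W | m₁]) one_le_two]

lemma lpNorm_sub_condExp_le {m₁ : MeasurableSpace Ω} (h₁ : m₁ ≤ mΩ)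
    {Z W : Ω → ℝ} (hZ : MemLp Z 2 P) (hW : MemLp W 2 P) (hWm : StronglyMeasurable[m₁] W) :
    lpNorm (Z - P[Z | m₁]) 2 P ≤ 2 * lpNorm (Z - W) 2 P := by
  have hWW : P[W | m₁] = W := condExp_of_stronglyMeasurable h₁ hWm (hW.integrable one_le_two)
  have hsub : P[Z - W | m₁] =ᵐ[P] P[Z | m₁] - P[W | m₁] :=
    condExp_sub (hZ.integrable one_le_two) (hW.integrable one_le_two) m₁
  have heq : Z - P[Z | m₁] =ᵐ[P] (Z - W) - P[Z - W | m₁] := by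
    filter_upwards [hsub] with ω h2
    rw [hWW] at h2
    simp only [Pi.sub_apply] at h2 ⊢
    rw [h2]
    ring
  rw [lpNorm_congr_ae (hZ.sub (hZ.condExp one_le_two)).aestronglyMeasurable heq]
  have h2 := (hZ.sub hW).lpNorm_condExp_le_lpNorm (m := m₁) one_le_two
  linarith [lpNorm_sub_le (hZ.sub hW) (g := P[Z - W | m₁]) one_le_two]

/-- The `L²` norm of a sum of adapted random variables is bounded by the sum over the lags of the
norms of the martingale increments at this lag. -/
theorem lpNorm_sum_le_tsum_of_condExp (F : ℤ → MeasurableSpace Ω) (hF : Monotone F)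
    (hle : ∀ k, F k ≤ mΩ) (N : ℕ) (D : ℕ → Ω → ℝ) (hL : ∀ n, MemLp (D n) 2 P)
    (hD : ∀ n : ℕ, StronglyMeasurable[F n] (D n))
    (htail : ∀ n : ℕ, Tendsto (fun j : ℕ => lpNorm (P[D n | F (n - j)]) 2 P) atTop (𝓝 0))
    (Q : ℕ → ℝ) (hQ0 : ∀ j, 0 ≤ Q j) (hQ : Summable Q)
    (hDQ : ∀ j : ℕ, ∑ n ∈ Finset.range N,
      lpNorm (P[D n | F (n - j)] - P[D n | F (n - j - 1)]) 2 P ^ 2 ≤ Q j ^ 2) :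
    lpNorm (fun ω => ∑ n ∈ Finset.range N, D n ω) 2 P ≤ ∑' j, Q j := by
  have hfact : ∀ k, Fact (F k ≤ mΩ) := fun k => ⟨hle k⟩
  set V : ℤ → Submodule ℝ (Lp ℝ 2 P) := fun k => lpMeas ℝ ℝ (F k) 2 P
  have hproj : ∀ (k : ℤ) (n : ℕ), (V k).starProjection ((hL n).toLp _) =
      ((hL n).condExp (m := F k) one_le_two).toLp _ := by
    intro k n
    refine Lp.ext ?_
    have h1 := (hL n).condExpL2_ae_eq_condExp (𝕜 := ℝ) (hle k)
    exact h1.trans (MemLp.coeFn_toLp _).symm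
  have hnorm : ∀ {f : Ω → ℝ} (hf : MemLp f 2 P), ‖hf.toLp f‖ = lpNorm f 2 P := by
    intro f hf
    rw [Lp.norm_toLp, toReal_eLpNorm hf.aestronglyMeasurable]
  have key := norm_sum_le_tsum_of_projections V
    (fun i j hij f hf => AEStronglyMeasurable.mono (hF hij) hf) N (fun n => (hL n).toLp _)
    (fun n => (mem_lpMeas_iff_aestronglyMeasurable).2
      ((hD n).aestronglyMeasurable.congr (hL n).coeFn_toLp.symm)) ?_ Q hQ0 hQ ?_
  · refine le_of_eq_of_le ?_ key
    rw [← hnorm (memLp_finsetSum _ fun n _ => hL n)]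
    congr 1
    refine Lp.ext ?_
    have hsum := Lp.coeFn_finsetSum (Finset.range N) fun n => (hL n).toLp _
    have hall : ∀ᵐ ω ∂P, ∀ n, (hL n).toLp _ ω = D n ω :=
      ae_all_iff.2 fun n => (hL n).coeFn_toLp
    refine (MemLp.coeFn_toLp _).trans ?_
    filter_upwards [hsum, hall] with ω h1 h2
    rw [h1]
    simp [h2]
  · intro n
    simp only [hproj]
    rw [tendsto_zero_iff_norm_tendsto_zero]
    simp only [hnorm]
    exact htail n
  · intro j
    simp only [hproj]
    refine le_of_eq_of_le (Finset.sum_congr rfl fun n _ => ?_) (hDQ j)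
    rw [← MemLp.toLp_sub, hnorm]

end Increments

section IncrementOfIID

variable {Ω : Type*} {m₁ m₂ mΩ : MeasurableSpace Ω} {P : Measure Ω} [IsProbabilityMeasure P]
  {ε : ℤ → Ω → ℝ} {ν : Measure ℝ}

/-- The increment of the conditional expectations when `ε k` is revealed, if the conditional
expectation is a bounded Lipschitz function of `b * ε k`. -/
lemma IsIIDSequence.lpNorm_condExp_sub_le (h : IsIIDSequence ε ν P) {Z : Ω → ℝ}
    (hZ : MemLp Z 2 P) (h₁₂ : m₁ ≤ m₂) (h₂ : m₂ ≤ mΩ) (k : ℤ)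
    {Γ : ℝ → ℝ} (hΓ : Measurable Γ) {B : ℝ} (hB : 0 ≤ B)
    (hΓB : ∀ x y, |Γ x - Γ y| ≤ B * min 1 |x - y|) {b : ℝ} {V : Ω → ℝ} (hV : Measurable[m₁] V)
    (hZΓ : P[Z | m₂] =ᵐ[P] fun ω => Γ (b * ε k ω + V ω)) :
    lpNorm (P[Z | m₂] - P[Z | m₁]) 2 P ≤ 2 * B * √(∫ y, min 1 ((b * y) ^ 2) ∂ν) := by
  set G : Ω → ℝ := fun ω => Γ (b * ε k ω + V ω) with hG
  have hV' : Measurable V := hV.mono (h₁₂.trans h₂) le_rfl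
  have hbε : Measurable fun ω => b * ε k ω := (h.measurable k).const_mul b
  have hGL : MemLp G 2 P := (memLp_congr_ae hZΓ).1 (hZ.condExp one_le_two)
  set E : Ω → ℝ := fun ω => B * min 1 |b * ε k ω| with hE
  have hEm : Measurable E := by fun_prop
  have hEL : MemLp E 2 P := by
    refine MemLp.of_bound hEm.aestronglyMeasurable B ?_
    filter_upwards with ω
    rw [Real.norm_eq_abs, abs_of_nonneg (by positivity)]
    exact mul_le_of_le_one_right hB (min_le_left _ _)
  have hdiff : ∀ ω, |(G - fun ω => Γ (V ω)) ω| ≤ |E ω| := by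
    intro ω
    refine (hΓB _ _).trans ?_
    rw [add_sub_cancel_right]
    exact le_abs_self _
  have hGm : Measurable G := hΓ.comp (hbε.add hV')
  have hdm : Measurable (G - fun ω => Γ (V ω)) := hGm.sub (hΓ.comp hV')
  have hdL : MemLp (G - fun ω => Γ (V ω)) 2 P :=
    hEL.mono hdm.aestronglyMeasurable (Eventually.of_forall hdiff)
  have hWL : MemLp (fun ω => Γ (V ω)) 2 P := by
    have := hGL.sub hdL
    simpa using this
  have h1 := _root_.lpNorm_condExp_sub_le h₁₂ h₂ hZ hWL (hΓ.comp hV).stronglyMeasurable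
  refine h1.trans ?_
  rw [mul_assoc]
  refine mul_le_mul_of_nonneg_left ?_ zero_le_two
  have h3 : P[Z | m₂] - (fun ω => Γ (V ω)) =ᵐ[P] G - fun ω => Γ (V ω) :=
    hZΓ.sub (ae_eq_refl _)
  rw [← lpNorm_congr_ae hdL.aestronglyMeasurable h3.symm]
  refine (lpNorm_mono_ae hdL.aestronglyMeasurable hEL (Eventually.of_forall hdiff)).trans_eq ?_
  rw [lpNorm_two_eq_sqrt hEm.aestronglyMeasurable]
  have h4 : ∀ ω, E ω ^ 2 = B ^ 2 * min 1 ((b * ε k ω) ^ 2) := by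
    intro ω
    simp only [hE, mul_pow B]
    congr 1
    rcases le_total 1 |b * ε k ω| with hc | hc
    · rw [min_eq_left hc, min_eq_left (by rw [← sq_abs]; exact one_le_pow₀ hc), one_pow]
    · rw [min_eq_right hc, min_eq_right (by rw [← sq_abs]; exact pow_le_one₀ (abs_nonneg _) hc),
        sq_abs]
  simp only [h4]
  rw [integral_const_mul, Real.sqrt_mul (by positivity), Real.sqrt_sq hB,
    ← (h.hasLaw k).integral_comp (f := fun y => min 1 ((b * y) ^ 2))
      (by fun_prop)]
  rfl

end IncrementOfIID

/-- The laws of the sums of the first `j ≥ J` terms of the linear process, with an arbitrary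
independent term added, are smoothing with constant `C`. -/
def SmoothingHead {Ω : Type*} [MeasurableSpace Ω] (P : Measure Ω) (a : ℕ → ℝ) (ε : ℤ → Ω → ℝ)
    (C : ℝ≥0) (J : ℕ) : Prop :=
  ∀ (n : ℤ) (j : ℕ), J ≤ j → ∀ U : Ω → ℝ, Measurable U → IndepFun (headSum a ε n j) U P →
    IsSmoothing C (P.map fun ω => headSum a ε n j ω + U ω)

/-- The function `x ↦ E K(x + R)`, where `R` is the linear process without its first `r` terms. -/
noncomputable def condMean {Ω : Type*} [MeasurableSpace Ω] (P : Measure Ω) (K : ℝ → ℝ) (a : ℕ → ℝ)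
    (ε : ℤ → Ω → ℝ) (r : ℕ) (x : ℝ) : ℝ :=
  ∫ v, K (x + v) ∂(P.map (tailSum a ε 0 r))

section Smoothing

variable {μ : Measure ℝ} {C : ℝ≥0} {K : ℝ → ℝ}

lemma IsSmoothing.abs_sub_le_min (hμ : IsSmoothing C μ) (hK : Integrable K) (x y : ℝ) :
    |∫ u, K (x + u) ∂μ - ∫ u, K (y + u) ∂μ| ≤ (2 * C * ∫ u, |K u|) * min 1 |x - y| := by
  have hK0 : 0 ≤ ∫ u, |K u| := integral_nonneg fun _ => abs_nonneg _
  have hb : ∀ x, |∫ u, K (x + u) ∂μ| ≤ C * ∫ u, |K u| := fun x =>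
    (abs_integral_le_integral_abs).trans
      (integral_comp_add_le_of_le_volume hμ.le_volume hK.abs (fun _ => abs_nonneg _) x)
  have hCK : 0 ≤ C * ∫ u, |K u| := by positivity
  rcases le_total 1 |x - y| with h | h
  · rw [min_eq_left h]
    linarith [abs_sub (∫ u, K (x + u) ∂μ) (∫ u, K (y + u) ∂μ), hb x, hb y]
  · rw [min_eq_right h]
    refine (hμ.lipschitz K hK x y).trans ?_
    have := mul_nonneg hCK (abs_nonneg (x - y))
    linarith

end Smoothing

section Functional

variable {Ω : Type*} {mΩ : MeasurableSpace Ω} {P : Measure Ω}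
  {ε : ℤ → Ω → ℝ} {a : ℕ → ℝ} {ν : Measure ℝ} {K : ℝ → ℝ} {C : ℝ≥0} {J : ℕ}

lemma measurable_integral_comp_add {μ : Measure ℝ} [SFinite μ] (hK : Measurable K) :
    Measurable fun x => ∫ v, K (x + v) ∂μ :=
  (StronglyMeasurable.integral_prod_right (f := fun x v => K (x + v))
    (hK.comp measurable_add).stronglyMeasurable).measurable

lemma measurable_condMean [IsProbabilityMeasure P] (hε : ∀ n, Measurable (ε n)) (hK : Measurable K) (r : ℕ) :
    Measurable (condMean P K a ε r) := by
  have := Measure.isProbabilityMeasure_map (μ := P)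
    (measurable_tailSum (a := a) hε 0 r).aemeasurable
  exact measurable_integral_comp_add hK

lemma IsIIDSequence.indepFun_headSum_tailSum (h : IsIIDSequence ε ν P) (n : ℤ) {j r : ℕ}
    (hjr : j ≤ r) : IndepFun (headSum a ε n j) (tailSum a ε n r) P :=
  h.indepFun (A := Set.Ioi (n - r)) (B := Set.Iic (n - r))
    (Set.Iic_disjoint_Ioi le_rfl).symm
    (measurable_headSum_sigmaOf fun i hi => by simp only [Set.mem_Ioi]; omega)
    (measurable_tailSum_sigmaOf fun i => by simp only [Set.mem_Iic]; omega)

lemma isSmoothing_map_tailSum_zero (h : IsIIDSequence ε ν P) (hC : SmoothingHead P a ε C J)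
    (hs : ∀ n : ℤ, ∀ᵐ ω ∂P, Summable fun i : ℕ => a i * ε (n - i) ω) (n : ℤ) :
    IsSmoothing C (P.map (tailSum a ε n 0)) := by
  have := hC n J le_rfl (tailSum a ε n J) (measurable_tailSum h.measurable n J)
    (h.indepFun_headSum_tailSum n le_rfl)
  rwa [Measure.map_congr (g := tailSum a ε n 0)] at this
  filter_upwards [hs n] with ω hω using headSum_add_tailSum hω J

lemma isSmoothing_map_headSum [IsProbabilityMeasure P] (hC : SmoothingHead P a ε C J)
    (n : ℤ) {j : ℕ} (hj : J ≤ j) : IsSmoothing C (P.map (headSum a ε n j)) := by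
  simpa using hC n j hj (fun _ => 0) measurable_const (indepFun_const_right _ _)

lemma memLp_comp_of_le_volume {E : Type*} [NormedAddCommGroup E] {f : ℝ → E} {X : Ω → ℝ}
    (hX : AEMeasurable X P) (hf : MemLp f 2) (hle : P.map X ≤ C • (volume : Measure ℝ)) :
    MemLp (fun ω => f (X ω)) 2 P := by
  have h1 : MemLp f 2 (P.map X) := (hf.smul_measure (c := C) (by simp)).mono_measure hle
  exact (memLp_map_measure_iff h1.aestronglyMeasurable hX).1 h1

lemma lpNorm_comp_le_of_le_volume {f : ℝ → ℝ} {X : Ω → ℝ}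
    (hX : AEMeasurable X P) (hf : MemLp f 2) (hle : P.map X ≤ C • (volume : Measure ℝ)) :
    lpNorm (fun ω => f (X ω)) 2 P ≤ √C * lpNorm f 2 volume := by
  have h1 : MemLp f 2 (P.map X) := (hf.smul_measure (c := C) (by simp)).mono_measure hle
  have h2 := memLp_comp_of_le_volume hX hf hle
  refine le_of_sq_le_sq ?_ (mul_nonneg (Real.sqrt_nonneg _) lpNorm_nonneg)
  rw [mul_pow, Real.sq_sqrt C.coe_nonneg, lpNorm_two_sq h2.aestronglyMeasurable,
    lpNorm_two_sq hf.aestronglyMeasurable,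
    ← integral_map hX (f := fun x => f x ^ 2) (h1.aestronglyMeasurable.pow 2)]
  refine (integral_mono_measure hle (Eventually.of_forall fun y => sq_nonneg _)
    hf.integrable_sq.smul_measure_nnreal).trans_eq ?_
  rw [integral_smul_nnreal_measure]
  rfl

variable [IsProbabilityMeasure P]

/-- The conditional expectation of `K (X (n + 1))` given the innovations up to time `n - j`. -/
lemma condExp_comp_tailSum (h : IsIIDSequence ε ν P)
    (hs : ∀ n : ℤ, ∀ᵐ ω ∂P, Summable fun i : ℕ => a i * ε (n - i) ω)
    (hK : Measurable K) (n : ℤ) (hKX : MemLp (fun ω => K (tailSum a ε n 0 ω)) 2 P) (j : ℕ) :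
    P[fun ω => K (tailSum a ε n 0 ω) | sigmaOf ε (Set.Iic (n - j))] =ᵐ[P]
      fun ω => ∫ u, K (tailSum a ε n j ω + u) ∂(P.map (headSum a ε n j)) := by
  have heq : (fun ω => K (tailSum a ε n 0 ω)) =ᵐ[P]
      fun ω => K (tailSum a ε n j ω + headSum a ε n j ω) := by
    filter_upwards [hs n] with ω hω
    rw [add_comm, headSum_add_tailSum hω j]
  refine (condExp_congr_ae heq).trans (condExp_comp_add_of_indep (sigmaOf_le h.measurable _)
    (measurable_headSum h.measurable n j) ?_ ?_ hK ?_)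
  · exact measurable_tailSum_sigmaOf fun i => by simp only [Set.mem_Iic]; omega
  · refine h.indep_comap (A := Set.Iic (n - j)) (B := Set.Ioi (n - j))
      (Set.Iic_disjoint_Ioi le_rfl) ?_
    exact measurable_headSum_sigmaOf fun i hi => by simp only [Set.mem_Ioi]; omega
  · exact (hKX.integrable one_le_two).congr heq

/-- The conditional expectation of `K (X (n + 1))` given the last `r` innovations. -/
lemma condExp_comp_tailSum_Ioi (h : IsIIDSequence ε ν P)
    (hs : ∀ n : ℤ, ∀ᵐ ω ∂P, Summable fun i : ℕ => a i * ε (n - i) ω)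
    (hK : Measurable K) (n : ℤ) (hKX : MemLp (fun ω => K (tailSum a ε n 0 ω)) 2 P) (r : ℕ) :
    P[fun ω => K (tailSum a ε n 0 ω) | sigmaOf ε (Set.Ioi (n - r))] =ᵐ[P]
      fun ω => condMean P K a ε r (headSum a ε n r ω) := by
  have heq : (fun ω => K (tailSum a ε n 0 ω)) =ᵐ[P]
      fun ω => K (headSum a ε n r ω + tailSum a ε n r ω) := by
    filter_upwards [hs n] with ω hω
    rw [headSum_add_tailSum hω r]
  have hlaw : P.map (tailSum a ε 0 r) = P.map (tailSum a ε n r) :=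
    ((h.identDistrib_headSum_tailSum n r).comp measurable_snd).map_eq.symm
  simp only [condMean, hlaw]
  refine (condExp_congr_ae heq).trans (condExp_comp_add_of_indep (sigmaOf_le h.measurable _)
    (measurable_tailSum h.measurable n r) ?_ ?_ hK ?_)
  · exact measurable_headSum_sigmaOf fun i hi => by simp only [Set.mem_Ioi]; omega
  · refine h.indep_comap (A := Set.Ioi (n - r)) (B := Set.Iic (n - r))
      (Set.Iic_disjoint_Ioi le_rfl).symm ?_
    exact measurable_tailSum_sigmaOf fun i => by simp only [Set.mem_Iic]; omega
  · exact (hKX.integrable one_le_two).congr heq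

lemma memLp_condMean (h : IsIIDSequence ε ν P)
    (hs : ∀ n : ℤ, ∀ᵐ ω ∂P, Summable fun i : ℕ => a i * ε (n - i) ω)
    (hK : Measurable K) (n : ℤ) (hKX : MemLp (fun ω => K (tailSum a ε n 0 ω)) 2 P) (r : ℕ) :
    MemLp (fun ω => condMean P K a ε r (headSum a ε n r ω)) 2 P :=
  (memLp_congr_ae (condExp_comp_tailSum_Ioi h hs hK n hKX r)).1 (hKX.condExp one_le_two)

lemma lpNorm_condExp_comp_tailSum_sub_le (h : IsIIDSequence ε ν P)
    (hC : SmoothingHead P a ε C J)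
    (hs : ∀ n : ℤ, ∀ᵐ ω ∂P, Summable fun i : ℕ => a i * ε (n - i) ω)
    (hK : Measurable K) (hK1 : Integrable K) (n : ℤ)
    (hKX : MemLp (fun ω => K (tailSum a ε n 0 ω)) 2 P) {j : ℕ} (hj : J ≤ j) :
    lpNorm (P[fun ω => K (tailSum a ε n 0 ω) | sigmaOf ε (Set.Iic (n - j))] -
      P[fun ω => K (tailSum a ε n 0 ω) | sigmaOf ε (Set.Iic (n - j - 1))]) 2 P ≤
      2 * (2 * C * ∫ u, |K u|) * √(∫ y, min 1 ((a j * y) ^ 2) ∂ν) := by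
  have := Measure.isProbabilityMeasure_map (μ := P)
    (measurable_headSum (a := a) h.measurable n j).aemeasurable
  refine h.lpNorm_condExp_sub_le hKX (sigmaOf_mono (Set.Iic_subset_Iic.2 (by omega)))
    (sigmaOf_le h.measurable _) (n - j) (measurable_integral_comp_add hK) (by positivity)
    (fun x y => (isSmoothing_map_headSum hC n hj).abs_sub_le_min hK1 x y)
    (V := tailSum a ε n (j + 1)) ?_ ?_
  · exact measurable_tailSum_sigmaOf fun i => by simp only [Set.mem_Iic]; push_cast; omega
  · filter_upwards [condExp_comp_tailSum h hs hK n hKX j, hs n] with ω h1 h2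
    rw [h1, tailSum_eq_add h2]

/-- `condMean K r` averaged over the first `j` terms of the process has the same regularity as `K`
averaged over these terms. -/
lemma integral_condMean_eq (h : IsIIDSequence ε ν P) (hC : SmoothingHead P a ε C J)
    (hK : Measurable K) (hK1 : Integrable K) (n : ℤ) {j r : ℕ} (hj : J ≤ j) (hjr : j ≤ r)
    (x : ℝ) : ∫ u, condMean P K a ε r (x + u) ∂(P.map (headSum a ε n j)) =
      ∫ s, K (x + s) ∂(P.map fun ω => headSum a ε n j ω + tailSum a ε n r ω) := by
  have hhead := measurable_headSum (a := a) h.measurable n j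
  have htail := measurable_tailSum (a := a) h.measurable n r
  have hind := h.indepFun_headSum_tailSum (a := a) n hjr
  have := Measure.isProbabilityMeasure_map (μ := P) hhead.aemeasurable
  have := Measure.isProbabilityMeasure_map (μ := P) htail.aemeasurable
  have hsm := hC n j hj _ htail hind
  have hint : Integrable (fun s => K (x + s))
      (P.map fun ω => headSum a ε n j ω + tailSum a ε n r ω) :=
    integrable_comp_add_of_le_volume hsm.le_volume hK1 x
  have hlaw : P.map (tailSum a ε 0 r) = P.map (tailSum a ε n r) :=
    ((h.identDistrib_headSum_tailSum n r).comp measurable_snd).map_eq.symm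
  have hmap : P.map (fun ω => headSum a ε n j ω + tailSum a ε n r ω) =
      ((P.map (headSum a ε n j)).prod (P.map (tailSum a ε n r))).map fun q => q.1 + q.2 := by
    rw [← hind.map_prod_eq_prod_map_map hhead.aemeasurable htail.aemeasurable,
      Measure.map_map measurable_add (hhead.prodMk htail)]
    rfl
  have hKx : Measurable fun s => K (x + s) := hK.comp (measurable_const_add x)
  rw [hmap, integrable_map_measure hKx.aestronglyMeasurable measurable_add.aemeasurable] at hint
  rw [hmap, integral_map measurable_add.aemeasurable hKx.aestronglyMeasurable]
  refine Eq.trans ?_ (integral_prod _ hint).symm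
  simp only [condMean, hlaw, add_assoc, Function.comp_apply]

lemma lpNorm_condExp_condMean_sub_le (h : IsIIDSequence ε ν P)
    (hC : SmoothingHead P a ε C J)
    (hs : ∀ n : ℤ, ∀ᵐ ω ∂P, Summable fun i : ℕ => a i * ε (n - i) ω)
    (hK : Measurable K) (hK1 : Integrable K) (n : ℤ)
    (hKX : MemLp (fun ω => K (tailSum a ε n 0 ω)) 2 P) {j : ℕ} (hj : J ≤ j) (r : ℕ) :
    lpNorm (P[fun ω => condMean P K a ε r (headSum a ε n r ω) | sigmaOf ε (Set.Iic (n - j))] -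
      P[fun ω => condMean P K a ε r (headSum a ε n r ω) | sigmaOf ε (Set.Iic (n - j - 1))]) 2 P ≤
      2 * (2 * C * ∫ u, |K u|) * √(∫ y, min 1 ((a j * y) ^ 2) ∂ν) := by
  have hYL := memLp_condMean h hs hK n hKX r
  have hYm : Measurable[sigmaOf ε (Set.Ioi (n - r))]
      fun ω => condMean P K a ε r (headSum a ε n r ω) :=
    (measurable_condMean h.measurable hK r).comp
      (measurable_headSum_sigmaOf fun i hi => by simp only [Set.mem_Ioi]; omega)
  rcases lt_or_ge j r with hjr | hjr
  · have hhead := measurable_headSum (a := a) h.measurable n j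
    have htail := measurable_tailSum (a := a) h.measurable n r
    have := Measure.isProbabilityMeasure_map (μ := P) hhead.aemeasurable
    have hsm := hC n j hj _ htail (h.indepFun_headSum_tailSum (a := a) n hjr.le)
    refine h.lpNorm_condExp_sub_le hYL (sigmaOf_mono (Set.Iic_subset_Iic.2 (by omega)))
      (sigmaOf_le h.measurable _) (n - j)
      (Γ := fun x => ∫ u, condMean P K a ε r (x + u) ∂(P.map (headSum a ε n j)))
      (measurable_integral_comp_add (measurable_condMean h.measurable hK r)) (by positivity)
      (fun x y => ?_)
      (V := headSum (fun i => a (i + (j + 1))) ε (n - (j + 1)) (r - (j + 1))) ?_ ?_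
    · rw [integral_condMean_eq h hC hK hK1 n hj hjr.le, integral_condMean_eq h hC hK hK1 n hj hjr.le]
      exact hsm.abs_sub_le_min hK1 x y
    · exact measurable_headSum_sigmaOf fun i _ => by simp only [Set.mem_Iic]; omega
    · have heq : ∀ ω, headSum a ε n r ω = (a j * ε (n - j) ω +
          headSum (fun i => a (i + (j + 1))) ε (n - (j + 1)) (r - (j + 1)) ω) +
          headSum a ε n j ω := by
        intro ω
        have h1 := headSum_add (a := a) (ε := ε) n (j + 1) (r - (j + 1)) ω
        rw [Nat.add_sub_cancel' hjr] at h1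
        rw [h1]
        push_cast
        rw [show headSum a ε n (j + 1) ω = headSum a ε n j ω + a j * ε (n - j) ω from
          Finset.sum_range_succ _ _]
        ring
      simp only [heq] at hYL ⊢
      refine condExp_comp_add_of_indep (sigmaOf_le h.measurable _) hhead ?_ ?_
        (measurable_condMean h.measurable hK r) (hYL.integrable one_le_two)
      · exact ((measurable_sigmaOf (by simp)).const_mul _).add
          (measurable_headSum_sigmaOf fun i _ => by simp only [Set.mem_Iic]; omega)
      · refine h.indep_comap (A := Set.Iic (n - j)) (B := Set.Ioi (n - j))
          (Set.Iic_disjoint_Ioi le_rfl) ?_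
        exact measurable_headSum_sigmaOf fun i hi => by simp only [Set.mem_Ioi]; omega
  · have hconst : ∀ k ≤ n - (j : ℤ), P[fun ω => condMean P K a ε r (headSum a ε n r ω) |
        sigmaOf ε (Set.Iic k)] =ᵐ[P]
        fun _ => ∫ ω, condMean P K a ε r (headSum a ε n r ω) ∂P := by
      intro k hk
      refine condExp_indep_eq (sigmaOf_le h.measurable (Set.Ioi (n - r)))
        (sigmaOf_le h.measurable _) hYm.stronglyMeasurable (h.indep_sigmaOf
          (Set.Iic_disjoint_Ioi (by omega)).symm)
    have hzero := (hconst (n - j) le_rfl).sub (hconst (n - j - 1) (by omega))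
    rw [lpNorm_congr_ae (by fun_prop) hzero]
    simp only [sub_self, lpNorm_zero]
    exact mul_nonneg (by positivity) (Real.sqrt_nonneg _)

end Functional

section Approximation

variable {Ω : Type*} {mΩ : MeasurableSpace Ω} {P : Measure Ω} [IsProbabilityMeasure P]
  {ε : ℤ → Ω → ℝ} {a : ℕ → ℝ} {ν : Measure ℝ} {K : ℝ → ℝ} {C : ℝ≥0} {J : ℕ}

lemma lpNorm_sub_condMean_eq (h : IsIIDSequence ε ν P)
    (hs : ∀ n : ℤ, ∀ᵐ ω ∂P, Summable fun i : ℕ => a i * ε (n - i) ω)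
    (hK : Measurable K) (n : ℤ) (r : ℕ) :
    lpNorm (fun ω => K (tailSum a ε n 0 ω) - condMean P K a ε r (headSum a ε n r ω)) 2 P =
      lpNorm (fun ω => K (tailSum a ε 0 0 ω) - condMean P K a ε r (headSum a ε 0 r ω)) 2 P := by
  have hcm := measurable_condMean (P := P) (a := a) h.measurable hK r
  have hm : ∀ n, Measurable
      fun ω => K (tailSum a ε n 0 ω) - condMean P K a ε r (headSum a ε n r ω) := fun n =>
    (hK.comp (measurable_tailSum h.measurable n 0)).sub
      (hcm.comp (measurable_headSum h.measurable n r))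
  have hg : Measurable fun q : ℝ × ℝ => K (q.1 + q.2) - condMean P K a ε r q.1 :=
    (hK.comp measurable_add).sub (hcm.comp measurable_fst)
  have hid := (h.identDistrib_headSum_tailSum (a := a) n r).comp hg
  have heq : ∀ n : ℤ,
      (fun ω => K (tailSum a ε n 0 ω) - condMean P K a ε r (headSum a ε n r ω)) =ᵐ[P]
      (fun q : ℝ × ℝ => K (q.1 + q.2) - condMean P K a ε r q.1) ∘
        fun ω => (headSum a ε n r ω, tailSum a ε n r ω) := by
    intro n
    filter_upwards [hs n] with ω hω
    simp only [Function.comp_apply]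
    rw [headSum_add_tailSum hω r]
  have hm' : ∀ n, Measurable ((fun q : ℝ × ℝ => K (q.1 + q.2) - condMean P K a ε r q.1) ∘
        fun ω => (headSum a ε n r ω, tailSum a ε n r ω)) := fun n =>
    hg.comp ((measurable_headSum h.measurable n r).prodMk (measurable_tailSum h.measurable n r))
  rw [lpNorm_congr_ae (hm n).aestronglyMeasurable (heq n),
    lpNorm_congr_ae (hm 0).aestronglyMeasurable (heq 0),
    ← toReal_eLpNorm (hm' n).aestronglyMeasurable, ← toReal_eLpNorm (hm' 0).aestronglyMeasurable,
    hid.eLpNorm_eq]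

lemma tendsto_lpNorm_sub_condMean (h : IsIIDSequence ε ν P) (hC : SmoothingHead P a ε C J)
    (hs : ∀ n : ℤ, ∀ᵐ ω ∂P, Summable fun i : ℕ => a i * ε (n - i) ω)
    (hK : Measurable K) (hK2 : MemLp K 2) :
    Tendsto (fun r : ℕ => lpNorm (fun ω => K (tailSum a ε 0 0 ω) -
      condMean P K a ε r (headSum a ε 0 r ω)) 2 P) atTop (𝓝 0) := by
  have hX := measurable_tailSum (a := a) h.measurable 0 0
  have hle := (isSmoothing_map_tailSum_zero h hC hs 0).le_volume
  have hZL := memLp_comp_of_le_volume hX.aemeasurable hK2 hle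
  rw [Metric.tendsto_atTop]
  intro η hη
  have hδ : 0 < η / (4 * (√C + 1)) := by positivity
  obtain ⟨g, hgc, hgK, hg, hgL⟩ := hK2.exists_hasCompactSupport_eLpNorm_sub_le
    ENNReal.ofNat_ne_top (ENNReal.ofReal_pos.2 hδ).ne'
  have hKg : lpNorm (K - g) 2 volume ≤ η / (4 * (√C + 1)) := by
    rw [← toReal_eLpNorm (hK2.sub hgL).aestronglyMeasurable]
    exact ENNReal.toReal_le_of_le_ofReal hδ.le hgK
  obtain ⟨M, hM⟩ := hgc.exists_bound_of_continuous hg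
  have hM0 : 0 ≤ M := (norm_nonneg _).trans (hM 0)
  have hgX : ∀ X : Ω → ℝ, Measurable X → MemLp (fun ω => g (X ω)) 2 P := fun X hX =>
    MemLp.of_bound (hg.measurable.comp hX).aestronglyMeasurable M
      (Eventually.of_forall fun ω => hM _)
  have hlim : Tendsto (fun r : ℕ => ∫ ω, (g (tailSum a ε 0 0 ω) - g (headSum a ε 0 r ω)) ^ 2 ∂P)
      atTop (𝓝 0) := by
    have := tendsto_integral_of_dominated_convergence (μ := P) (f := fun _ => (0 : ℝ))
      (F := fun (r : ℕ) ω => (g (tailSum a ε 0 0 ω) - g (headSum a ε 0 r ω)) ^ 2)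
      (fun _ => (M + M) ^ 2) (fun r => ((hgX _ hX).sub
        (hgX _ (measurable_headSum h.measurable 0 r))).aestronglyMeasurable.pow 2)
      (integrable_const _) (fun r => Eventually.of_forall fun ω => ?_) ?_
    · simpa using this
    · rw [norm_pow]
      gcongr
      exact (norm_sub_le _ _).trans (add_le_add (hM _) (hM _))
    · filter_upwards [hs 0] with ω hω
      have := ((hg.tendsto _).comp (tendsto_headSum hω)).const_sub (g (tailSum a ε 0 0 ω))
      simpa using this.pow 2
  have hlim' : Tendsto (fun r : ℕ => lpNorm ((fun ω => g (tailSum a ε 0 0 ω)) -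
      fun ω => g (headSum a ε 0 r ω)) 2 P) atTop (𝓝 0) := by
    have := hlim.sqrt
    rw [Real.sqrt_zero] at this
    refine this.congr fun r => ?_
    rw [lpNorm_two_eq_sqrt ((hgX _ hX).sub
      (hgX _ (measurable_headSum h.measurable 0 r))).aestronglyMeasurable]
    rfl
  obtain ⟨R, hR⟩ := (Metric.tendsto_atTop.1 hlim') (η / 4) (by positivity)
  refine ⟨R, fun r hr => ?_⟩
  rw [dist_zero_right, Real.norm_eq_abs, abs_of_nonneg lpNorm_nonneg]
  have h1 := condExp_comp_tailSum_Ioi h hs hK 0 hZL r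
  have h2 : lpNorm ((fun ω => K (tailSum a ε 0 0 ω)) -
      P[fun ω => K (tailSum a ε 0 0 ω) | sigmaOf ε (Set.Ioi (0 - r))]) 2 P =
      lpNorm (fun ω => K (tailSum a ε 0 0 ω) - condMean P K a ε r (headSum a ε 0 r ω)) 2 P :=
    lpNorm_congr_ae (hZL.sub (hZL.condExp one_le_two)).aestronglyMeasurable
      ((ae_eq_refl _).sub h1)
  have hhm : Measurable[sigmaOf ε (Set.Ioi (0 - (r : ℤ)))] (headSum a ε 0 r) :=
    measurable_headSum_sigmaOf fun i hi => by simp only [Set.mem_Ioi]; omega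
  have h3 := lpNorm_sub_condExp_le (sigmaOf_le h.measurable _) hZL
    (hgX _ (measurable_headSum h.measurable 0 r)) (hg.measurable.comp hhm).stronglyMeasurable
  rw [h2] at h3
  have h4 := lpNorm_sub_le_lpNorm_sub_add_lpNorm_sub (h := fun ω => g (headSum a ε 0 r ω)) hZL
    (hgX _ hX) one_le_two
  have h5 := lpNorm_comp_le_of_le_volume hX.aemeasurable (hK2.sub hgL) hle
  have h6 : √C * lpNorm (K - g) 2 volume ≤ η / 4 := by
    calc √C * lpNorm (K - g) 2 volume ≤ (√C + 1) * (η / (4 * (√C + 1))) :=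
          mul_le_mul (by linarith) hKg lpNorm_nonneg (by positivity)
      _ = η / 4 := by field_simp
  have h7 := hR r hr
  rw [dist_zero_right, Real.norm_eq_abs, abs_of_nonneg lpNorm_nonneg] at h7
  have h8 : lpNorm ((fun ω => K (tailSum a ε 0 0 ω)) - fun ω => g (tailSum a ε 0 0 ω)) 2 P ≤
    η / 4 := h5.trans h6
  linarith

/-- The distance between the process and its approximation, projected on the remote past. -/
lemma tendsto_lpNorm_condExp_sub_condMean (h : IsIIDSequence ε ν P)
    (hC : SmoothingHead P a ε C J)
    (hs : ∀ n : ℤ, ∀ᵐ ω ∂P, Summable fun i : ℕ => a i * ε (n - i) ω)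
    (hK : Measurable K) (hK2 : MemLp K 2) (n : ℤ) (r : ℕ) :
    Tendsto (fun j : ℕ => lpNorm (P[fun ω => K (tailSum a ε n 0 ω) -
      condMean P K a ε r (headSum a ε n r ω) | sigmaOf ε (Set.Iic (n - j))]) 2 P)
      atTop (𝓝 0) := by
  have hZL := memLp_comp_of_le_volume (measurable_tailSum (a := a) h.measurable n 0).aemeasurable
    hK2 (isSmoothing_map_tailSum_zero h hC hs n).le_volume
  set Z : Ω → ℝ := fun ω => K (tailSum a ε n 0 ω)
  set Y : ℕ → Ω → ℝ := fun r ω => condMean P K a ε r (headSum a ε n r ω)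
  have hYL : ∀ r, MemLp (Y r) 2 P := fun r => memLp_condMean h hs hK n hZL r
  have hYint : ∀ r, ∫ ω, Y r ω ∂P = ∫ ω, Z ω ∂P := by
    intro r
    rw [← integral_congr_ae (condExp_comp_tailSum_Ioi h hs hK n hZL r),
      integral_condExp (sigmaOf_le h.measurable _)]
  have hconst : ∀ r j : ℕ, r ≤ j → P[Y r | sigmaOf ε (Set.Iic (n - j))] =ᵐ[P]
      fun _ => ∫ ω, Z ω ∂P := by
    intro r j hrj
    rw [← hYint r]
    have hYm : Measurable[sigmaOf ε (Set.Ioi (n - r))] (Y r) :=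
      (measurable_condMean h.measurable hK r).comp
        (measurable_headSum_sigmaOf fun i hi => by simp only [Set.mem_Ioi]; omega)
    exact condExp_indep_eq (sigmaOf_le h.measurable (Set.Ioi (n - r)))
      (sigmaOf_le h.measurable _) hYm.stronglyMeasurable (h.indep_sigmaOf
        (Set.Iic_disjoint_Ioi (by omega)).symm)
  rw [Metric.tendsto_atTop]
  intro η hη
  obtain ⟨R, hR⟩ := (Metric.tendsto_atTop.1 (tendsto_lpNorm_sub_condMean h hC hs hK hK2)) η hη
  refine ⟨max R r, fun j hj => ?_⟩
  rw [dist_zero_right, Real.norm_eq_abs, abs_of_nonneg lpNorm_nonneg]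
  have h1 := hR (max R r) (le_max_left _ _)
  rw [dist_zero_right, Real.norm_eq_abs, abs_of_nonneg lpNorm_nonneg,
    ← lpNorm_sub_condMean_eq h hs hK n] at h1
  refine lt_of_le_of_lt ?_ h1
  have hint : ∀ r, Integrable (Y r) P := fun r => (hYL r).integrable one_le_two
  have hZint : Integrable Z P := hZL.integrable one_le_two
  have heq : P[fun ω => Z ω - Y r ω | sigmaOf ε (Set.Iic (n - j))] =ᵐ[P]
      P[fun ω => Z ω - Y (max R r) ω | sigmaOf ε (Set.Iic (n - j))] := by
    have e1 := condExp_sub hZint (hint r) (sigmaOf ε (Set.Iic (n - j)))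
    have e2 := condExp_sub hZint (hint (max R r)) (sigmaOf ε (Set.Iic (n - j)))
    refine e1.trans (EventuallyEq.trans ?_ e2.symm)
    exact (ae_eq_refl _).sub ((hconst r j ((le_max_right _ _).trans hj)).trans
      (hconst _ j hj).symm)
  rw [lpNorm_congr_ae integrable_condExp.aestronglyMeasurable heq]
  exact (hZL.sub (hYL _)).lpNorm_condExp_le_lpNorm one_le_two

end Approximation

/-- The approximation, on the `k`-th block of length `p`, of the sum of the centered process by a
function of the innovations of this block. -/
noncomputable def blockSum {Ω : Type*} [MeasurableSpace Ω] (P : Measure Ω) (K : ℝ → ℝ) (a : ℕ → ℝ)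
    (ε : ℤ → Ω → ℝ) (p k : ℕ) (ω : Ω) : ℝ :=
  ∑ i ∈ Finset.range p, (condMean P K a ε (i + 1) (headSum a ε (k * p + i : ℕ) (i + 1) ω) -
    ∫ ω', K (tailSum a ε 0 0 ω') ∂P)

section Approximation

lemma sum_range_mul {M : Type*} [AddCommMonoid M] (f : ℕ → M) (p q : ℕ) :
    ∑ n ∈ Finset.range (q * p), f n =
      ∑ k ∈ Finset.range q, ∑ i ∈ Finset.range p, f (k * p + i) := by
  induction q with
  | zero => simp
  | succ q ih => rw [Finset.sum_range_succ, ← ih, Nat.succ_mul, Finset.sum_range_add]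

/-- The averages over blocks that bound the approximation error tend to zero. -/
lemma tendsto_tsum_sqrt_average {A d : ℕ → ℝ} (hA0 : ∀ j, 0 ≤ A j) (hA : Summable A)
    (hd0 : ∀ r, 0 ≤ d r) (hd : Tendsto d atTop (𝓝 0)) :
    Tendsto (fun p : ℕ => ∑' j, √((p : ℝ)⁻¹ * ∑ i ∈ Finset.range p, min (A j) (d (i + 1)) ^ 2))
      atTop (𝓝 0) := by
  have := tendsto_tsum_of_dominated_convergence (𝓕 := atTop) (bound := A) (g := fun _ => (0 : ℝ))
    (f := fun (p : ℕ) j => √((p : ℝ)⁻¹ * ∑ i ∈ Finset.range p, min (A j) (d (i + 1)) ^ 2)) hA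
    (fun j => ?_) (Eventually.of_forall fun p j => ?_)
  · simpa using this
  · have h1 : Tendsto (fun i => min (A j) (d (i + 1)) ^ 2) atTop (𝓝 0) := by
      have h2 := (tendsto_const_nhds (x := A j)).min (hd.comp (tendsto_add_atTop_nat 1))
      rw [min_eq_right (hA0 j)] at h2
      simpa using h2.pow 2
    simpa using h1.cesaro.sqrt
  · rw [Real.norm_eq_abs, abs_of_nonneg (Real.sqrt_nonneg _)]
    refine (Real.sqrt_le_sqrt (y := A j ^ 2) ?_).trans_eq (Real.sqrt_sq (hA0 j))
    rcases Nat.eq_zero_or_pos p with rfl | hp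
    · simpa using sq_nonneg (A j)
    have hp' : (0 : ℝ) < p := by exact_mod_cast hp
    rw [inv_mul_le_iff₀ hp']
    refine (Finset.sum_le_card_nsmul _ _ (A j ^ 2) fun i _ => ?_).trans_eq (by simp)
    exact pow_le_pow_left₀ (le_min (hA0 j) (hd0 _)) (min_le_left _ _) 2

variable {Ω : Type*} {mΩ : MeasurableSpace Ω} {P : Measure Ω} [IsProbabilityMeasure P]
  {ε : ℤ → Ω → ℝ} {a : ℕ → ℝ} {ν : Measure ℝ} {K : ℝ → ℝ} {C : ℝ≥0} {J : ℕ}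

lemma lpNorm_condExp_sub_condMean_sub_le (h : IsIIDSequence ε ν P)
    (hC : SmoothingHead P a ε C J)
    (hs : ∀ n : ℤ, ∀ᵐ ω ∂P, Summable fun i : ℕ => a i * ε (n - i) ω)
    (hK : Measurable K) (hK1 : Integrable K) (n : ℤ)
    (hZL : MemLp (fun ω => K (tailSum a ε n 0 ω)) 2 P) (r : ℕ) {d₀ : ℝ}
    (hd₀ : lpNorm (fun ω => K (tailSum a ε 0 0 ω) -
      condMean P K a ε r (headSum a ε 0 r ω)) 2 P ≤ d₀) (j : ℕ) :
    lpNorm (P[fun ω => K (tailSum a ε n 0 ω) -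
        condMean P K a ε r (headSum a ε n r ω) | sigmaOf ε (Set.Iic (n - j))] -
      P[fun ω => K (tailSum a ε n 0 ω) -
        condMean P K a ε r (headSum a ε n r ω) | sigmaOf ε (Set.Iic (n - j - 1))]) 2 P ≤
      min (if J ≤ j then 4 * (2 * C * ∫ u, |K u|) * √(∫ y, min 1 ((a j * y) ^ 2) ∂ν) else 2 * d₀)
        (2 * lpNorm (fun ω => K (tailSum a ε 0 0 ω) -
          condMean P K a ε r (headSum a ε 0 r ω)) 2 P) := by
  have hYL := memLp_condMean h hs hK n hZL r
  have hDL : MemLp (fun ω => K (tailSum a ε n 0 ω) -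
      condMean P K a ε r (headSum a ε n r ω)) 2 P := hZL.sub hYL
  have h2d : lpNorm (P[fun ω => K (tailSum a ε n 0 ω) -
      condMean P K a ε r (headSum a ε n r ω) | sigmaOf ε (Set.Iic (n - j))] -
    P[fun ω => K (tailSum a ε n 0 ω) -
      condMean P K a ε r (headSum a ε n r ω) | sigmaOf ε (Set.Iic (n - j - 1))]) 2 P ≤
      2 * lpNorm (fun ω => K (tailSum a ε 0 0 ω) -
      condMean P K a ε r (headSum a ε 0 r ω)) 2 P := by
    have e1 := hDL.lpNorm_condExp_le_lpNorm (m := sigmaOf ε (Set.Iic (n - j))) one_le_two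
    have e2 := hDL.lpNorm_condExp_le_lpNorm (m := sigmaOf ε (Set.Iic (n - j - 1)))
      one_le_two
    rw [lpNorm_sub_condMean_eq h hs hK n r] at e1 e2
    refine (lpNorm_sub_le (hDL.condExp one_le_two) one_le_two).trans ?_
    rw [two_mul]
    exact add_le_add e1 e2
  refine le_min ?_ h2d
  split_ifs with hj
  · have e1 := lpNorm_condExp_comp_tailSum_sub_le h hC hs hK hK1 n hZL hj
    have e2 := lpNorm_condExp_condMean_sub_le h hC hs hK hK1 n hZL hj r
    have hsub : ∀ S : Set ℤ, P[fun ω => K (tailSum a ε n 0 ω) -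
        condMean P K a ε r (headSum a ε n r ω) | sigmaOf ε S] =ᵐ[P]
        P[fun ω => K (tailSum a ε n 0 ω) | sigmaOf ε S] -
        P[fun ω => condMean P K a ε r (headSum a ε n r ω) | sigmaOf ε S] := fun S =>
      condExp_sub (hZL.integrable one_le_two) (hYL.integrable one_le_two) _
    have heq := (hsub (Set.Iic (n - j))).sub (hsub (Set.Iic (n - j - 1)))
    rw [sub_sub_sub_comm] at heq
    rw [lpNorm_congr_ae (integrable_condExp.sub integrable_condExp).aestronglyMeasurable heq]
    refine (lpNorm_sub_le ((hZL.condExp one_le_two).sub (hZL.condExp one_le_two))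
      one_le_two).trans ((add_le_add e1 e2).trans_eq ?_)
    ring
  · exact h2d.trans (by linarith)

omit [IsProbabilityMeasure P] in
lemma lpNorm_sum_Ico_le {Z : ℕ → Ω → ℝ} (hZ : ∀ n, MemLp (Z n) 2 P) {L : ℝ}
    (hL : ∀ n, lpNorm (Z n) 2 P = L) {M N p : ℕ} (hMN : N - M ≤ p) :
    lpNorm (∑ n ∈ Finset.Ico M N, Z n) 2 P ≤ p * L := by
  refine (lpNorm_sum_le (fun n _ => hZ n) one_le_two).trans ?_
  simp only [hL]
  rw [Finset.sum_const, Nat.card_Ico, nsmul_eq_mul]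
  exact mul_le_mul_of_nonneg_right (by exact_mod_cast hMN) (hL 0 ▸ lpNorm_nonneg)

/-- The sums of the centered process are approximated by sums of independent blocks. -/
theorem exists_blockSum_approx (h : IsIIDSequence ε ν P) (hC : SmoothingHead P a ε C J)
    (hs : ∀ n : ℤ, ∀ᵐ ω ∂P, Summable fun i : ℕ => a i * ε (n - i) ω)
    (hsum : Summable fun i => √(∫ y, min 1 ((a i * y) ^ 2) ∂ν))
    (hK : Measurable K) (hK1 : Integrable K) (hK2 : MemLp K 2) {η : ℝ} (hη : 0 < η) :
    ∃ (p : ℕ) (R : ℝ), 0 < p ∧ ∀ N : ℕ, lpNorm (fun ω => ∑ n ∈ Finset.range N,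
      (K (tailSum a ε n 0 ω) - ∫ ω', K (tailSum a ε 0 0 ω') ∂P) -
        ∑ k ∈ Finset.range (N / p), blockSum P K a ε p k ω) 2 P ≤ R + √N * η := by
  set m : ℝ := ∫ ω', K (tailSum a ε 0 0 ω') ∂P
  have hZL : ∀ n, MemLp (fun ω => K (tailSum a ε n 0 ω)) 2 P := fun n =>
    memLp_comp_of_le_volume (measurable_tailSum (a := a) h.measurable n 0).aemeasurable
      hK2 (isSmoothing_map_tailSum_zero h hC hs n).le_volume
  have hYL : ∀ n r, MemLp (fun ω => condMean P K a ε r (headSum a ε n r ω)) 2 P := fun n r =>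
    memLp_condMean h hs hK n (hZL n) r
  have hDL : ∀ (n : ℤ) r, MemLp (fun ω => K (tailSum a ε n 0 ω) -
      condMean P K a ε r (headSum a ε n r ω)) 2 P := fun n r => (hZL n).sub (hYL n r)
  set d : ℕ → ℝ := fun r => lpNorm (fun ω => K (tailSum a ε 0 0 ω) -
      condMean P K a ε r (headSum a ε 0 r ω)) 2 P with hd
  have hdlim : Tendsto d atTop (𝓝 0) := tendsto_lpNorm_sub_condMean h hC hs hK hK2
  obtain ⟨d₀, hd₀⟩ := hdlim.bddAbove_range
  have hd₀' : ∀ r, d r ≤ d₀ := fun r => hd₀ ⟨r, rfl⟩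
  have hd00 : 0 ≤ d₀ := lpNorm_nonneg.trans (hd₀' 0)
  set B : ℝ := 2 * C * ∫ u, |K u|
  have hB : 0 ≤ B := by positivity
  set s : ℕ → ℝ := fun i => √(∫ y, min 1 ((a i * y) ^ 2) ∂ν) with hsdef
  set A : ℕ → ℝ := fun j => if J ≤ j then 4 * B * s j else 2 * d₀ with hAdef
  have hA0 : ∀ j, 0 ≤ A j := by
    intro j
    simp only [hAdef]
    split_ifs
    · exact mul_nonneg (by positivity) (Real.sqrt_nonneg _)
    · positivity
  have hA : Summable A := by
    refine (summable_congr_cofinite ?_).1 (hsum.mul_left (4 * B))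
    rw [Nat.cofinite_eq_atTop]
    filter_upwards [eventually_ge_atTop J] with j hj
    simp only [hAdef, if_pos hj, hsdef]
  have hinc : ∀ (n : ℤ) (r j : ℕ), lpNorm (P[fun ω => K (tailSum a ε n 0 ω) -
        condMean P K a ε r (headSum a ε n r ω) | sigmaOf ε (Set.Iic (n - j))] -
      P[fun ω => K (tailSum a ε n 0 ω) -
        condMean P K a ε r (headSum a ε n r ω) | sigmaOf ε (Set.Iic (n - j - 1))]) 2 P ≤
      min (A j) (2 * d r) := fun n r j =>
    lpNorm_condExp_sub_condMean_sub_le h hC hs hK hK1 n (hZL n) r (hd₀' r) j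
  have hlim := tendsto_tsum_sqrt_average hA0 hA (d := fun r => 2 * d r)
    (fun r => mul_nonneg zero_le_two lpNorm_nonneg) (by simpa using hdlim.const_mul 2)
  obtain ⟨p, hpη, hp⟩ := ((hlim.eventually_lt_const hη).and (eventually_gt_atTop 0)).exists
  have hp' : (0 : ℝ) < p := by exact_mod_cast hp
  set w : ℕ → ℝ := fun j => √((p : ℝ)⁻¹ * ∑ i ∈ Finset.range p, min (A j) (2 * d (i + 1)) ^ 2)
    with hw
  have hwA : ∀ j, w j ≤ A j := by
    intro j
    refine (Real.sqrt_le_sqrt (y := A j ^ 2) ?_).trans_eq (Real.sqrt_sq (hA0 j))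
    rw [inv_mul_le_iff₀ hp']
    refine (Finset.sum_le_card_nsmul _ _ (A j ^ 2) fun i _ => ?_).trans_eq (by simp)
    exact pow_le_pow_left₀ (le_min (hA0 j) (mul_nonneg zero_le_two lpNorm_nonneg))
      (min_le_left _ _) 2
  have hwsum : Summable w := hA.of_nonneg_of_le (fun j => Real.sqrt_nonneg _) hwA
  set Z : ℕ → Ω → ℝ := fun n ω => K (tailSum a ε n 0 ω) - m with hZdef
  have hZmL : ∀ n, MemLp (Z n) 2 P := fun n => (hZL n).sub (memLp_const m)
  have hZeq : ∀ n, lpNorm (Z n) 2 P = lpNorm (Z 0) 2 P := by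
    intro n
    have hid := ((h.identDistrib_headSum_tailSum (a := a) n 0).comp measurable_snd).comp
      (hK.sub_const m)
    rw [← toReal_eLpNorm (hZmL n).aestronglyMeasurable,
      ← toReal_eLpNorm (hZmL 0).aestronglyMeasurable]
    exact congrArg ENNReal.toReal (hid.eLpNorm_eq 2)
  refine ⟨p, p * lpNorm (Z 0) 2 P, hp, fun N => ?_⟩
  set q := N / p
  have hqN : q * p ≤ N := Nat.div_mul_le_self N p
  set D : ℕ → Ω → ℝ := fun n ω => K (tailSum a ε n 0 ω) -
    condMean P K a ε (n % p + 1) (headSum a ε n (n % p + 1) ω) with hD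
  have hsplit : (fun ω => ∑ n ∈ Finset.range N, (K (tailSum a ε n 0 ω) - m) -
      ∑ k ∈ Finset.range q, blockSum P K a ε p k ω) =
      (fun ω => ∑ n ∈ Finset.range (q * p), D n ω) +
        ∑ n ∈ Finset.Ico (q * p) N, Z n := by
    ext ω
    rw [Pi.add_apply, Finset.sum_apply,
      ← Finset.sum_range_add_sum_Ico (fun n : ℕ => K (tailSum a ε n 0 ω) - m) hqN,
      sum_range_mul, sum_range_mul, add_sub_right_comm, ← Finset.sum_sub_distrib]
    congr 1
    refine Finset.sum_congr rfl fun k _ => ?_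
    rw [blockSum, ← Finset.sum_sub_distrib]
    refine Finset.sum_congr rfl fun i hi => ?_
    simp only [hD]
    rw [Nat.mul_add_mod_of_lt (Finset.mem_range.1 hi)]
    ring
  rw [hsplit]
  have hmain : lpNorm (fun ω => ∑ n ∈ Finset.range (q * p), D n ω) 2 P ≤ ∑' j, √N * w j := by
    refine lpNorm_sum_le_tsum_of_condExp (fun k => sigmaOf ε (Set.Iic k))
      (fun i j hij => sigmaOf_mono (Set.Iic_subset_Iic.2 hij)) (fun k => sigmaOf_le h.measurable _)
      (q * p) D (fun n => hDL n _) (fun n => ?_) (fun n => ?_) _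
      (fun j => mul_nonneg (Real.sqrt_nonneg _) (Real.sqrt_nonneg _)) (hwsum.mul_left _)
      (fun j => ?_)
    · refine Measurable.stronglyMeasurable (Measurable.sub (hK.comp ?_)
        ((measurable_condMean h.measurable hK _).comp ?_))
      · exact measurable_tailSum_sigmaOf fun i => by simp only [Set.mem_Iic]; omega
      · exact measurable_headSum_sigmaOf fun i _ => by simp only [Set.mem_Iic]; omega
    · exact tendsto_lpNorm_condExp_sub_condMean h hC hs hK hK2 n (Nat.succ (n % p))
    · refine (Finset.sum_le_sum fun (n : ℕ) _ => pow_le_pow_left₀ lpNorm_nonneg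
        (hinc n (n % p + 1) j) 2).trans ?_
      rw [sum_range_mul, mul_pow, Real.sq_sqrt (Nat.cast_nonneg N), hw, Real.sq_sqrt (by positivity)]
      have : ∀ k ∈ Finset.range q, ∑ i ∈ Finset.range p,
          min (A j) (2 * d ((k * p + i) % p + 1)) ^ 2 =
          ∑ i ∈ Finset.range p, min (A j) (2 * d (i + 1)) ^ 2 := fun k _ =>
        Finset.sum_congr rfl fun i hi => by rw [Nat.mul_add_mod_of_lt (Finset.mem_range.1 hi)]
      rw [Finset.sum_congr rfl this, Finset.sum_const, Finset.card_range, nsmul_eq_mul, ← mul_assoc]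
      gcongr
      rw [← div_eq_mul_inv]
      exact Nat.cast_div_le
  have hrest : lpNorm (∑ n ∈ Finset.Ico (q * p) N, Z n) 2 P ≤ p * lpNorm (Z 0) 2 P := by
    refine lpNorm_sum_Ico_le hZmL hZeq ?_
    have h1 : q * p + N % p = N := Nat.div_add_mod' N p
    have h2 := Nat.mod_lt N hp
    omega
  rw [tsum_mul_left] at hmain
  have hDsum : MemLp (fun ω => ∑ n ∈ Finset.range (q * p), D n ω) 2 P :=
    memLp_finsetSum _ fun n _ => hDL (n : ℤ) (n % p + 1)
  have hfin : √N * ∑' j, w j ≤ √N * η := mul_le_mul_of_nonneg_left hpη.le (Real.sqrt_nonneg _)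
  have hadd := lpNorm_add_le hDsum one_le_two (g := ∑ n ∈ Finset.Ico (q * p) N, Z n)
  linarith only [hadd, hfin, hmain, hrest]

end Approximation

section Blocks

variable {Ω : Type*} {mΩ : MeasurableSpace Ω} {P : Measure Ω} [IsProbabilityMeasure P]
  {ε : ℤ → Ω → ℝ} {a : ℕ → ℝ} {ν : Measure ℝ} {K : ℝ → ℝ}

omit [IsProbabilityMeasure P] in
lemma IsIIDSequence.identDistrib_tailSum (h : IsIIDSequence ε ν P) (n : ℤ) (j : ℕ) :
    IdentDistrib (tailSum a ε n j) (tailSum a ε 0 j) P P :=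
  (h.identDistrib_headSum_tailSum n j).comp measurable_snd

lemma IsIIDSequence.integral_condMean_headSum (h : IsIIDSequence ε ν P)
    (hs : ∀ n : ℤ, ∀ᵐ ω ∂P, Summable fun i : ℕ => a i * ε (n - i) ω)
    (hK : Measurable K) (n : ℤ) (hKX : MemLp (fun ω => K (tailSum a ε n 0 ω)) 2 P) (r : ℕ) :
    ∫ ω, condMean P K a ε r (headSum a ε n r ω) ∂P = ∫ ω, K (tailSum a ε 0 0 ω) ∂P := by
  rw [← integral_congr_ae (condExp_comp_tailSum_Ioi h hs hK n hKX r),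
    integral_condExp (sigmaOf_le h.measurable _)]
  exact ((h.identDistrib_tailSum (a := a) n 0).comp hK).integral_eq

lemma memLp_blockSum (h : IsIIDSequence ε ν P)
    (hs : ∀ n : ℤ, ∀ᵐ ω ∂P, Summable fun i : ℕ => a i * ε (n - i) ω)
    (hK : Measurable K) (hKX : ∀ n : ℤ, MemLp (fun ω => K (tailSum a ε n 0 ω)) 2 P) (p k : ℕ) :
    MemLp (blockSum P K a ε p k) 2 P :=
  memLp_finsetSum _ fun _ _ => (memLp_condMean h hs hK _ (hKX _) _).sub (memLp_const _)

lemma integral_blockSum (h : IsIIDSequence ε ν P)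
    (hs : ∀ n : ℤ, ∀ᵐ ω ∂P, Summable fun i : ℕ => a i * ε (n - i) ω)
    (hK : Measurable K) (hKX : ∀ n : ℤ, MemLp (fun ω => K (tailSum a ε n 0 ω)) 2 P) (p k : ℕ) :
    ∫ ω, blockSum P K a ε p k ω ∂P = 0 := by
  have hint : ∀ (n : ℤ) r, Integrable (fun ω => condMean P K a ε r (headSum a ε n r ω)) P :=
    fun n r => (memLp_condMean h hs hK n (hKX n) r).integrable one_le_two
  have hint' : ∀ i ∈ Finset.range p, Integrable (fun ω =>
      condMean P K a ε (i + 1) (headSum a ε (k * p + i : ℕ) (i + 1) ω) -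
        ∫ ω', K (tailSum a ε 0 0 ω') ∂P) P := fun i _ => (hint _ _).sub (integrable_const _)
  unfold blockSum
  rw [integral_finsetSum _ hint']
  refine Finset.sum_eq_zero fun i _ => ?_
  rw [integral_sub (hint _ _) (integrable_const _), integral_const, probReal_univ, one_smul,
    h.integral_condMean_headSum hs hK _ (hKX _), sub_self]

lemma measurable_blockSum_sigmaOf (hε : ∀ n, Measurable (ε n)) (hK : Measurable K) (p k : ℕ) :
    Measurable[sigmaOf ε (Set.Ico (k * p : ℤ) ((k + 1) * p))] (blockSum P K a ε p k) := by
  refine Finset.measurable_fun_sum _ fun i hi => Measurable.sub_const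
    ((measurable_condMean hε hK _).comp (measurable_headSum_sigmaOf fun j hj => ?_)) _
  have := Finset.mem_range.1 hi
  rw [Set.mem_Ico, add_mul, one_mul]
  push_cast
  constructor <;> linarith [show (j : ℤ) ≤ i by omega, show (i : ℤ) < p by omega,
    show (0 : ℤ) ≤ j by omega]

lemma IsIIDSequence.identDistrib_blockSum (h : IsIIDSequence ε ν P) (hK : Measurable K)
    (p k : ℕ) : IdentDistrib (blockSum P K a ε p k) (blockSum P K a ε p 0) P P := by
  have hm : Measurable fun e : ℤ → ℝ => ∑ i ∈ Finset.range p,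
      (condMean P K a ε (i + 1) (headSum a (fun i (e : ℤ → ℝ) => e i) (i : ℤ) (i + 1) e) -
        ∫ ω', K (tailSum a ε 0 0 ω') ∂P) :=
    Finset.measurable_fun_sum _ fun i _ => ((measurable_condMean h.measurable hK _).comp
      (measurable_headSum (fun i => measurable_pi_apply i) _ _)).sub_const _
  have := (h.identDistrib_shift (k * p : ℤ)).comp hm
  simp only [Function.comp_def, ← headSum_shift] at this
  convert this using 1
  · ext ω
    simp only [blockSum, Nat.cast_add, Nat.cast_mul]
  · ext ω
    simp only [blockSum, zero_mul, zero_add]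
    rfl

lemma IsIIDSequence.indepFun_blockSum (h : IsIIDSequence ε ν P) (hK : Measurable K) (p n : ℕ)
    (w : ℕ → ℝ) : IndepFun (fun ω => ∑ k ∈ Finset.range n, w k * blockSum P K a ε p k ω)
      (blockSum P K a ε p n) P := by
  refine h.indepFun (A := Set.Iio (n * p : ℤ)) (B := Set.Ico (n * p : ℤ) ((n + 1) * p)) ?_ ?_
    (measurable_blockSum_sigmaOf h.measurable hK p n)
  · rw [Set.disjoint_left]
    intro x hx hx'
    exact absurd hx'.1 (not_le.2 hx)
  · refine Finset.measurable_fun_sum _ fun k hk => Measurable.const_mul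
      ((measurable_blockSum_sigmaOf h.measurable hK p k).mono (sigmaOf_mono fun x hx => ?_) le_rfl) _
    refine lt_of_lt_of_le hx.2 ?_
    have : (k : ℤ) + 1 ≤ n := by exact_mod_cast Finset.mem_range.1 hk
    exact mul_le_mul_of_nonneg_right this (by positivity)

end Blocks

lemma norm_prod_sub_prod_le_sum {ι : Type*} (s : Finset ι) {x y : ι → ℂ}
    (hx : ∀ i ∈ s, ‖x i‖ ≤ 1) (hy : ∀ i ∈ s, ‖y i‖ ≤ 1) :
    ‖∏ i ∈ s, x i - ∏ i ∈ s, y i‖ ≤ ∑ i ∈ s, ‖x i - y i‖ := by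
  classical
  induction s using Finset.induction_on with
  | empty => simp
  | insert i s hi ih =>
    rw [Finset.prod_insert hi, Finset.prod_insert hi, Finset.sum_insert hi]
    have ih' := ih (fun j hj => hx j (Finset.mem_insert_of_mem hj))
      (fun j hj => hy j (Finset.mem_insert_of_mem hj))
    have hys : ‖∏ j ∈ s, x j‖ ≤ 1 := by
      rw [norm_prod]
      exact Finset.prod_le_one (fun j _ => norm_nonneg _)
        fun j hj => hx j (Finset.mem_insert_of_mem hj)
    calc ‖x i * ∏ j ∈ s, x j - y i * ∏ j ∈ s, y j‖
        = ‖(x i - y i) * ∏ j ∈ s, x j + y i * (∏ j ∈ s, x j - ∏ j ∈ s, y j)‖ := by ring_nf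
      _ ≤ ‖x i - y i‖ * ‖∏ j ∈ s, x j‖ + ‖y i‖ * ‖∏ j ∈ s, x j - ∏ j ∈ s, y j‖ := by
        rw [← norm_mul, ← norm_mul]
        exact norm_add_le _ _
      _ ≤ ‖x i - y i‖ * 1 + 1 * ∑ j ∈ s, ‖x j - y j‖ := by
        gcongr
        exact hy i (Finset.mem_insert_self i s)
      _ = _ := by ring

lemma isLittleO_charFun_sub_quadratic {Ω : Type*} {mΩ : MeasurableSpace Ω} {P : Measure Ω}
    [IsProbabilityMeasure P] {X : Ω → ℝ} (hX : MemLp X 2 P) (h0 : ∫ ω, X ω ∂P = 0) :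
    (fun t : ℝ => charFun (P.map X) t - (1 - (∫ ω, X ω ^ 2 ∂P : ℝ) * t ^ 2 / 2))
      =o[𝓝 0] fun t => t ^ 2 := by
  have hX' : AEMeasurable X P := hX.aestronglyMeasurable.aemeasurable
  have hid : MemLp id 2 (P.map X) :=
    (memLp_map_measure_iff aestronglyMeasurable_id hX').2 hX
  have := Measure.isProbabilityMeasure_map hX'
  have h := taylor_isLittleO_univ (x₀ := (0 : ℝ)) (n := 2) (contDiff_charFun (n := 2) hid)
  simp only [sub_zero] at h
  refine h.congr_left fun t => ?_
  rw [taylorWithinEval_charFun_two_zero hX' hid, h0]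
  simp

lemma isLittleO_charFun_sub_exp {Ω : Type*} {mΩ : MeasurableSpace Ω} {P : Measure Ω}
    [IsProbabilityMeasure P] {X : Ω → ℝ} (hX : MemLp X 2 P) (h0 : ∫ ω, X ω ∂P = 0) :
    (fun t : ℝ => charFun (P.map X) t - Complex.exp (-((∫ ω, X ω ^ 2 ∂P : ℝ) * t ^ 2 / 2)))
      =o[𝓝 0] fun t => t ^ 2 := by
  have h1 := isLittleO_charFun_sub_quadratic hX h0
  set v : ℝ := ∫ ω, X ω ^ 2 ∂P with hv
  have hv0 : 0 ≤ v := integral_nonneg fun _ => sq_nonneg _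
  have hG0 : ∫ x, x ∂(gaussianReal 0 v.toNNReal) = 0 := integral_id_gaussianReal
  have hGv : ∫ x, x ^ 2 ∂(gaussianReal 0 v.toNNReal) = v := by
    have := variance_eq_integral (μ := gaussianReal 0 v.toNNReal) (X := fun x : ℝ => x)
      measurable_id.aemeasurable
    rw [hG0, variance_fun_id_gaussianReal] at this
    simpa [hv0] using this.symm
  have h2 := isLittleO_charFun_sub_quadratic (P := gaussianReal 0 v.toNNReal) (X := fun x => x) (memLp_id_gaussianReal 2) hG0
  rw [hGv] at h2
  refine (h1.sub h2).congr_left fun t => ?_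
  rw [show (fun x : ℝ => x) = id from rfl, Measure.map_id, charFun_gaussianReal]
  simp only [sub_sub_sub_cancel_right]
  congr 2
  simp [hv0]

/-- Centered, square integrable, identically distributed variables such that each one is
independent of the linear combinations of the preceding ones. -/
structure IsBlockSequence {Ω : Type*} [MeasurableSpace Ω] (B : ℕ → Ω → ℝ) (P : Measure Ω) :
    Prop where
  memLp : ∀ k, MemLp (B k) 2 P
  integral_eq_zero : ∀ k, ∫ ω, B k ω ∂P = 0
  identDistrib : ∀ k, IdentDistrib (B k) (B 0) P P
  indepFun : ∀ (n : ℕ) (w : ℕ → ℝ), IndepFun (fun ω => ∑ k ∈ Finset.range n, w k * B k ω) (B n) P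

namespace IsBlockSequence

variable {Ω : Type*} {mΩ : MeasurableSpace Ω} {P : Measure Ω}
  {B : ℕ → Ω → ℝ}

lemma memLp_sum (h : IsBlockSequence B P) (n : ℕ) :
    MemLp (fun ω => ∑ k ∈ Finset.range n, B k ω) 2 P :=
  memLp_finsetSum _ fun k _ => h.memLp k

lemma integral_sq_sum (h : IsBlockSequence B P) (n : ℕ) :
    ∫ ω, (∑ k ∈ Finset.range n, B k ω) ^ 2 ∂P = n * ∫ ω, B 0 ω ^ 2 ∂P := by
  induction n with
  | zero => simp
  | succ n ih =>
    have hT := h.memLp_sum n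
    have hind := h.indepFun n 1
    simp only [Pi.one_apply, one_mul] at hind
    have hcross : ∫ ω, (∑ k ∈ Finset.range n, B k ω) * B n ω ∂P = 0 := by
      rw [hind.integral_fun_mul_eq_mul_integral hT.aestronglyMeasurable
        (h.memLp n).aestronglyMeasurable, h.integral_eq_zero n, mul_zero]
    have hsq : ∫ ω, B n ω ^ 2 ∂P = ∫ ω, B 0 ω ^ 2 ∂P :=
      ((h.identDistrib n).comp (measurable_id.pow_const 2)).integral_eq
    have hi1 := hT.integrable_sq
    have hi2 := (h.memLp n).integrable_sq
    have hi3 : Integrable (fun ω => 2 * ((∑ k ∈ Finset.range n, B k ω) * B n ω)) P :=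
      (hT.integrable_mul (h.memLp n)).const_mul 2
    have hexp : ∀ ω, (∑ k ∈ Finset.range (n + 1), B k ω) ^ 2 =
        (∑ k ∈ Finset.range n, B k ω) ^ 2 +
          2 * ((∑ k ∈ Finset.range n, B k ω) * B n ω) + B n ω ^ 2 := fun ω => by
      rw [Finset.sum_range_succ]
      ring
    have hi13 : Integrable (fun ω => (∑ k ∈ Finset.range n, B k ω) ^ 2 +
      2 * ((∑ k ∈ Finset.range n, B k ω) * B n ω)) P := hi1.add hi3
    simp only [hexp]
    rw [integral_add hi13 hi2, integral_add hi1 hi3, integral_const_mul, hcross, ih, hsq]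
    push_cast
    ring

lemma lpNorm_sum (h : IsBlockSequence B P) (n : ℕ) :
    lpNorm (fun ω => ∑ k ∈ Finset.range n, B k ω) 2 P = √n * √(∫ ω, B 0 ω ^ 2 ∂P) := by
  rw [lpNorm_two_eq_sqrt (h.memLp_sum n).aestronglyMeasurable, h.integral_sq_sum,
    Real.sqrt_mul (Nat.cast_nonneg n)]

lemma charFun_sum [IsProbabilityMeasure P] (h : IsBlockSequence B P) (w : ℕ → ℝ) (n : ℕ) (u : ℝ) :
    charFun (P.map fun ω => ∑ k ∈ Finset.range n, w k * B k ω) u =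
      ∏ k ∈ Finset.range n, charFun (P.map (B 0)) (w k * u) := by
  have hB : ∀ k, AEMeasurable (B k) P := fun k => (h.memLp k).aestronglyMeasurable.aemeasurable
  induction n with
  | zero => simp
  | succ n ih =>
    have hind : IndepFun (fun ω => ∑ k ∈ Finset.range n, w k * B k ω) (fun ω => w n * B n ω) P :=
      (h.indepFun n w).comp measurable_id (measurable_const_mul (w n))
    simp only [Finset.sum_range_succ]
    rw [hind.charFun_map_fun_add_eq_mul
      (Finset.aemeasurable_fun_sum _ fun k _ => (hB k).const_mul _) ((hB n).const_mul _),
      Pi.mul_apply, ih, Finset.prod_range_succ, charFun_map_mul_comp (hB n),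
      (h.identDistrib n).map_eq]

end IsBlockSequence

section CharFunLimit

variable {Ω : Type*} {mΩ : MeasurableSpace Ω} {P : Measure Ω} [IsProbabilityMeasure P]
  {ι : Type*} [Fintype ι]

lemma sum_range_ite_lt {M : Type*} [AddCommMonoid M] (f : ℕ → M) {m n : ℕ} (h : n ≤ m) :
    ∑ k ∈ Finset.range m, (if k < n then f k else 0) = ∑ k ∈ Finset.range n, f k := by
  rw [← Finset.sum_filter]
  congr 1
  ext k
  simp only [Finset.mem_filter, Finset.mem_range]
  omega

lemma sum_mul_sum_range_eq (c : ι → ℝ) (n : ι → ℕ) {m : ℕ} (hm : ∀ i, n i ≤ m) (b : ℕ → ℝ) :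
    ∑ i, c i * ∑ k ∈ Finset.range (n i), b k =
      ∑ k ∈ Finset.range m, (∑ i, if k < n i then c i else 0) * b k := by
  simp only [Finset.sum_mul, ite_mul, zero_mul]
  rw [Finset.sum_comm]
  refine Finset.sum_congr rfl fun i _ => ?_
  rw [sum_range_ite_lt _ (hm i), Finset.mul_sum]

lemma sum_range_sq_eq (c : ι → ℝ) (n : ι → ℕ) {m : ℕ} (hm : ∀ i, n i ≤ m) :
    ∑ k ∈ Finset.range m, (∑ i, if k < n i then c i else 0) ^ 2 =
      ∑ i, ∑ j, c i * c j * min (n i : ℝ) (n j) := by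
  have h : ∀ k i j, (if k < n i then c i else 0) * (if k < n j then c j else 0) =
      if k < min (n i) (n j) then c i * c j else 0 := by
    intro k i j
    simp only [lt_min_iff, mul_ite, ite_mul, zero_mul, mul_zero]
    split_ifs <;> simp_all
  simp only [sq, Finset.sum_mul_sum, h]
  rw [Finset.sum_comm]
  refine Finset.sum_congr rfl fun i _ => ?_
  rw [Finset.sum_comm]
  refine Finset.sum_congr rfl fun j _ => ?_
  rw [sum_range_ite_lt (fun _ => c i * c j) (min_le_of_left_le (hm i)), Finset.sum_const,
    Finset.card_range, nsmul_eq_mul, Nat.cast_min, mul_comm]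

lemma IsBlockSequence.tendsto_charFun {B : ℕ → Ω → ℝ} (h : IsBlockSequence B P) (c : ι → ℝ)
    {n : ι → ℕ → ℕ} {τ : ι → ℝ}
    (hn : ∀ i, Tendsto (fun N : ℕ => (n i N : ℝ) / N) atTop (𝓝 (τ i))) :
    Tendsto (fun N : ℕ => charFun (P.map fun ω =>
        ∑ i, c i * ∑ k ∈ Finset.range (n i N), B k ω) (√N)⁻¹) atTop
      (𝓝 (Complex.exp (-((∫ ω, B 0 ω ^ 2 ∂P) *
        (∑ i, ∑ j, c i * c j * min (τ i) (τ j)) / 2 : ℝ)))) := by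
  set v : ℝ := ∫ ω, B 0 ω ^ 2 ∂P
  set m : ℕ → ℕ := fun N => ∑ i, n i N
  have hm : ∀ N i, n i N ≤ m N := fun N i =>
    Finset.single_le_sum (f := fun i => n i N) (fun _ _ => Nat.zero_le _) (Finset.mem_univ i)
  set w : ℕ → ℕ → ℝ := fun N k => ∑ i, if k < n i N then c i else 0
  set W : ℝ := ∑ i, |c i|
  have hw : ∀ N k, |w N k| ≤ W := fun N k =>
    (Finset.abs_sum_le_sum_abs _ _).trans (Finset.sum_le_sum fun i _ => by
      split_ifs
      · exact le_rfl
      · simp)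
  have hx : ∀ N : ℕ, ((√N)⁻¹) ^ 2 = (N : ℝ)⁻¹ := fun N => by
    rw [inv_pow, Real.sq_sqrt (Nat.cast_nonneg N)]
  have hx0 : Tendsto (fun N : ℕ => (√N)⁻¹) atTop (𝓝 0) :=
    tendsto_inv_atTop_zero.comp (Real.tendsto_sqrt_atTop.comp tendsto_natCast_atTop_atTop)
  set e : ℝ → ℂ := fun s => Complex.exp (-(v * s ^ 2 / 2)) with he
  have he' : ∀ s, e s = Complex.exp (-(v * s ^ 2 / 2) : ℝ) := fun s => by simp [he]
  have hv : 0 ≤ v := integral_nonneg fun _ => sq_nonneg _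
  have hform : ∀ N : ℕ, charFun (P.map fun ω =>
      ∑ i, c i * ∑ k ∈ Finset.range (n i N), B k ω) (√N)⁻¹ =
      ∏ k ∈ Finset.range (m N), charFun (P.map (B 0)) (w N k * (√N)⁻¹) := by
    intro N
    rw [← h.charFun_sum]
    congr 2
    ext ω
    exact sum_mul_sum_range_eq c _ (hm N) _
  have hlim : Tendsto (fun N : ℕ => ∏ k ∈ Finset.range (m N), e (w N k * (√N)⁻¹)) atTop
      (𝓝 (Complex.exp (-(v * (∑ i, ∑ j, c i * c j * min (τ i) (τ j)) / 2 : ℝ)))) := by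
    have hprod : ∀ N : ℕ, ∏ k ∈ Finset.range (m N), e (w N k * (√N)⁻¹) =
        Complex.exp (-(v * (∑ i, ∑ j, c i * c j * min ((n i N : ℝ) / N) (n j N / N)) / 2 : ℝ)) := by
      intro N
      simp only [he']
      rw [← Complex.exp_sum, ← Complex.ofReal_sum, ← Complex.ofReal_neg]
      congr 2
      have := sum_range_sq_eq c (fun i => n i N) (hm N)
      simp only [mul_pow, hx]
      simp only [min_div_div_right (Nat.cast_nonneg N), ← mul_div_assoc, ← Finset.sum_div]
      rw [← this, Finset.sum_neg_distrib, ← Finset.sum_div, ← Finset.mul_sum, ← Finset.sum_mul,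
        div_eq_mul_inv (_ * _) (N : ℝ), mul_assoc]
    simp only [hprod]
    refine (Complex.continuous_exp.tendsto _).comp ?_
    rw [← Complex.ofReal_neg]
    simp only [← Complex.ofReal_neg]
    refine (Complex.continuous_ofReal.tendsto _).comp ?_
    refine (Tendsto.div_const (Tendsto.const_mul v ?_) 2).neg
    exact tendsto_finsetSum _ fun i _ => tendsto_finsetSum _ fun j _ =>
      ((hn i).min (hn j)).const_mul _
  have hdiff : Tendsto (fun N : ℕ => ∏ k ∈ Finset.range (m N), charFun (P.map (B 0))
      (w N k * (√N)⁻¹) - ∏ k ∈ Finset.range (m N), e (w N k * (√N)⁻¹)) atTop (𝓝 0) := by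
    have hmT : Tendsto (fun N : ℕ => (m N : ℝ) / N) atTop (𝓝 (∑ i, τ i)) := by
      simp only [m, Nat.cast_sum, Finset.sum_div]
      exact tendsto_finsetSum _ fun i _ => hn i
    obtain ⟨T, hT⟩ := hmT.bddAbove_range
    have hT' : ∀ N : ℕ, (m N : ℝ) / N ≤ T := fun N => hT ⟨N, rfl⟩
    have hT0 : 0 ≤ T := (by positivity : (0 : ℝ) ≤ (m 0 : ℝ) / (0 : ℕ)).trans (hT' 0)
    rw [Metric.tendsto_nhds]
    intro r hr
    set κ : ℝ := r / (2 * (W ^ 2 * T + 1)) with hκ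
    have hκ0 : 0 < κ := by positivity
    have ho := (isLittleO_charFun_sub_exp (h.memLp 0) (h.integral_eq_zero 0)).bound hκ0
    obtain ⟨δ, hδ, hball⟩ := Metric.eventually_nhds_iff.1 ho
    have hWx : Tendsto (fun N : ℕ => W * (√N)⁻¹) atTop (𝓝 0) := by simpa using hx0.const_mul W
    filter_upwards [hWx.eventually_lt_const hδ] with N hN
    have hB := (h.memLp 0).aestronglyMeasurable.aemeasurable
    have := Measure.isProbabilityMeasure_map hB
    rw [dist_zero_right]
    calc _ ≤ ∑ k ∈ Finset.range (m N), ‖charFun (P.map (B 0)) (w N k * (√N)⁻¹) -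
          e (w N k * (√N)⁻¹)‖ := by
          refine norm_prod_sub_prod_le_sum _ (fun k _ => norm_charFun_le_one _) fun k _ => ?_
          rw [he', Complex.norm_exp_ofReal, Real.exp_le_one_iff]
          have : 0 ≤ v * (w N k * (√N)⁻¹) ^ 2 / 2 := by positivity
          linarith
      _ ≤ ∑ k ∈ Finset.range (m N), κ * (W ^ 2 * (N : ℝ)⁻¹) := by
          refine Finset.sum_le_sum fun k _ => ?_
          have hle : |w N k * (√N)⁻¹| ≤ W * (√N)⁻¹ := by
            rw [abs_mul, abs_of_nonneg (inv_nonneg.2 (Real.sqrt_nonneg (N : ℝ)))]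
            exact mul_le_mul_of_nonneg_right (hw N k) (by positivity)
          have := hball (y := w N k * (√N)⁻¹) (by
            rw [dist_zero_right, Real.norm_eq_abs]
            exact hle.trans_lt hN)
          refine this.trans (mul_le_mul_of_nonneg_left ?_ hκ0.le)
          rw [Real.norm_of_nonneg (sq_nonneg _), ← hx, ← mul_pow, sq_le_sq]
          exact hle.trans (le_abs_self _)
      _ = κ * W ^ 2 * ((m N : ℝ) / N) := by
          rw [Finset.sum_const, Finset.card_range, nsmul_eq_mul]
          ring
      _ ≤ κ * W ^ 2 * T := by
          gcongr
          exact hT' N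
      _ < r := by
          rw [hκ, mul_assoc, div_mul_eq_mul_div, div_lt_iff₀ (by positivity)]
          nlinarith [mul_nonneg (sq_nonneg W) hT0]
  simp only [hform]
  simpa using hdiff.add hlim

end CharFunLimit

lemma exists_tendsto_of_approx {u L e : ℕ → ℝ} (he : Tendsto e atTop (𝓝 0))
    (h : ∀ m, ∀ᶠ N in atTop, |u N - L m| ≤ e m) :
    ∃ l, Tendsto u atTop (𝓝 l) ∧ Tendsto L atTop (𝓝 l) := by
  have hu : CauchySeq u := by
    rw [Metric.cauchySeq_iff']
    intro r hr
    obtain ⟨m, hm⟩ := (he.eventually_lt_const (half_pos hr)).exists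
    obtain ⟨N, hN⟩ := eventually_atTop.1 (h m)
    refine ⟨N, fun n hn => ?_⟩
    rw [Real.dist_eq]
    have h1 := abs_le.1 (hN n hn)
    have h2 := abs_le.1 (hN N le_rfl)
    rw [abs_lt]
    constructor <;> linarith [h1.1, h1.2, h2.1, h2.2]
  obtain ⟨l, hl⟩ := cauchySeq_tendsto_of_complete hu
  refine ⟨l, hl, tendsto_iff_dist_tendsto_zero.2 (squeeze_zero (fun _ => dist_nonneg) (fun m => ?_) he)⟩
  rw [dist_comm, Real.dist_eq]
  exact le_of_tendsto (hl.sub_const (L m)).abs (h m)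

lemma tendsto_of_approx {u L : ℕ → ℂ} {l : ℂ} {e : ℕ → ℝ} (he : Tendsto e atTop (𝓝 0))
    (hL : Tendsto L atTop (𝓝 l)) (h : ∀ m, ∀ᶠ N in atTop, ‖u N - L m‖ ≤ e m) :
    Tendsto u atTop (𝓝 l) := by
  rw [Metric.tendsto_nhds]
  intro r hr
  have h0 : Tendsto (fun m => e m + dist (L m) l) atTop (𝓝 0) := by
    simpa using he.add (tendsto_iff_dist_tendsto_zero.1 hL)
  obtain ⟨m, hm⟩ := (h0.eventually_lt_const hr).exists
  filter_upwards [h m] with N hN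
  rw [← dist_eq_norm] at hN
  linarith [dist_triangle (u N) (L m) l]

lemma norm_charFun_map_sub_le {Ω : Type*} {mΩ : MeasurableSpace Ω} {P : Measure Ω}
    [IsProbabilityMeasure P] {X Y : Ω → ℝ} (hX : MemLp X 2 P) (hY : MemLp Y 2 P) (u : ℝ) :
    ‖charFun (P.map X) u - charFun (P.map Y) u‖ ≤ |u| * lpNorm (X - Y) 2 P := by
  have hform : ∀ {Z : Ω → ℝ}, MemLp Z 2 P →
      charFun (P.map Z) u = ∫ ω, Complex.exp (u * Z ω * Complex.I) ∂P := fun {Z} hZ => by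
    rw [charFun_apply_real, integral_map hZ.aestronglyMeasurable.aemeasurable]
    exact (by fun_prop : Continuous fun x : ℝ => Complex.exp (u * x * Complex.I)).aestronglyMeasurable
  have hint : ∀ {Z : Ω → ℝ}, MemLp Z 2 P →
      Integrable (fun ω => Complex.exp (u * Z ω * Complex.I)) P := fun {Z} hZ => by
    refine Integrable.of_bound ((by fun_prop : Continuous fun x : ℝ =>
      Complex.exp (u * x * Complex.I)).comp_aestronglyMeasurable hZ.aestronglyMeasurable) 1
      (Eventually.of_forall fun ω => ?_)
    rw [← Complex.ofReal_mul, Complex.norm_exp_ofReal_mul_I]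
  have hsub : MemLp (X - Y) 2 P := hX.sub hY
  rw [hform hX, hform hY, ← integral_sub (hint hX) (hint hY)]
  calc _ ≤ ∫ ω, ‖Complex.exp (u * X ω * Complex.I) - Complex.exp (u * Y ω * Complex.I)‖ ∂P :=
        norm_integral_le_integral_norm _
    _ ≤ ∫ ω, |u| * |(X - Y) ω| ∂P := by
        refine integral_mono ((hint hX).sub (hint hY)).norm
          ((hsub.integrable one_le_two).abs.const_mul _) fun ω => ?_
        have : Complex.exp (u * X ω * Complex.I) - Complex.exp (u * Y ω * Complex.I) =
            Complex.exp ((u * Y ω : ℝ) * Complex.I) *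
              (Complex.exp (Complex.I * (u * (X ω - Y ω) : ℝ)) - 1) := by
          rw [mul_sub, ← Complex.exp_add, mul_one]
          push_cast
          ring_nf
        simp only [this, norm_mul, Complex.norm_exp_ofReal_mul_I, one_mul]
        refine (Real.norm_exp_I_mul_ofReal_sub_one_le).trans_eq ?_
        rw [Real.norm_eq_abs, abs_mul, Pi.sub_apply]
    _ ≤ _ := by
        rw [integral_const_mul]
        exact mul_le_mul_of_nonneg_left (integral_abs_le_lpNorm_two hsub) (abs_nonneg u)

section BlockApproximation

variable {Ω : Type*} {mΩ : MeasurableSpace Ω} {P : Measure Ω} [IsProbabilityMeasure P]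
  {S : ℕ → Ω → ℝ} {B : ℕ → Ω → ℝ}

lemma tendsto_floor_div_div {t : ℝ} (ht : 0 ≤ t) (p : ℕ) :
    Tendsto (fun N : ℕ => ((⌊(N : ℝ) * t⌋₊ / p : ℕ) : ℝ) / N) atTop (𝓝 (t / p)) := by
  have h := (tendsto_nat_floor_mul_div_atTop (R := ℝ) (a := t / p) (by positivity)).comp
    tendsto_natCast_atTop_atTop
  refine h.congr fun N => ?_
  simp only [Function.comp_apply]
  rw [← Nat.floor_div_natCast, mul_comm, mul_div_assoc]

omit [IsProbabilityMeasure P] in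
lemma IsBlockSequence.eventually_abs_lpNorm_sub_le (hB : IsBlockSequence B P)
    (hS : ∀ N, MemLp (S N) 2 P) {p : ℕ} {R η : ℝ} (hη : 0 < η)
    (h : ∀ N : ℕ, lpNorm (fun ω => S N ω - ∑ k ∈ Finset.range (N / p), B k ω) 2 P ≤ R + √N * η) :
    ∀ᶠ N : ℕ in atTop,
      |(√N)⁻¹ * lpNorm (S N) 2 P - √(∫ ω, B 0 ω ^ 2 ∂P) / √p| ≤ 3 * η := by
  set σ : ℝ := √(∫ ω, B 0 ω ^ 2 ∂P)
  have hx0 : Tendsto (fun N : ℕ => (√N)⁻¹) atTop (𝓝 0) :=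
    tendsto_inv_atTop_zero.comp (Real.tendsto_sqrt_atTop.comp tendsto_natCast_atTop_atTop)
  have h1 : Tendsto (fun N : ℕ => √(((N / p : ℕ) : ℝ) / N) * σ) atTop (𝓝 (√(1 / p) * σ)) := by
    refine Tendsto.mul_const σ (Tendsto.sqrt ?_)
    simpa using tendsto_floor_div_div zero_le_one p
  have h2 : Tendsto (fun N : ℕ => R * (√N)⁻¹) atTop (𝓝 0) := by simpa using hx0.const_mul R
  have h1' := (tendsto_iff_dist_tendsto_zero.1 h1).eventually_lt_const hη
  filter_upwards [h1', h2.eventually_lt_const hη, eventually_gt_atTop 0] with N h3 h4 hN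
  have hN' : 0 < √(N : ℝ) := Real.sqrt_pos.2 (by exact_mod_cast hN)
  rw [Real.dist_eq, Real.sqrt_div zero_le_one, Real.sqrt_one, one_div_mul_eq_div] at h3
  have hT := hB.memLp_sum (N / p)
  have h5 : |lpNorm (S N) 2 P - √((N / p : ℕ) : ℝ) * σ| ≤ R + √N * η := by
    rw [← hB.lpNorm_sum]
    refine le_trans ?_ (h N)
    rw [abs_le]
    have e1 := lpNorm_sub_le (f := S N) (g := fun ω => S N ω - ∑ k ∈ Finset.range (N / p), B k ω)
      (hS N) (μ := P) one_le_two
    have e2 := lpNorm_add_le (f := fun ω => S N ω - ∑ k ∈ Finset.range (N / p), B k ω)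
      (g := fun ω => ∑ k ∈ Finset.range (N / p), B k ω) ((hS N).sub hT) (μ := P) one_le_two
    have e1' : (S N - fun ω => S N ω - ∑ k ∈ Finset.range (N / p), B k ω) =
        fun ω => ∑ k ∈ Finset.range (N / p), B k ω := by
      ext ω
      simp
    have e2' : ((fun ω => S N ω - ∑ k ∈ Finset.range (N / p), B k ω) +
        fun ω => ∑ k ∈ Finset.range (N / p), B k ω) = S N := by
      ext ω
      simp
    rw [e1'] at e1
    rw [e2'] at e2
    constructor <;> linarith
  have h6 : |(√N)⁻¹ * lpNorm (S N) 2 P - √(((N / p : ℕ) : ℝ) / N) * σ| ≤ R * (√N)⁻¹ + η := by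
    have : (√N)⁻¹ * lpNorm (S N) 2 P - √(((N / p : ℕ) : ℝ) / N) * σ =
        (√N)⁻¹ * (lpNorm (S N) 2 P - √((N / p : ℕ) : ℝ) * σ) := by
      rw [Real.sqrt_div (Nat.cast_nonneg _)]
      ring
    rw [this, abs_mul, abs_of_pos (inv_pos.2 hN')]
    refine (mul_le_mul_of_nonneg_left h5 (inv_pos.2 hN').le).trans_eq ?_
    field_simp
  have h7 := abs_sub_le ((√N)⁻¹ * lpNorm (S N) 2 P) (√(((N / p : ℕ) : ℝ) / N) * σ) (σ / √p)
  linarith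

lemma IsBlockSequence.eventually_norm_charFun_sub_le (hB : IsBlockSequence B P)
    (hS : ∀ N, MemLp (S N) 2 P) {p : ℕ} {R η : ℝ} (hη : 0 < η)
    (h : ∀ N : ℕ, lpNorm (fun ω => S N ω - ∑ k ∈ Finset.range (N / p), B k ω) 2 P ≤ R + √N * η)
    {ι : Type*} [Fintype ι] (c : ι → ℝ) {τ : ι → ℝ} (hτ : ∀ i, 0 ≤ τ i) :
    ∀ᶠ N : ℕ in atTop, ‖charFun (P.map fun ω => ∑ i, c i * S ⌊(N : ℝ) * τ i⌋₊ ω) (√N)⁻¹ -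
      Complex.exp (-((∫ ω, B 0 ω ^ 2 ∂P) / p *
        (∑ i, ∑ j, c i * c j * min (τ i) (τ j)) / 2 : ℝ))‖ ≤ (∑ i, |c i| * √(τ i) + 2) * η := by
  set v : ℝ := ∫ ω, B 0 ω ^ 2 ∂P
  have hx0 : Tendsto (fun N : ℕ => (√N)⁻¹) atTop (𝓝 0) :=
    tendsto_inv_atTop_zero.comp (Real.tendsto_sqrt_atTop.comp tendsto_natCast_atTop_atTop)
  have h1 := hB.tendsto_charFun c fun i => tendsto_floor_div_div (hτ i) p
  have hQ : v * (∑ i, ∑ j, c i * c j * min (τ i / p) (τ j / p)) / 2 =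
      v / p * (∑ i, ∑ j, c i * c j * min (τ i) (τ j)) / 2 := by
    simp only [min_div_div_right (Nat.cast_nonneg p), ← mul_div_assoc, ← Finset.sum_div]
    ring
  rw [hQ] at h1
  have h2 : Tendsto (fun N : ℕ => (√N)⁻¹ * ∑ i, |c i| * R) atTop (𝓝 0) := by
    simpa using hx0.mul_const (∑ i, |c i| * R)
  have h1' := (tendsto_iff_dist_tendsto_zero.1 h1).eventually_lt_const hη
  filter_upwards [h1', h2.eventually_lt_const hη, eventually_gt_atTop 0] with N h3 h4 hN
  have hN' : 0 < √(N : ℝ) := Real.sqrt_pos.2 (by exact_mod_cast hN)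
  rw [dist_eq_norm] at h3
  have hX : MemLp (fun ω => ∑ i, c i * S ⌊(N : ℝ) * τ i⌋₊ ω) 2 P :=
    memLp_finsetSum _ fun i _ => (hS _).const_mul _
  have hY : MemLp (fun ω => ∑ i, c i * ∑ k ∈ Finset.range (⌊(N : ℝ) * τ i⌋₊ / p), B k ω) 2 P :=
    memLp_finsetSum _ fun i _ => (hB.memLp_sum _).const_mul _
  have h5 := norm_charFun_map_sub_le hX hY (√N)⁻¹
  rw [abs_of_pos (inv_pos.2 hN')] at h5
  have h6 : lpNorm ((fun ω => ∑ i, c i * S ⌊(N : ℝ) * τ i⌋₊ ω) -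
      fun ω => ∑ i, c i * ∑ k ∈ Finset.range (⌊(N : ℝ) * τ i⌋₊ / p), B k ω) 2 P ≤
      ∑ i, |c i| * (R + √N * √(τ i) * η) := by
    have heq : ((fun ω => ∑ i, c i * S ⌊(N : ℝ) * τ i⌋₊ ω) -
      fun ω => ∑ i, c i * ∑ k ∈ Finset.range (⌊(N : ℝ) * τ i⌋₊ / p), B k ω) =
      ∑ i, c i • fun ω => S ⌊(N : ℝ) * τ i⌋₊ ω -
        ∑ k ∈ Finset.range (⌊(N : ℝ) * τ i⌋₊ / p), B k ω := by
      ext ω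
      simp [Finset.sum_apply, mul_sub, Finset.sum_sub_distrib]
    rw [heq]
    refine (lpNorm_sum_le (fun i _ => ((hS _).sub (hB.memLp_sum _)).const_smul _)
      one_le_two).trans (Finset.sum_le_sum fun i _ => ?_)
    rw [lpNorm_const_smul, coe_nnnorm, Real.norm_eq_abs]
    refine mul_le_mul_of_nonneg_left ((h _).trans ?_) (abs_nonneg _)
    rw [← Real.sqrt_mul (Nat.cast_nonneg N)]
    gcongr
    exact Nat.floor_le (mul_nonneg (Nat.cast_nonneg N) (hτ i))
  have h7 : (√N)⁻¹ * ∑ i, |c i| * (R + √N * √(τ i) * η) =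
      (√N)⁻¹ * ∑ i, |c i| * R + (∑ i, |c i| * √(τ i)) * η := by
    simp only [mul_add, Finset.sum_add_distrib]
    congr 1
    rw [Finset.mul_sum, Finset.sum_mul]
    refine Finset.sum_congr rfl fun i _ => ?_
    field_simp
  have h8 := mul_le_mul_of_nonneg_left h6 (inv_pos.2 hN').le
  have h9 := norm_sub_le_norm_sub_add_norm_sub
    (charFun (P.map fun ω => ∑ i, c i * S ⌊(N : ℝ) * τ i⌋₊ ω) (√N)⁻¹)
    (charFun (P.map fun ω => ∑ i, c i *
      ∑ k ∈ Finset.range (⌊(N : ℝ) * τ i⌋₊ / p), B k ω) (√N)⁻¹)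
    (Complex.exp (-(v / p * (∑ i, ∑ j, c i * c j * min (τ i) (τ j)) / 2 : ℝ)))
  linarith

/-- If the sums `S N` are approximated by sums of blocks, then their normalized variances
converge, and the characteristic functions of their normalized finite dimensional distributions
converge to those of a Brownian motion. -/
theorem exists_tendsto_charFun_of_blocks (hS : ∀ N, MemLp (S N) 2 P)
    (happ : ∀ η : ℝ, 0 < η → ∃ (p : ℕ) (R : ℝ) (B : ℕ → Ω → ℝ), IsBlockSequence B P ∧
      ∀ N : ℕ, lpNorm (fun ω => S N ω - ∑ k ∈ Finset.range (N / p), B k ω) 2 P ≤ R + √N * η) :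
    ∃ θ : ℝ, Tendsto (fun N : ℕ => (N : ℝ)⁻¹ * ∫ ω, S N ω ^ 2 ∂P) atTop (𝓝 (θ ^ 2)) ∧
      ∀ (I : Finset ℝ≥0) (c : I → ℝ),
        Tendsto (fun N : ℕ => charFun (P.map fun ω =>
          ∑ i, c i * S ⌊(N : ℝ) * (i : ℝ≥0)⌋₊ ω) (√N)⁻¹) atTop
        (𝓝 (Complex.exp (-(θ ^ 2 * (∑ i, ∑ j, c i * c j *
          min ((i : ℝ≥0) : ℝ) ((j : ℝ≥0) : ℝ)) / 2 : ℝ)))) := by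
  have hη : ∀ m : ℕ, (0 : ℝ) < 1 / ((m : ℝ) + 1) := fun m => by positivity
  have hη0 : Tendsto (fun m : ℕ => 1 / ((m : ℝ) + 1)) atTop (𝓝 0) :=
    tendsto_one_div_add_atTop_nhds_zero_nat
  choose p R B hB h using fun m : ℕ => happ _ (hη m)
  obtain ⟨θ, hθ, hθ'⟩ := exists_tendsto_of_approx (by simpa using hη0.const_mul 3)
    fun m => (hB m).eventually_abs_lpNorm_sub_le hS (hη m) (h m)
  refine ⟨θ, ?_, fun I c => ?_⟩
  · refine (hθ.pow 2).congr fun N => ?_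
    rw [mul_pow, inv_pow, Real.sq_sqrt (Nat.cast_nonneg N), lpNorm_two_sq (hS N).aestronglyMeasurable]
  · refine tendsto_of_approx (by simpa using hη0.const_mul (∑ i : I, |c i| * √((i : ℝ≥0) : ℝ) + 2))
      ?_ fun m => (hB m).eventually_norm_charFun_sub_le hS (hη m) (h m) c (fun i => i.1.2)
    refine (Complex.continuous_exp.tendsto _).comp ?_
    simp only [← Complex.ofReal_neg]
    refine (Complex.continuous_ofReal.tendsto _).comp (Tendsto.neg ((Tendsto.mul_const _ ?_).div_const 2))
    refine (hθ'.pow 2).congr fun m => ?_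
    rw [div_pow, Real.sq_sqrt (integral_nonneg fun _ => sq_nonneg _), Real.sq_sqrt (Nat.cast_nonneg _)]

end BlockApproximation

section FiniteDimensionalDistributions

lemma charFun_map_mul_isPreBrownianReal {Ω' : Type*} {mΩ' : MeasurableSpace Ω'}
    {P' : Measure Ω'} {W : ℝ≥0 → Ω' → ℝ} (hW : IsPreBrownianReal W P') (r : ℝ)
    (I : Finset ℝ≥0) (c : EuclideanSpace ℝ I) :
    charFun (P'.map fun ω => WithLp.toLp 2 fun t : I => r * W t ω) c =
      Complex.exp (-(r ^ 2 * (∑ i, ∑ j, c i * c j *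
          min ((i : ℝ≥0) : ℝ) ((j : ℝ≥0) : ℝ)) / 2 : ℝ)) := by
  have h1 : HasLaw (fun ω => WithLp.toLp 2 (I.restrict (W · ω)))
      (multivariateGaussian 0 (BrownianReal.covMatrix I)) P' :=
    (BrownianReal.measurePreserving_toLp_projectiveFamily I).hasLaw.comp (hW.hasLaw I)
  have h2 : (fun ω => WithLp.toLp 2 fun t : I => r * W t ω) =
      fun ω => r • WithLp.toLp 2 (I.restrict (W · ω)) := by
    ext ω t
    simp
  rw [h2, charFun_map_smul_comp h1.aemeasurable, h1.map_eq,
    charFun_multivariateGaussian (BrownianReal.posSemidef_covMatrix I)]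
  congr 1
  simp only [inner_zero_right, Complex.ofReal_zero, zero_mul, zero_sub]
  rw [← Complex.ofReal_ofNat, ← Complex.ofReal_div]
  congr 3
  simp only [dotProduct, Matrix.mulVec, BrownianReal.covMatrix_apply, Finset.mul_sum]
  refine Finset.sum_congr rfl fun i _ => Finset.sum_congr rfl fun j _ => ?_
  simp
  ring

/-- Convergence of the finite dimensional distributions of normalized sums to those of a Brownian
motion, from the convergence of characteristic functions. -/
theorem tendstoFDD_of_tendsto_charFun {Ω Ω' : Type*} [MeasurableSpace Ω] [MeasurableSpace Ω']
    {P : Measure Ω} [IsProbabilityMeasure P] {P' : Measure Ω'} [IsProbabilityMeasure P']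
    {S : ℕ → Ω → ℝ} (hS : ∀ N, AEMeasurable (S N) P) {θ : ℝ}
    (h : ∀ (I : Finset ℝ≥0) (c : I → ℝ),
        Tendsto (fun N : ℕ => charFun (P.map fun ω =>
          ∑ i, c i * S ⌊(N : ℝ) * (i : ℝ≥0)⌋₊ ω) (√N)⁻¹) atTop
        (𝓝 (Complex.exp (-(θ ^ 2 * (∑ i, ∑ j, c i * c j *
          min ((i : ℝ≥0) : ℝ) ((j : ℝ≥0) : ℝ)) / 2 : ℝ)))))
    {W : ℝ≥0 → Ω' → ℝ} (hW : IsPreBrownianReal W P') :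
    TendstoFDD (fun N t ω => (N : ℝ) ^ (-(1 / 2) : ℝ) * S ⌊(N : ℝ) * (t : ℝ)⌋₊ ω)
      (fun t ω => |θ| * W t ω) P P' := by
  intro I
  have hX : ∀ N : ℕ, AEMeasurable (fun ω => WithLp.toLp 2 fun t : I =>
      (N : ℝ) ^ (-(1 / 2) : ℝ) * S ⌊(N : ℝ) * ((t : ℝ≥0) : ℝ)⌋₊ ω) P := fun N =>
    (WithLp.measurable_toLp 2 _).comp_aemeasurable
      (aemeasurable_pi_lambda _ fun t => (hS _).const_mul _)
  have hZ : AEMeasurable (fun ω => WithLp.toLp 2 fun t : I => |θ| * W t ω) P' :=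
    (WithLp.measurable_toLp 2 _).comp_aemeasurable
      (aemeasurable_pi_lambda _ fun t => (hW.aemeasurable _).const_mul _)
  have key : TendstoInDistribution (fun (N : ℕ) ω => WithLp.toLp 2 fun t : I =>
      (N : ℝ) ^ (-(1 / 2) : ℝ) * S ⌊(N : ℝ) * ((t : ℝ≥0) : ℝ)⌋₊ ω) atTop
      (fun ω => WithLp.toLp 2 fun t : I => |θ| * W t ω) (fun _ => P) P' := by
    refine ⟨hX, hZ, ProbabilityMeasure.tendsto_iff_tendsto_charFun.2 fun c => ?_⟩
    simp only [ProbabilityMeasure.coe_mk]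
    rw [charFun_map_mul_isPreBrownianReal hW, sq_abs]
    refine (h I c).congr fun N => ?_
    rw [charFun_apply, charFun_apply, integral_map (hX N) (by fun_prop),
      integral_map (Finset.aemeasurable_fun_sum _ fun i _ => (hS _).const_mul _) (by fun_prop)]
    refine integral_congr_ae (Eventually.of_forall fun ω => ?_)
    simp only
    congr 3
    simp only [PiLp.inner_apply, RCLike.inner_apply, conj_trivial]
    rw [Finset.mul_sum, Real.rpow_neg (Nat.cast_nonneg N), ← Real.sqrt_eq_rpow]
    refine Finset.sum_congr rfl fun i _ => ?_
    ring
  exact key.continuous_comp (g := WithLp.ofLp) (PiLp.continuous_ofLp 2 _)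

end FiniteDimensionalDistributions

section SlowVariation

/-- The additive form of the uniform convergence theorem for slowly varying functions. -/
lemma eventually_forall_abs_add_sub_lt {g : ℝ → ℝ} (hg : Measurable g)
    (h : ∀ u, Tendsto (fun x => g (x + u) - g x) atTop (𝓝 0)) {L δ : ℝ} (hL : 0 < L)
    (hδ : 0 < δ) : ∀ᶠ x in atTop, ∀ u ∈ Set.Icc 0 L, |g (x + u) - g x| < 2 * δ := by
  by_contra hcon
  rw [Filter.not_eventually] at hcon
  have hseq : ∀ n : ℕ, ∃ x : ℝ, (n : ℝ) ≤ x ∧ ∃ u ∈ Set.Icc 0 L, 2 * δ ≤ |g (x + u) - g x| := by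
    intro n
    obtain ⟨x, hx, hnx⟩ := (hcon.and_eventually (eventually_ge_atTop (n : ℝ))).exists
    push Not at hx
    exact ⟨x, hnx, hx⟩
  choose x hx u hu hxu using hseq
  have hx' : Tendsto x atTop atTop := tendsto_atTop_mono hx tendsto_natCast_atTop_atTop
  have hxu' : Tendsto (fun n => x n + u n) atTop atTop :=
    tendsto_atTop_mono (fun n => (le_add_of_nonneg_right (hu n).1)) hx'
  set μ : Measure ℝ := volume.restrict (Set.Icc 0 (2 * L)) with hμ
  have hmeas : ∀ {z : ℕ → ℝ}, Tendsto z atTop atTop →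
      Tendsto (fun n => μ {v | δ ≤ |g (z n + v) - g (z n)|}) atTop (𝓝 0) := by
    intro z hz
    have h1 : TendstoInMeasure μ (fun n v => g (z n + v) - g (z n)) atTop 0 :=
      tendstoInMeasure_of_tendsto_ae (fun n => ((hg.comp (measurable_const_add _)).sub_const
        _).aestronglyMeasurable) (Eventually.of_forall fun v => (h v).comp hz)
    have h2 := tendstoInMeasure_iff_norm.1 h1 δ hδ
    simpa using h2
  have hlt : (0 : ENNReal) < ENNReal.ofReal (L / 2) := by simpa using hL
  obtain ⟨n, h1, h2⟩ := (((hmeas hx').eventually_lt_const hlt).and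
    ((hmeas hxu').eventually_lt_const hlt)).exists
  set E₁ : Set ℝ := {v | δ ≤ |g (x n + v) - g (x n)|}
  set E₂ : Set ℝ := {v | δ ≤ |g (x n + u n + v) - g (x n + u n)|}
  have hE₁ : MeasurableSet E₁ := measurableSet_le measurable_const
    (((hg.comp (measurable_const_add _)).sub_const _).abs)
  have hE₂ : MeasurableSet E₂ := measurableSet_le measurable_const
    (((hg.comp (measurable_const_add _)).sub_const _).abs)
  rw [hμ, Measure.restrict_apply hE₁] at h1
  rw [hμ, Measure.restrict_apply hE₂] at h2
  have hex : ∃ v ∈ Set.Icc 0 L, v ∉ E₂ ∧ u n + v ∉ E₁ := by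
    by_contra hno
    push Not at hno
    have hsub : Set.Icc 0 L ⊆ (E₂ ∩ Set.Icc 0 (2 * L)) ∪
        (fun v => u n + v) ⁻¹' (E₁ ∩ Set.Icc 0 (2 * L)) := by
      intro v hv
      by_cases hv2 : v ∈ E₂
      · exact Or.inl ⟨hv2, hv.1, by linarith [hv.2]⟩
      · refine Or.inr ⟨hno v hv hv2, ?_, ?_⟩
        · linarith [hv.1, (hu n).1]
        · linarith [hv.2, (hu n).2]
    have hle := (measure_mono hsub).trans (measure_union_le (μ := volume) _ _)
    rw [measure_preimage_add, Real.volume_Icc, sub_zero] at hle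
    have := hle.trans_lt (ENNReal.add_lt_add h2 h1)
    rw [← ENNReal.ofReal_add (by positivity) (by positivity), add_halves] at this
    exact lt_irrefl _ this
  obtain ⟨v, -, hv2, hv1⟩ := hex
  simp only [E₁, E₂, Set.mem_ofPred_eq, not_le, ← add_assoc] at hv1 hv2
  have := abs_sub_le (g (x n + u n)) (g (x n + u n + v)) (g (x n))
  rw [abs_sub_comm (g (x n + u n)) (g (x n + u n + v))] at this
  linarith [hxu n]

/-- The uniform convergence theorem for slowly varying functions. -/
lemma IsSlowlyVarying.eventually_forall_le {f : ℝ → ℝ} (hf : IsSlowlyVarying f) {A r : ℝ}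
    (hA : 1 < A) (hr : 1 < r) :
    ∀ᶠ t in atTop, ∀ c ∈ Set.Icc 1 A, f (c * t) ≤ r * f t ∧ f t ≤ r * f (c * t) := by
  set g : ℝ → ℝ := fun x => Real.log (f (Real.exp x)) with hgdef
  have hg : Measurable g := Real.measurable_log.comp
    (hf.measurable.comp (Real.measurable_exp.subtype_mk (h := fun x => Real.exp_pos x)))
  have hlim : ∀ u, Tendsto (fun x => g (x + u) - g x) atTop (𝓝 0) := by
    intro u
    have h1 := (hf.tendsto (Real.exp u) (Real.exp_pos u)).comp Real.tendsto_exp_atTop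
    have h2 := h1.log one_ne_zero
    rw [Real.log_one] at h2
    refine h2.congr fun x => ?_
    simp only [Function.comp_apply, hgdef]
    rw [Real.log_div (hf.pos _ (by positivity)).ne' (hf.pos _ (by positivity)).ne', Real.exp_add,
      mul_comm (Real.exp u)]
  have hU := eventually_forall_abs_add_sub_lt hg hlim (Real.log_pos hA)
    (half_pos (Real.log_pos hr))
  filter_upwards [Real.tendsto_log_atTop.eventually hU, eventually_gt_atTop 0] with t ht ht0 c hc
  have hc0 : 0 < c := one_pos.trans_le hc.1
  have h1 := ht (Real.log c) ⟨Real.log_nonneg hc.1, Real.log_le_log hc0 hc.2⟩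
  have hft := hf.pos t ht0
  have hfct := hf.pos (c * t) (mul_pos hc0 ht0)
  simp only [hgdef] at h1
  rw [Real.exp_add, Real.exp_log ht0, Real.exp_log hc0, mul_comm t c, mul_div_cancel₀ _ two_ne_zero,
    abs_lt] at h1
  have hr0 : 0 < r := one_pos.trans hr
  constructor
  · rw [← Real.log_le_log_iff hfct (by positivity), Real.log_mul hr0.ne' hft.ne']
    linarith [h1.2]
  · rw [← Real.log_le_log_iff hft (by positivity), Real.log_mul hr0.ne' hfct.ne']
    linarith [h1.1]

lemma IsSlowlyVarying.coeff_pos {ℓ : ℝ → ℝ} (hℓ : IsSlowlyVarying ℓ) (β : ℝ) {j : ℕ}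
    (hj : 0 < j) : 0 < coeff β ℓ j :=
  mul_pos (Real.rpow_pos_of_pos (by exact_mod_cast hj) _) (hℓ.pos _ (by exact_mod_cast hj))

/-- The inverse coefficients at least double from `j` to `[3 j, 6 j]`, for `j` large. -/
lemma IsSlowlyVarying.eventually_inv_coeff {ℓ : ℝ → ℝ} (hℓ : IsSlowlyVarying ℓ) {β : ℝ}
    (hβ : 1 ≤ β) : ∀ᶠ j : ℕ in atTop, ∀ i : ℕ, 3 * j ≤ i → i ≤ 6 * j →
      2 * (coeff β ℓ j)⁻¹ ≤ (coeff β ℓ i)⁻¹ ∧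
        (coeff β ℓ i)⁻¹ ≤ ((i : ℝ) / j) ^ β * (4 / 3) * (coeff β ℓ j)⁻¹ := by
  have h := tendsto_natCast_atTop_atTop.eventually
    (hℓ.eventually_forall_le (A := 6) (r := 4 / 3) (by norm_num) (by norm_num))
  filter_upwards [h, eventually_gt_atTop 0] with j hj hj0 i h3 h6
  have hj0' : (0 : ℝ) < j := by exact_mod_cast hj0
  have h3' : 3 ≤ (i : ℝ) / j := by
    rw [le_div_iff₀ hj0']
    exact_mod_cast h3
  have h6' : (i : ℝ) / j ≤ 6 := by
    rw [div_le_iff₀ hj0']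
    exact_mod_cast h6
  have hc := hj (i / j) ⟨by linarith, h6'⟩
  rw [div_mul_cancel₀ _ hj0'.ne'] at hc
  have hi0 : 0 < i := by omega
  have hℓi := hℓ.pos i (by exact_mod_cast hi0)
  have hℓj := hℓ.pos j hj0'
  have hq : 3 ≤ ((i : ℝ) / j) ^ β := h3'.trans (Real.self_le_rpow_of_one_le (by linarith) hβ)
  have hform : (coeff β ℓ i)⁻¹ = ((i : ℝ) / j) ^ β * (ℓ j / ℓ i) * (coeff β ℓ j)⁻¹ := by
    unfold coeff
    rw [Real.div_rpow (Nat.cast_nonneg i) hj0'.le, Real.rpow_neg (Nat.cast_nonneg i),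
      Real.rpow_neg hj0'.le]
    have := (Real.rpow_pos_of_pos hj0' β).ne'
    field_simp
  have hpos := inv_pos.2 (hℓ.coeff_pos β hj0)
  have hr1 : 3 / 4 ≤ ℓ j / ℓ i := by
    rw [le_div_iff₀ hℓi]
    linarith [hc.1]
  have hr2 : ℓ j / ℓ i ≤ 4 / 3 := by
    rw [div_le_iff₀ hℓi]
    linarith [hc.2]
  rw [hform]
  constructor
  · gcongr
    nlinarith
  · gcongr

/-- A positive sequence that at least doubles from `j` to `[3 j, 6 j]` tends to infinity. -/
lemma tendsto_atTop_of_two_mul_le {b : ℕ → ℝ} (hb : ∀ j, 0 < j → 0 < b j)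
    (h : ∀ᶠ j : ℕ in atTop, ∀ i : ℕ, 3 * j ≤ i → i ≤ 6 * j → 2 * b j ≤ b i) :
    Tendsto b atTop atTop := by
  obtain ⟨j₀, hj₀⟩ := eventually_atTop.1 (h.and (eventually_ge_atTop 2))
  have hj2 : 2 ≤ j₀ := (hj₀ j₀ le_rfl).2
  obtain ⟨i₀, hi₀, hmin⟩ := Finset.exists_min_image (Finset.Icc j₀ (3 * j₀))
    (fun i => b i / √i) ⟨j₀, Finset.mem_Icc.2 ⟨le_rfl, by omega⟩⟩
  have hi₀' : 0 < i₀ := by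
    have := (Finset.mem_Icc.1 hi₀).1
    omega
  set κ : ℝ := b i₀ / √i₀
  have hκ : 0 < κ := div_pos (hb _ hi₀') (Real.sqrt_pos.2 (by exact_mod_cast hi₀'))
  have hlow : ∀ i : ℕ, j₀ ≤ i → κ * √i ≤ b i := by
    intro i
    induction i using Nat.strong_induction_on with
    | _ i ih =>
      intro hi
      rcases le_or_gt i (3 * j₀) with hi3 | hi3
      · have := hmin i (Finset.mem_Icc.2 ⟨hi, hi3⟩)
        rwa [le_div_iff₀ (Real.sqrt_pos.2 (by exact_mod_cast (by omega : 0 < i)))] at this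
      · have h1 := ih (i / 3) (by omega) (by omega)
        have h2 := (hj₀ (i / 3) (by omega)).1 i (by omega) (by omega)
        have h3 : √(i : ℝ) ≤ 2 * √((i / 3 : ℕ) : ℝ) := by
          rw [Real.sqrt_le_left (by positivity), mul_pow, Real.sq_sqrt (Nat.cast_nonneg _)]
          have : i ≤ 4 * (i / 3) := by omega
          norm_num
          exact_mod_cast this
        nlinarith
  refine tendsto_atTop_mono' atTop (f₁ := fun i : ℕ => κ * √i) ?_
    (Tendsto.const_mul_atTop hκ (Real.tendsto_sqrt_atTop.comp tendsto_natCast_atTop_atTop))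
  filter_upwards [eventually_ge_atTop j₀] with i hi using hlow i hi

end SlowVariation

section StableTails

variable {ν : Measure ℝ} [IsProbabilityMeasure ν]

lemma integrable_min_one_sq (a : ℝ) : Integrable (fun y : ℝ => min 1 ((a * y) ^ 2)) ν := by
  refine Integrable.of_bound (by fun_prop) 1 (Eventually.of_forall fun y => ?_)
  rw [Real.norm_of_nonneg (le_min zero_le_one (sq_nonneg _))]
  exact min_le_left _ _

lemma integral_min_one_sq_le_one (a : ℝ) : ∫ y, min 1 ((a * y) ^ 2) ∂ν ≤ 1 := by
  refine (integral_mono (integrable_min_one_sq a) (integrable_const 1)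
    fun y => min_le_left _ _).trans_eq (by simp)

/-- The mass of the tails of `ν`. -/
noncomputable def tailMass (ν : Measure ℝ) (x : ℝ) : ℝ := ν.real (Set.Iic (-x)) + ν.real (Set.Ioi x)

lemma tailMass_antitone : Antitone (tailMass ν) := fun x y hxy =>
  add_le_add (measureReal_mono (Set.Iic_subset_Iic.2 (neg_le_neg hxy)))
    (measureReal_mono (Set.Ioi_subset_Ioi hxy))

omit [IsProbabilityMeasure ν] in
lemma tailMass_nonneg (x : ℝ) : 0 ≤ tailMass ν x := by
  unfold tailMass
  positivity

lemma integral_min_one_sq_double {b : ℝ} (hb : 0 < b) :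
    ∫ y, min 1 (((2 * b)⁻¹ * y) ^ 2) ∂ν ≤
      (∫ y, min 1 ((b⁻¹ * y) ^ 2) ∂ν) / 4 + 3 / 4 * tailMass ν b := by
  have hi1 : Integrable ((Set.Iic (-b)).indicator fun _ : ℝ => (1 : ℝ)) ν :=
    (integrable_const 1).indicator measurableSet_Iic
  have hi2 : Integrable ((Set.Ioi b).indicator fun _ : ℝ => (1 : ℝ)) ν :=
    (integrable_const 1).indicator measurableSet_Ioi
  have hT : tailMass ν b = ∫ y, ((Set.Iic (-b)).indicator (fun _ => (1 : ℝ)) y +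
      (Set.Ioi b).indicator (fun _ => (1 : ℝ)) y) ∂ν := by
    rw [integral_add hi1 hi2, integral_indicator_const _ measurableSet_Iic,
      integral_indicator_const _ measurableSet_Ioi]
    simp [tailMass]
  have hi3 : Integrable (fun y : ℝ => 3 / 4 * ((Set.Iic (-b)).indicator (fun _ => (1 : ℝ)) y +
      (Set.Ioi b).indicator (fun _ => (1 : ℝ)) y)) ν := (hi1.add hi2).const_mul _
  rw [hT, ← integral_div, ← integral_const_mul, ← integral_add
    ((integrable_min_one_sq b⁻¹).div_const 4) hi3]
  refine integral_mono (integrable_min_one_sq _)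
    (((integrable_min_one_sq b⁻¹).div_const 4).add hi3) fun y => ?_
  beta_reduce
  have hn1 : 0 ≤ (Set.Iic (-b)).indicator (fun _ => (1 : ℝ)) y :=
    Set.indicator_nonneg (fun _ _ => zero_le_one) _
  have hn2 : 0 ≤ (Set.Ioi b).indicator (fun _ => (1 : ℝ)) y :=
    Set.indicator_nonneg (fun _ _ => zero_le_one) _
  rcases le_or_gt |y| b with hy | hy
  · have h1 : (b⁻¹ * y) ^ 2 ≤ 1 := by
      rw [sq_le_one_iff_abs_le_one, abs_mul, abs_of_pos (inv_pos.2 hb), inv_mul_le_one₀ hb]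
      exact hy
    rw [min_eq_right h1]
    refine (min_le_right _ _).trans ?_
    have : ((2 * b)⁻¹ * y) ^ 2 = (b⁻¹ * y) ^ 2 / 4 := by
      rw [mul_inv]
      ring
    rw [this]
    nlinarith
  · have h1 : 1 ≤ (b⁻¹ * y) ^ 2 := by
      rw [one_le_sq_iff_one_le_abs, abs_mul, abs_of_pos (inv_pos.2 hb), ← div_eq_inv_mul,
        one_le_div hb]
      exact hy.le
    rw [min_eq_left h1]
    refine (min_le_left _ _).trans ?_
    rcases lt_abs.1 hy with hy | hy
    · rw [Set.indicator_of_mem (s := Set.Ioi b) hy]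
      linarith
    · rw [Set.indicator_of_mem (s := Set.Iic (-b)) (by simp only [Set.mem_Iic]; linarith)]
      linarith

/-- If the tails decrease by a factor at most `q < 4` when the argument doubles, they control the
truncated second moment. -/
lemma exists_integral_min_one_sq_le_tailMass {q x₀ : ℝ} (hq : q < 4) (hx₀ : 0 < x₀)
    (hpos : 0 < tailMass ν (2 * x₀))
    (hT : ∀ b, x₀ ≤ b → tailMass ν b ≤ q * tailMass ν (2 * b)) :
    ∃ C, 0 ≤ C ∧ ∀ b, x₀ ≤ b → ∫ y, min 1 ((b⁻¹ * y) ^ 2) ∂ν ≤ C * tailMass ν b := by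
  set C : ℝ := max (tailMass ν (2 * x₀))⁻¹ (3 * q / (4 - q)) with hC
  have hC0 : 0 < C := (inv_pos.2 hpos).trans_le (le_max_left _ _)
  have hCq : (C + 3) * q ≤ 4 * C := by
    have := le_max_right (tailMass ν (2 * x₀))⁻¹ (3 * q / (4 - q))
    rw [← hC, div_le_iff₀ (by linarith)] at this
    linarith
  have key : ∀ n : ℕ, ∀ b, x₀ ≤ b → b ≤ 2 ^ n * (2 * x₀) →
      ∫ y, min 1 ((b⁻¹ * y) ^ 2) ∂ν ≤ C * tailMass ν b := by
    intro n
    induction n with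
    | zero =>
      intro b hb hb2
      rw [pow_zero, one_mul] at hb2
      refine (integral_min_one_sq_le_one _).trans ?_
      calc (1 : ℝ) = (tailMass ν (2 * x₀))⁻¹ * tailMass ν (2 * x₀) := (inv_mul_cancel₀ hpos.ne').symm
        _ ≤ C * tailMass ν b := mul_le_mul (le_max_left _ _) (tailMass_antitone hb2) hpos.le hC0.le
    | succ n ih =>
      intro b hb hb2
      rcases le_or_gt b (2 * x₀) with h | h
      · exact ih b hb (h.trans (le_mul_of_one_le_left (by positivity) (one_le_pow₀ one_le_two)))
      · have hb' : x₀ ≤ b / 2 := by linarith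
        have h1 := ih (b / 2) hb' (by rw [pow_succ] at hb2; linarith)
        have h2 := integral_min_one_sq_double (ν := ν) (b := b / 2) (by linarith)
        have h3 := hT (b / 2) hb'
        rw [mul_div_cancel₀ _ two_ne_zero] at h2 h3
        have h4 : (C + 3) * tailMass ν (b / 2) ≤ 4 * C * tailMass ν b :=
          calc _ ≤ (C + 3) * (q * tailMass ν b) := by gcongr
            _ = (C + 3) * q * tailMass ν b := by ring
            _ ≤ _ := mul_le_mul_of_nonneg_right hCq (tailMass_nonneg b)
        linarith
  refine ⟨C, hC0.le, fun b hb => ?_⟩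
  obtain ⟨n, hn⟩ := pow_unbounded_of_one_lt (b / (2 * x₀)) one_lt_two
  exact key n b hb (by rw [div_lt_iff₀ (by positivity)] at hn; exact hn.le)

/-- The truncated second moment of a law with stable tails is dominated by the tail function. -/
lemma HasStableTails.exists_integral_min_one_sq_le {α σ₁ σ₂ : ℝ} {h : ℝ → ℝ}
    (hν : HasStableTails α ν σ₁ σ₂ h) (hα : α < 2) :
    ∃ C, 0 ≤ C ∧ ∀ᶠ b in atTop,
      ∫ y, min 1 ((b⁻¹ * y) ^ 2) ∂ν ≤ C * (b ^ (-α) * h b) := by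
  set σ := σ₁ + σ₂
  have hσ : 0 < σ := hν.pos
  set R : ℝ → ℝ := fun x => x ^ (-α) * h x with hR
  have hRpos : ∀ x, 0 < x → 0 < R x := fun x hx =>
    mul_pos (Real.rpow_pos_of_pos hx _) (hν.slowlyVarying.pos x hx)
  have hTR : Tendsto (fun x => tailMass ν x / R x) atTop (𝓝 σ) :=
    (hν.left.add hν.right).congr fun x => by rw [tailMass, add_div]
  have hTpos : ∀ x, 0 < tailMass ν x := by
    intro x
    obtain ⟨z, ⟨hz, hz0⟩, hxz⟩ := (((hTR.eventually_const_lt hσ).and (eventually_gt_atTop 0)).and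
      (eventually_ge_atTop x)).exists
    have := (div_pos_iff_of_pos_right (hRpos z hz0)).1 hz
    exact this.trans_le (tailMass_antitone hxz)
  have h2 : Tendsto (fun x : ℝ => 2 * x) atTop atTop := tendsto_id.const_mul_atTop two_pos
  have hRR : Tendsto (fun x => R x / R (2 * x)) atTop (𝓝 (2 ^ α)) := by
    have h3 := ((hν.slowlyVarying.tendsto 2 two_pos).inv₀ one_ne_zero).const_mul ((2 : ℝ) ^ α)
    rw [inv_one, mul_one] at h3
    refine h3.congr' ?_
    filter_upwards [eventually_gt_atTop 0] with x hx
    have hx2 := (hν.slowlyVarying.pos (2 * x) (by positivity)).ne'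
    have hx1 := (Real.rpow_pos_of_pos hx α).ne'
    have hx3 := (Real.rpow_pos_of_pos two_pos α).ne'
    simp only [hR]
    rw [Real.mul_rpow two_pos.le hx.le, Real.rpow_neg hx.le, Real.rpow_neg two_pos.le]
    field_simp
  have hTT : Tendsto (fun x => tailMass ν x / tailMass ν (2 * x)) atTop (𝓝 (2 ^ α)) := by
    have h3 := (hTR.div (hTR.comp h2) hσ.ne').mul hRR
    rw [div_self hσ.ne', one_mul] at h3
    refine h3.congr' ?_
    filter_upwards [eventually_gt_atTop 0] with x hx
    have e1 := (hRpos x hx).ne'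
    have e2 := (hRpos (2 * x) (by positivity)).ne'
    have e3 := (hTpos (2 * x)).ne'
    simp only [Pi.div_apply, Function.comp_apply]
    field_simp
  have h4 : (2 : ℝ) ^ α < 4 := by
    have := Real.rpow_lt_rpow_of_exponent_lt one_lt_two hα
    norm_num at this
    exact this
  obtain ⟨q, hq1, hq2⟩ := exists_between h4
  obtain ⟨x₀, hx₀⟩ := eventually_atTop.1 ((hTT.eventually_lt_const hq1).and (eventually_gt_atTop 0))
  have hx₀' : 0 < x₀ := (hx₀ x₀ le_rfl).2
  obtain ⟨C, hC, hle⟩ := exists_integral_min_one_sq_le_tailMass (ν := ν) hq2 hx₀' (hTpos _) fun b hb => by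
      have := (hx₀ b hb).1
      rw [div_lt_iff₀ (hTpos _)] at this
      exact this.le
  refine ⟨C * (σ + 1), by positivity, ?_⟩
  filter_upwards [hTR.eventually_lt_const (lt_add_one σ), eventually_ge_atTop x₀] with b hb hbx
  rw [div_lt_iff₀ (hRpos b (hx₀'.trans_le hbx))] at hb
  refine (hle b hbx).trans ?_
  rw [mul_assoc]
  exact mul_le_mul_of_nonneg_left hb.le hC

end StableTails

section TruncatedMoment

variable {ν : Measure ℝ} [IsProbabilityMeasure ν]

lemma integrable_indicator_abs_sq (t : ℝ) :
    Integrable (((fun y : ℝ => |y|) ⁻¹' Set.Ioc 0 t).indicator fun y => y ^ 2) ν := by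
  have hm : MeasurableSet ((fun y : ℝ => |y|) ⁻¹' Set.Ioc 0 t) := by measurability
  refine Integrable.of_bound ((by fun_prop : Measurable fun y : ℝ => y ^ 2).indicator
    hm).aestronglyMeasurable (t ^ 2) (Eventually.of_forall fun y => ?_)
  by_cases hy : y ∈ (fun y : ℝ => |y|) ⁻¹' Set.Ioc 0 t
  · rw [Set.indicator_of_mem hy, Real.norm_of_nonneg (sq_nonneg y), ← sq_abs y]
    exact pow_le_pow_left₀ (abs_nonneg y) hy.2 2
  · simpa [Set.indicator_of_notMem hy] using sq_nonneg t

omit [IsProbabilityMeasure ν] in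
lemma innovH_two (h : ℝ → ℝ) (t : ℝ) :
    innovH 2 ν h t = ∫ y, ((fun y : ℝ => |y|) ⁻¹' Set.Ioc 0 t).indicator (fun y => y ^ 2) y ∂ν := by
  have hm : MeasurableSet ((fun y : ℝ => |y|) ⁻¹' Set.Ioc 0 t) := by measurability
  rw [innovH, if_neg (lt_irrefl _), setIntegral_map measurableSet_Ioc (by fun_prop) (by fun_prop),
    integral_indicator hm]
  simp only [sq_abs]

lemma innovH_two_mono (h : ℝ → ℝ) : Monotone (innovH 2 ν h) := by
  intro s t hst
  rw [innovH_two, innovH_two]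
  exact integral_mono (integrable_indicator_abs_sq s) (integrable_indicator_abs_sq t) fun y =>
    Set.indicator_le_indicator_of_subset (fun z (hz : |z| ∈ Set.Ioc 0 s) => (⟨hz.1, hz.2.trans hst⟩ : |z| ∈ Set.Ioc 0 t))
      (fun y => sq_nonneg y) y

omit [IsProbabilityMeasure ν] in
lemma innovH_two_nonneg (h : ℝ → ℝ) (t : ℝ) : 0 ≤ innovH 2 ν h t := by
  rw [innovH_two]
  exact integral_nonneg fun y => Set.indicator_nonneg (fun _ _ => sq_nonneg _) y

lemma tsum_sq_le_sq_tsum {g : ℕ → ℝ} (hg : ∀ k, 0 ≤ g k) (hs : Summable g) :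
    Summable (fun k => g k ^ 2) ∧ ∑' k, g k ^ 2 ≤ (∑' k, g k) ^ 2 := by
  have hle : ∀ k, g k ^ 2 ≤ g k * ∑' k, g k := fun k => by
    rw [sq]
    exact mul_le_mul_of_nonneg_left (hs.le_tsum k fun j _ => hg j) (hg k)
  have hs2 : Summable fun k => g k ^ 2 :=
    (hs.mul_right _).of_nonneg_of_le (fun k => sq_nonneg _) hle
  refine ⟨hs2, (hs2.tsum_le_tsum hle (hs.mul_right _)).trans_eq ?_⟩
  rw [tsum_mul_right, sq]

/-- A dyadic bound of the truncated second moment by the function `innovH 2`. -/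
lemma sqrt_integral_min_one_sq_le_tsum (h : ℝ → ℝ) {b : ℝ} (hb : 0 < b)
    (hs : Summable fun k : ℕ => 2 * 2⁻¹ ^ k * b⁻¹ * √(innovH 2 ν h (2 ^ k * b))) :
    √(∫ y, min 1 ((b⁻¹ * y) ^ 2) ∂ν) ≤
      ∑' k : ℕ, 2 * 2⁻¹ ^ k * b⁻¹ * √(innovH 2 ν h (2 ^ k * b)) := by
  have hg : ∀ k : ℕ, 0 ≤ 2 * 2⁻¹ ^ k * b⁻¹ * √(innovH 2 ν h (2 ^ k * b)) := fun k => by positivity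
  obtain ⟨hs2, hle⟩ := tsum_sq_le_sq_tsum hg hs
  refine Real.sqrt_le_iff.2 ⟨tsum_nonneg hg, le_trans ?_ hle⟩
  set F : ℕ → ℝ → ℝ := fun k y => (2 * 2⁻¹ ^ k * b⁻¹) ^ 2 *
    ((fun y : ℝ => |y|) ⁻¹' Set.Ioc 0 (2 ^ k * b)).indicator (fun y => y ^ 2) y with hF
  have hF0 : ∀ k y, 0 ≤ F k y := fun k y =>
    mul_nonneg (sq_nonneg _) (Set.indicator_nonneg (fun _ _ => sq_nonneg _) y)
  have hFi : ∀ k, Integrable (F k) ν := fun k => (integrable_indicator_abs_sq _).const_mul _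
  have hFint : ∀ k, ∫ y, F k y ∂ν =
      (2 * 2⁻¹ ^ k * b⁻¹ * √(innovH 2 ν h (2 ^ k * b))) ^ 2 := fun k => by
    rw [mul_pow, Real.sq_sqrt (innovH_two_nonneg h _), innovH_two, ← integral_const_mul]
  have hpt : ∀ y, ENNReal.ofReal (min 1 ((b⁻¹ * y) ^ 2)) ≤ ∑' k, ENNReal.ofReal (F k y) := by
    intro y
    rcases eq_or_ne y 0 with rfl | hy0
    · simp
    have hex : ∃ k : ℕ, |y| ≤ 2 ^ k * b := by
      obtain ⟨k, hk⟩ := pow_unbounded_of_one_lt (|y| / b) one_lt_two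
      exact ⟨k, ((div_lt_iff₀ hb).1 hk).le⟩
    classical
    set k := Nat.find hex with hk
    have hky : |y| ≤ 2 ^ k * b := Nat.find_spec hex
    refine le_trans (ENNReal.ofReal_le_ofReal ?_) (ENNReal.le_tsum k)
    simp only [hF]
    rw [Set.indicator_of_mem (show y ∈ (fun y : ℝ => |y|) ⁻¹' Set.Ioc 0 (2 ^ k * b) from
      ⟨abs_pos.2 hy0, hky⟩), ← mul_pow]
    rcases Nat.eq_zero_or_pos k with hk0 | hk0
    · refine (min_le_right _ _).trans ?_
      rw [hk0, pow_zero, mul_one, mul_assoc, mul_pow 2]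
      nlinarith [sq_nonneg (b⁻¹ * y)]
    · refine (min_le_left _ _).trans ?_
      have hlt : 2 ^ (k - 1) * b < |y| := not_le.1 (Nat.find_min hex (by omega))
      rw [one_le_sq_iff_one_le_abs, abs_mul, abs_of_pos (by positivity)]
      have h2k : (2 : ℝ) ^ k = 2 * 2 ^ (k - 1) := by
        rw [← pow_succ', Nat.sub_add_cancel hk0]
      have : (1 : ℝ) = 2 * 2⁻¹ ^ k * b⁻¹ * (2 ^ (k - 1) * b) := by
        rw [inv_pow, h2k]
        field_simp
      rw [this]
      exact mul_le_mul_of_nonneg_left hlt.le (by positivity)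
  rw [← ENNReal.ofReal_le_ofReal_iff (tsum_nonneg fun k => sq_nonneg _),
    ofReal_integral_eq_lintegral_ofReal (integrable_min_one_sq _)
      (Eventually.of_forall fun y => le_min zero_le_one (sq_nonneg _)),
    ENNReal.ofReal_tsum_of_nonneg (fun k => sq_nonneg _) hs2]
  refine (lintegral_mono hpt).trans_eq ?_
  rw [lintegral_tsum fun k => (hFi k).aestronglyMeasurable.aemeasurable.ennreal_ofReal]
  refine tsum_congr fun k => ?_
  rw [← hFint, ofReal_integral_eq_lintegral_ofReal (hFi k) (Eventually.of_forall (hF0 k))]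

end TruncatedMoment

section Blocking

/-- Sums over multiples of `s` of a function that is comparable on blocks of length `3 * s`. -/
lemma sum_range_mul_le_tsum {φ : ℕ → ℝ} (hφ : ∀ i, 0 ≤ φ i) (hs : Summable φ) {C : ℝ} (hC : 0 ≤ C)
    {s j₀ : ℕ} (hs0 : 0 < s)
    (h : ∀ j, j₀ ≤ j → ∀ i ∈ Finset.Ico (3 * s * j) (3 * s * (j + 1)), φ (s * j) ≤ C * φ i) (n : ℕ) :
    ∑ j ∈ Finset.range n, φ (s * (j + j₀)) ≤ C / (3 * s) * ∑' i, φ i := by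
  have key : (3 * s) * ∑ j ∈ Finset.range n, φ (s * (j + j₀)) ≤
      C * ∑ i ∈ Finset.Ico (3 * s * j₀) (3 * s * (n + j₀)), φ i := by
    induction n with
    | zero => simp
    | succ n ih =>
      rw [Finset.sum_range_succ, mul_add (3 * s : ℝ), add_right_comm n 1 j₀,
        ← Finset.sum_Ico_consecutive _ (Nat.mul_le_mul_left _ (Nat.le_add_left j₀ n))
          (Nat.mul_le_mul_left _ (Nat.le_succ (n + j₀))), mul_add C]
      refine add_le_add ih ?_
      rw [Finset.mul_sum]
      refine le_trans (le_of_eq ?_) (Finset.sum_le_sum (h (n + j₀) (Nat.le_add_left _ _)))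
      rw [Finset.sum_const, Nat.card_Ico, ← Nat.mul_sub, Nat.succ_eq_add_one, Nat.add_sub_cancel_left, mul_one,
        nsmul_eq_mul]
      push_cast
      ring
  have hs0' : (0 : ℝ) < 3 * s := by positivity
  have hle := mul_le_mul_of_nonneg_left (hs.sum_le_tsum
    (Finset.Ico (3 * s * j₀) (3 * s * (n + j₀))) fun i _ => hφ i) hC
  rw [div_mul_eq_mul_div, le_div_iff₀ hs0', mul_comm]
  exact key.trans hle

/-- Summation over all dyadic levels, for a sequence that grows regularly. -/
lemma summable_of_dyadic {b : ℕ → ℝ} {H : ℝ → ℝ} {u : ℕ → ℝ} (hH : Monotone H) {j₀ : ℕ} (hj₀ : 0 < j₀) (hb : ∀ j, j₀ ≤ j → 0 < b j)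
    (h2 : ∀ j, j₀ ≤ j → ∀ i, 3 * j ≤ i → i ≤ 6 * j → 2 * b j ≤ b i ∧ b i ≤ 8 * b j)
    (h4 : ∀ j, j₀ ≤ j → b (3 * j) ≤ 4 * b j)
    (hφ0 : ∀ j, 0 ≤ (b j)⁻¹ * √(H (b j)))
    (hs : Summable fun j => (b j)⁻¹ * √(H (b j))) (hu0 : ∀ j, 0 ≤ u j)
    (hu : ∀ j, j₀ ≤ j → Summable (fun k : ℕ => 2 * 2⁻¹ ^ k * (b j)⁻¹ * √(H (2 ^ k * b j))) →
      u j ≤ ∑' k : ℕ, 2 * 2⁻¹ ^ k * (b j)⁻¹ * √(H (2 ^ k * b j))) : Summable u := by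
  set φ : ℕ → ℝ := fun j => (b j)⁻¹ * √(H (b j)) with hφ
  have hpow : ∀ k j : ℕ, j₀ ≤ j → j₀ ≤ 3 ^ k * j := fun k j hj =>
    hj.trans (Nat.le_mul_of_pos_left _ (by positivity))
  have hb3 : ∀ k j : ℕ, j₀ ≤ j → 2 ^ k * b j ≤ b (3 ^ k * j) ∧ b (3 ^ k * j) ≤ 4 ^ k * b j := by
    intro k j hj
    induction k with
    | zero => simp
    | succ k ih =>
      have e : 3 ^ (k + 1) * j = 3 * (3 ^ k * j) := by ring
      have h2' := (h2 _ (hpow k j hj) (3 * (3 ^ k * j)) le_rfl (by omega)).1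
      have h4' := h4 _ (hpow k j hj)
      rw [e, pow_succ, pow_succ]
      constructor <;> linarith [ih.1, ih.2]
  set f : ℕ → ℕ → ℝ := fun k j => 2 * 2⁻¹ ^ k * (b j)⁻¹ * √(H (2 ^ k * b j)) with hf
  have hf0 : ∀ k j, j₀ ≤ j → 0 ≤ f k j := fun k j hj => by
    have := hb j hj
    positivity
  have hfle : ∀ k j, j₀ ≤ j → f k j ≤ 2 * 2 ^ k * φ (3 ^ k * j) := by
    intro k j hj
    have hbj := hb j hj
    have hbk := hb _ (hpow k j hj)
    have h1 : (b j)⁻¹ ≤ 4 ^ k * (b (3 ^ k * j))⁻¹ := by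
      rw [← div_eq_mul_inv, le_div_iff₀ hbk, ← div_eq_inv_mul, div_le_iff₀ hbj]
      exact (hb3 k j hj).2
    calc f k j ≤ 2 * 2⁻¹ ^ k * (4 ^ k * (b (3 ^ k * j))⁻¹) * √(H (b (3 ^ k * j))) := by
          simp only [hf]
          gcongr
          exact hH (hb3 k j hj).1
      _ = _ := by
          have : (4 : ℝ) ^ k = 2 ^ k * 2 ^ k := by rw [← mul_pow]; norm_num
          rw [this, inv_pow, hφ]
          field_simp
  have hsum : ∀ k n, ∑ j ∈ Finset.range n, f k (j + j₀) ≤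
      2 * (8 / 3) * (∑' i, φ i) * (2 / 3) ^ k := by
    intro k n
    have h5 := sum_range_mul_le_tsum (C := 8) (s := 3 ^ k) (j₀ := j₀) hφ0 hs (by norm_num)
      (by positivity) (fun j hj i hi => ?_) n
    · calc _ ≤ ∑ j ∈ Finset.range n, 2 * 2 ^ k * φ (3 ^ k * (j + j₀)) :=
            Finset.sum_le_sum fun j _ => hfle k _ (Nat.le_add_left _ _)
        _ ≤ 2 * 2 ^ k * (8 / (3 * (3 ^ k : ℕ)) * ∑' i, φ i) := by
            rw [← Finset.mul_sum]
            gcongr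
        _ = _ := by
            rw [div_pow]
            push_cast
            field_simp
    · have hi' := Finset.mem_Ico.1 hi
      have hJ := hpow k j hj
      have h6 : i ≤ 6 * (3 ^ k * j) := by
        have : 3 * 3 ^ k * (j + 1) ≤ 6 * (3 ^ k * j) := by
          calc 3 * 3 ^ k * (j + 1) ≤ 3 * 3 ^ k * (2 * j) := Nat.mul_le_mul_left _ (by omega)
            _ = _ := by ring
        omega
      have h7 := h2 _ hJ i (by linarith [hi'.1]) h6
      have hbJ := hb _ hJ
      have hbi : 0 < b i := by linarith [h7.1]
      have h8 : (b (3 ^ k * j))⁻¹ ≤ 8 * (b i)⁻¹ := by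
        rw [← div_eq_mul_inv, le_div_iff₀ hbi, ← div_eq_inv_mul, div_le_iff₀ hbJ]
        exact h7.2
      calc φ (3 ^ k * j) ≤ 8 * (b i)⁻¹ * √(H (b i)) := by
            simp only [hφ]
            gcongr
            exact hH (by linarith [h7.1])
        _ = _ := by rw [mul_assoc]
  have hgeo : Summable fun k : ℕ => 2 * (8 / 3) * (∑' i, φ i) * (2 / 3 : ℝ) ^ k :=
    (summable_geometric_of_lt_one (by norm_num) (by norm_num)).mul_left _
  have hfs : ∀ j, Summable fun k => f k (j + j₀) := fun j =>
    hgeo.of_nonneg_of_le (fun k => hf0 k _ (Nat.le_add_left _ _)) fun k =>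
      (Finset.single_le_sum (f := fun j => f k (j + j₀)) (fun j _ => hf0 k _ (Nat.le_add_left _ _))
        (Finset.self_mem_range_succ j)).trans (hsum k (j + 1))
  rw [← summable_nat_add_iff j₀]
  refine summable_of_sum_range_le (c := ∑' k : ℕ, 2 * (8 / 3) * (∑' i, φ i) * (2 / 3 : ℝ) ^ k)
    (fun j => hu0 _) fun n => ?_
  calc ∑ j ∈ Finset.range n, u (j + j₀) ≤ ∑ j ∈ Finset.range n, ∑' k, f k (j + j₀) :=
        Finset.sum_le_sum fun j _ => hu _ (Nat.le_add_left _ _) (hfs j)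
    _ = ∑' k, ∑ j ∈ Finset.range n, f k (j + j₀) :=
        (Summable.tsum_finsetSum fun j _ => hfs j).symm
    _ ≤ _ := (summable_sum fun j _ => hfs j).tsum_le_tsum (fun k => hsum k n) hgeo

end Blocking

/-- The short memory condition, in terms of truncated second moments. -/
theorem summable_sqrt_integral_min_one_sq {α β : ℝ} (hαβ : α * β = 2) (hβ : 1 ≤ β) {ν : Measure ℝ}
    [IsProbabilityMeasure ν] {h : ℝ → ℝ}
    (hh : α < 2 → ∃ σ₁ σ₂ : ℝ, HasStableTails α ν σ₁ σ₂ h) {ℓ : ℝ → ℝ} (hℓ : IsSlowlyVarying ℓ)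
    (hshort : Summable (fun i : ℕ => coeff β ℓ (i + 1) ^ (α / 2) *
      innovH α ν h ((coeff β ℓ (i + 1))⁻¹) ^ (1 / 2 : ℝ))) :
    Summable fun i : ℕ => √(∫ y, min 1 ((coeff β ℓ (i + 1) * y) ^ 2) ∂ν) := by
  have hpos : ∀ i : ℕ, 0 < i → 0 < coeff β ℓ i := fun i hi => hℓ.coeff_pos β hi
  have hα2 : α ≤ 2 := by nlinarith
  have hgrow := hℓ.eventually_inv_coeff hβ
  rcases hα2.lt_or_eq with hα | rfl
  · obtain ⟨σ₁, σ₂, hν⟩ := hh hα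
    obtain ⟨C, hC, hle⟩ := hν.exists_integral_min_one_sq_le hα
    have hbt : Tendsto (fun j => (coeff β ℓ j)⁻¹) atTop atTop :=
      tendsto_atTop_of_two_mul_le (fun j hj => inv_pos.2 (hpos j hj))
        (hgrow.mono fun j hj i h3 h6 => (hj i h3 h6).1)
    have hev := (hbt.comp (tendsto_add_atTop_nat 1)).eventually hle
    refine Summable.of_norm_bounded_eventually_nat (hshort.mul_left √C) ?_
    filter_upwards [hev] with i hi
    have hci := hpos (i + 1) (Nat.succ_pos i)
    simp only [Function.comp_apply, inv_inv] at hi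
    rw [Real.norm_of_nonneg (Real.sqrt_nonneg _), innovH, if_pos hα]
    refine (Real.sqrt_le_sqrt hi).trans_eq ?_
    rw [Real.sqrt_mul hC, Real.rpow_neg (inv_pos.2 hci).le, Real.inv_rpow hci.le, inv_inv,
      Real.sqrt_mul (Real.rpow_pos_of_pos hci _).le, Real.sqrt_eq_rpow (_ ^ _), ← Real.rpow_mul hci.le,
      Real.sqrt_eq_rpow (h _), mul_one_div]
  · have hβ1 : β = 1 := by linarith
    subst hβ1
    obtain ⟨j₀, hj₀⟩ := eventually_atTop.1 (hgrow.and (eventually_gt_atTop 0))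
    have hj₀' : 0 < j₀ := (hj₀ j₀ le_rfl).2
    rw [summable_nat_add_iff (f := fun i : ℕ => √(∫ y, min 1 ((coeff 1 ℓ i * y) ^ 2) ∂ν)) 1]
    have hc0 : coeff 1 ℓ 0 = 0 := by simp [coeff, Real.zero_rpow]
    have hnn : ∀ j, 0 ≤ coeff 1 ℓ j := fun j => by
      rcases Nat.eq_zero_or_pos j with rfl | hj
      · exact hc0.ge
      · exact (hpos j hj).le
    refine summable_of_dyadic (b := fun j => (coeff 1 ℓ j)⁻¹) (H := innovH 2 ν h)
      (innovH_two_mono h) hj₀' (fun j hj => inv_pos.2 (hpos j (hj₀'.trans_le hj)))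
      (fun j hj i h3 h6 => ⟨((hj₀ j hj).1 i h3 h6).1, ((hj₀ j hj).1 i h3 h6).2.trans ?_⟩)
      (fun j hj => ((hj₀ j hj).1 (3 * j) le_rfl (by omega)).2.trans_eq ?_)
      (fun j => mul_nonneg (by simpa using hnn j) (Real.sqrt_nonneg _)) ?_
      (fun j => Real.sqrt_nonneg _) (fun j hj hsj => ?_)
    · have hj0 := (hj₀ j hj).2
      have hj0' : (0 : ℝ) < j := by exact_mod_cast hj0
      have h6' : (i : ℝ) / j ≤ 6 := by
        rw [div_le_iff₀ hj0']
        exact_mod_cast h6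
      rw [Real.rpow_one]
      refine mul_le_mul_of_nonneg_right ?_ (inv_nonneg.2 (hnn j))
      linarith
    · have hj0' : (j : ℝ) ≠ 0 := by exact_mod_cast (hj₀ j hj).2.ne'
      rw [Real.rpow_one]
      push_cast
      field_simp
    · rw [← summable_nat_add_iff 1]
      refine hshort.congr fun i => ?_
      rw [inv_inv, div_self two_ne_zero, Real.rpow_one, Real.sqrt_eq_rpow]
    · have := sqrt_integral_min_one_sq_le_tsum h (inv_pos.2 (hpos j (hj₀'.trans_le hj))) hsj
      simpa only [inv_inv] using this

lemma summable_of_summable_min_one {x : ℕ → ℝ} (h : Summable fun i => min 1 |x i|) :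
    Summable x := by
  refine Summable.of_norm_bounded_eventually_nat h ?_
  filter_upwards [h.tendsto_atTop_zero.eventually_lt_const one_pos] with i hi
  rw [Real.norm_eq_abs, min_eq_right]
  by_contra hcon
  rw [min_eq_left (not_le.1 hcon).le] at hi
  exact lt_irrefl _ hi

lemma integral_min_one_abs_le {ν : Measure ℝ} [IsProbabilityMeasure ν] (a : ℝ) :
    ∫ y, min 1 |a * y| ∂ν ≤ √(∫ y, min 1 ((a * y) ^ 2) ∂ν) := by
  have hm : MemLp (fun y : ℝ => min 1 |a * y|) 2 ν :=
    MemLp.of_bound (by fun_prop) 1 (Eventually.of_forall fun y => by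
      rw [Real.norm_of_nonneg (le_min zero_le_one (abs_nonneg _))]
      exact min_le_left _ _)
  have h1 := integral_abs_le_lpNorm_two hm
  rw [lpNorm_two_eq_sqrt hm.aestronglyMeasurable] at h1
  have h2 : ∀ y, |min 1 (|a * y|)| = min 1 |a * y| := fun y =>
    abs_of_nonneg (le_min zero_le_one (abs_nonneg _))
  have h3 : ∀ y, min 1 |a * y| ^ 2 = min 1 ((a * y) ^ 2) := fun y => by
    rcases le_total 1 |a * y| with hy | hy
    · rw [min_eq_left hy, min_eq_left (one_le_sq_iff_one_le_abs _ |>.2 hy), one_pow]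
    · rw [min_eq_right hy, min_eq_right (sq_le_one_iff_abs_le_one _ |>.2 hy), sq_abs]
  simpa only [h2, h3] using h1

/-- The series of the linear process converges absolutely almost surely. -/
theorem IsIIDSequence.ae_summable {Ω : Type*} {mΩ : MeasurableSpace Ω} {P : Measure Ω}
    {ε : ℤ → Ω → ℝ} {a : ℕ → ℝ} {ν : Measure ℝ} [IsProbabilityMeasure ν]
    (h : IsIIDSequence ε ν P) (hsum : Summable fun i => √(∫ y, min 1 ((a i * y) ^ 2) ∂ν)) (n : ℤ) :
    ∀ᵐ ω ∂P, Summable fun i : ℕ => a i * ε (n - i) ω := by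
  have hint : ∀ c : ℝ, Integrable (fun y : ℝ => min 1 |c * y|) ν := fun c =>
    Integrable.of_bound (by fun_prop) 1 (Eventually.of_forall fun y => by
      rw [Real.norm_of_nonneg (le_min zero_le_one (abs_nonneg _))]
      exact min_le_left _ _)
  have hmeas : ∀ i : ℕ, Measurable fun ω => ENNReal.ofReal (min 1 |a i * ε (n - i) ω|) :=
    fun i => (measurable_const.min ((h.measurable _).const_mul _).abs).ennreal_ofReal
  have hterm : ∀ i : ℕ, ∫⁻ ω, ENNReal.ofReal (min 1 |a i * ε (n - i) ω|) ∂P ≤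
      ENNReal.ofReal √(∫ y, min 1 ((a i * y) ^ 2) ∂ν) := by
    intro i
    rw [← lintegral_map (f := fun y => ENNReal.ofReal (min 1 |a i * y|)) (by fun_prop)
      (h.measurable (n - i)), (h.hasLaw _).map_eq, ← ofReal_integral_eq_lintegral_ofReal (hint _)
        (Eventually.of_forall fun y => le_min zero_le_one (abs_nonneg _))]
    exact ENNReal.ofReal_le_ofReal (integral_min_one_abs_le _)
  have hfin : ∫⁻ ω, ∑' i : ℕ, ENNReal.ofReal (min 1 |a i * ε (n - i) ω|) ∂P ≠ ⊤ := by
    rw [lintegral_tsum fun i => (hmeas i).aemeasurable]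
    refine ne_top_of_le_ne_top ?_ (ENNReal.tsum_le_tsum hterm)
    rw [← ENNReal.ofReal_tsum_of_nonneg (fun i => Real.sqrt_nonneg _) hsum]
    exact ENNReal.ofReal_ne_top
  filter_upwards [ae_lt_top (Measurable.tsum hmeas) hfin] with ω hω
  refine summable_of_summable_min_one ?_
  have := ENNReal.summable_toReal hω.ne
  refine this.congr fun i => ENNReal.toReal_ofReal (le_min zero_le_one (abs_nonneg _))

/-- The central limit theorem for functionals of a linear process with short memory. -/
theorem exists_tendsto_of_linearProcess {Ω : Type*} {mΩ : MeasurableSpace Ω} {P : Measure Ω}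
    [IsProbabilityMeasure P] {ε : ℤ → Ω → ℝ} {a : ℕ → ℝ} {ν : Measure ℝ} {K : ℝ → ℝ} {C : ℝ≥0}
    {J : ℕ} (h : IsIIDSequence ε ν P) (hC : SmoothingHead P a ε C J)
    (hs : ∀ n : ℤ, ∀ᵐ ω ∂P, Summable fun i : ℕ => a i * ε (n - i) ω)
    (hsum : Summable fun i => √(∫ y, min 1 ((a i * y) ^ 2) ∂ν))
    (hK : Measurable K) (hK1 : Integrable K) (hK2 : MemLp K 2) :
    ∃ θ : ℝ, Tendsto (fun N : ℕ => (N : ℝ)⁻¹ * ∫ ω, (∑ n ∈ Finset.range N,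
        (K (tailSum a ε n 0 ω) - ∫ ω', K (tailSum a ε 0 0 ω') ∂P)) ^ 2 ∂P) atTop (𝓝 (θ ^ 2)) ∧
      ∀ (I : Finset ℝ≥0) (c : I → ℝ),
        Tendsto (fun N : ℕ => charFun (P.map fun ω =>
          ∑ i, c i * ∑ n ∈ Finset.range ⌊(N : ℝ) * (i : ℝ≥0)⌋₊,
            (K (tailSum a ε n 0 ω) - ∫ ω', K (tailSum a ε 0 0 ω') ∂P)) (√N)⁻¹) atTop
        (𝓝 (Complex.exp (-(θ ^ 2 * (∑ i, ∑ j, c i * c j *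
          min ((i : ℝ≥0) : ℝ) ((j : ℝ≥0) : ℝ)) / 2 : ℝ)))) := by
  have hKX : ∀ n : ℤ, MemLp (fun ω => K (tailSum a ε n 0 ω)) 2 P := fun n =>
    memLp_comp_of_le_volume (measurable_tailSum (a := a) h.measurable n 0).aemeasurable
      hK2 (isSmoothing_map_tailSum_zero h hC hs n).le_volume
  refine exists_tendsto_charFun_of_blocks (S := fun N ω => ∑ n ∈ Finset.range N,
    (K (tailSum a ε n 0 ω) - ∫ ω', K (tailSum a ε 0 0 ω') ∂P))
    (fun N => memLp_finsetSum _ fun n _ => (hKX n).sub (memLp_const _)) fun η hη => ?_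
  obtain ⟨p, R, -, happ⟩ := exists_blockSum_approx h hC hs hsum hK hK1 hK2 hη
  exact ⟨p, R, blockSum P K a ε p, ⟨memLp_blockSum h hs hK hKX p,
    integral_blockSum h hs hK hKX p, h.identDistrib_blockSum hK p, h.indepFun_blockSum hK p⟩, happ⟩

theorem mainTheorem4 {Ω : Type*} [MeasurableSpace Ω] (P : Measure Ω)
    [IsProbabilityMeasure P]
    -- the exponents
    (α β : ℝ) (hαβ : α * β = 2) (hβ : 1 ≤ β)
    -- the i.i.d. innovations, with law `ν`
    (ν : Measure ℝ) [IsProbabilityMeasure ν] (ε : ℤ → Ω → ℝ)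
    (hε_meas : ∀ n, Measurable (ε n)) (hε_law : ∀ n, HasLaw (ε n) ν P)
    (hε_indep : iIndepFun ε P)
    (hν : InDomainOfAttraction α ν)
    (hν_symm : α = 1 → ν.map (fun y : ℝ => -y) = ν)
    (hν_cent : 1 < α → Integrable (fun y : ℝ => y) ν ∧ ∫ y, y ∂ν = 0)
    -- the slowly varying function of the tails (for `α = 2`, `innovH` does not involve `h`)
    (h : ℝ → ℝ) (hh : α < 2 → ∃ σ₁ σ₂ : ℝ, HasStableTails α ν σ₁ σ₂ h)
    -- the slowly varying function of the coefficients
    (ℓ : ℝ → ℝ) (hℓ : IsSlowlyVarying ℓ)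
    -- the functional: integrable and square integrable
    (K : ℝ → ℝ) (hK1 : Integrable K) (hK2 : MemLp K 2)
    -- decay of the characteristic function of the innovations
    (hφ : ∃ c δ : ℝ, 0 < c ∧ 0 < δ ∧ ∀ u : ℝ, ‖charFun ν u‖ ≤ c / (1 + |u| ^ δ))
    -- short memory
    (hshort : Summable (fun i : ℕ => coeff β ℓ (i + 1) ^ (α / 2) *
      innovH α ν h ((coeff β ℓ (i + 1))⁻¹) ^ (1 / 2 : ℝ))) :
    -- the process and the variances of the partial sums are well defined
    (∀ n : ℕ, ∀ᵐ ω ∂P,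
      Summable (fun i : ℕ => coeff β ℓ (i + 1) * ε ((n : ℤ) - ((i : ℤ) + 1)) ω)) ∧
    (∀ n : ℕ, MemLp (fun ω => K (linearProcess (coeff β ℓ) ε n ω)) 2 P) ∧
    ∃ θ : ℝ,
      Tendsto (fun N : ℕ =>
        (N : ℝ)⁻¹ * Var[partialSum P K (linearProcess (coeff β ℓ) ε) N; P]) atTop (𝓝 (θ ^ 2)) ∧
      ∀ (Ω' : Type*) [MeasurableSpace Ω'] (P' : Measure Ω') [IsProbabilityMeasure P']
        (W : ℝ≥0 → Ω' → ℝ), IsBrownianReal W P' →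
        TendstoFDD
          (fun N t ω => (N : ℝ) ^ (-(1 / 2) : ℝ) *
            partialSum P K (linearProcess (coeff β ℓ) ε) ⌊(N : ℝ) * (t : ℝ)⌋₊ ω)
          (fun t ω => |θ| * W t ω) P P' := by
  set a : ℕ → ℝ := fun i => coeff β ℓ (i + 1) with ha
  have hseq : IsIIDSequence ε ν P := ⟨hε_meas, hε_law, hε_indep⟩
  have hsum : Summable fun i => √(∫ y, min 1 ((a i * y) ^ 2) ∂ν) :=
    summable_sqrt_integral_min_one_sq hαβ hβ hh hℓ hshort
  have hs : ∀ n : ℤ, ∀ᵐ ω ∂P, Summable fun i : ℕ => a i * ε (n - i) ω := hseq.ae_summable hsum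
  obtain ⟨C, J, hC⟩ := hseq.exists_isSmoothing_headSum_add (a := a)
    (fun i => (hℓ.coeff_pos β (Nat.succ_pos i)).ne') hφ
  have hX : ∀ n : ℤ, Measurable (tailSum a ε n 0) := fun n => measurable_tailSum hε_meas n 0
  have hvol : ∀ n : ℤ, P.map (tailSum a ε n 0) ≤ C • (volume : Measure ℝ) := fun n =>
    (isSmoothing_map_tailSum_zero hseq hC hs n).le_volume
  have hidx : ∀ (n : ℤ) (i : ℕ), n - ((i : ℤ) + 1) = n - 1 - i := fun n i => by ring
  have hlin : ∀ n : ℕ, linearProcess (coeff β ℓ) ε n = tailSum a ε ((n : ℤ) - 1) 0 := by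
    intro n
    ext ω
    simp only [linearProcess, tailSum, hidx, ha, add_zero, Nat.cast_zero, sub_zero]
  have hK1m := hK1.aestronglyMeasurable
  set K' : ℝ → ℝ := hK1m.mk K with hK'
  have hK'm : Measurable K' := hK1m.measurable_mk
  have hKK' : K =ᵐ[volume] K' := hK1m.ae_eq_mk
  have hcomp : ∀ n : ℤ, (fun ω => K (tailSum a ε n 0 ω)) =ᵐ[P] fun ω => K' (tailSum a ε n 0 ω) :=
    fun n => ae_of_ae_map (hX n).aemeasurable
      (((Measure.absolutelyContinuous_of_le (hvol n)).trans
        (Measure.smul_absolutelyContinuous (c := (C : ENNReal)))).ae_le hKK')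
  have hmean : ∀ n : ℤ, ∫ ω, K (tailSum a ε n 0 ω) ∂P = ∫ ω, K' (tailSum a ε 0 0 ω) ∂P := fun n =>
    (integral_congr_ae (hcomp n)).trans
      ((hseq.identDistrib_tailSum (a := a) n 0).comp hK'm).integral_eq
  have hmem : ∀ n : ℤ, MemLp (fun ω => K (tailSum a ε n 0 ω)) 2 P := fun n =>
    memLp_comp_of_le_volume (hX n).aemeasurable hK2 (hvol n)
  have hS : ∀ N : ℕ, partialSum P K (linearProcess (coeff β ℓ) ε) N =ᵐ[P] fun ω =>
      ∑ n ∈ Finset.range N, (K' (tailSum a ε n 0 ω) - ∫ ω', K' (tailSum a ε 0 0 ω') ∂P) := by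
    intro N
    have hall : ∀ᵐ ω ∂P, ∀ n : ℕ, K (tailSum a ε n 0 ω) = K' (tailSum a ε n 0 ω) :=
      ae_all_iff.2 fun n => hcomp n
    filter_upwards [hall] with ω hω
    simp only [partialSum, hlin, hmean]
    rw [← Finset.Ico_add_one_right_eq_Icc, Finset.sum_Ico_eq_sum_range, Nat.add_sub_cancel]
    refine Finset.sum_congr rfl fun n _ => ?_
    rw [← hω n, Nat.cast_add, Nat.cast_one, add_sub_cancel_left]
  refine ⟨fun n => ?_, fun n => ?_, ?_⟩
  · simpa only [hidx] using hs ((n : ℤ) - 1)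
  · rw [hlin]
    exact hmem _
  obtain ⟨θ, hθ, hchar⟩ := exists_tendsto_of_linearProcess hseq hC hs hsum hK'm
    (hK1.congr hKK') ((memLp_congr_ae hKK').1 hK2)
  have hSm : ∀ N : ℕ, AEMeasurable (partialSum P K (linearProcess (coeff β ℓ) ε) N) P := fun N =>
    ⟨_, Finset.measurable_fun_sum _ fun (n : ℕ) _ => (hK'm.comp (hX (n : ℤ))).sub_const _, hS N⟩
  refine ⟨θ, hθ.congr fun N => ?_, fun Ω' _ P' _ W hW => ?_⟩
  · have hint : ∀ n : ℕ, Integrable (fun ω => K' (tailSum a ε n 0 ω)) P := fun n =>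
      ((hmem n).integrable one_le_two).congr (hcomp n)
    rw [variance_of_integral_eq_zero (hSm N)]
    · congr 1
      exact integral_congr_ae ((hS N).mono fun ω hω => by simp only [hω])
    · have hint' : ∀ n ∈ Finset.range N, Integrable (fun ω => K' (tailSum a ε n 0 ω) -
          ∫ ω', K' (tailSum a ε 0 0 ω') ∂P) P := fun n _ => (hint n).sub (integrable_const _)
      rw [integral_congr_ae (hS N), integral_finsetSum _ hint']
      refine Finset.sum_eq_zero fun n _ => ?_
      rw [integral_sub (hint n) (integrable_const _), ← integral_congr_ae (hcomp n), hmean]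
      simp
  · refine tendstoFDD_of_tendsto_charFun hSm (fun I c => (hchar I c).congr fun N => ?_)
      hW.toIsPreBrownianReal
    congr 1
    refine Measure.map_congr ?_
    have hall : ∀ᵐ ω ∂P, ∀ M : ℕ, partialSum P K (linearProcess (coeff β ℓ) ε) M ω =
        ∑ n ∈ Finset.range M, (K' (tailSum a ε n 0 ω) - ∫ ω', K' (tailSum a ε 0 0 ω') ∂P) :=
      ae_all_iff.2 hS
    filter_upwards [hall] with ω hω
    simp only [hω]
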